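/- There is an algorithm, i.e. a fixed program for a random access machine with words of $O(\log n)$ bits and unit-cost instructions, and a constant $C$ with the following property. Let $G$ be a graph with $n$ vertices and maximum degree at most $3$ (not necessarily connected), given by the list of its edges in arbitrary order together with a proper $3$-edge-coloring of $G$, with color classes (matchings) $M_1, M_2, M_3$. Then the program halts after at most $C(n+1)$ steps, that is, in $O(n)$ time, and outputs a straight-line RAC drawing of $G$ whose vertices lie on the integer grid $\{0,\dots,Cn\}\times\{0,\dots,Cn\}$, hence of area $O(n^2)$. Here a straight-line RAC drawing places the vertices at distinct points of the plane and draws the edges as line segments so that no edge passes through a vertex other than its ends and any two edges that cross do so at a right angle. In the drawing all edges of $M_2$ are crossing-free; in each connected component of $G$ all edges of $M_1$ except possibly one are horizontal, all edges of $M_3$ except possibly one are vertical, and these exceptional edges are crossing-free. -/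

import Mathlib

/-! ### A word RAM: fixed program, registers and arrays of words, unit-cost instructions -/

namespace WordRAM

/-- Memory content: `reg r` is the content of register `r`, and `arr a i` is cell number `i` of
array number `a`. Words are natural numbers; the bound on the word size is imposed by `Exec`. -/
structure State where
  reg : ℕ → ℕ
  arr : ℕ → ℕ → ℕ

/-- Write the word `x` into register `r`. -/
def State.setReg (s : State) (r x : ℕ) : State :=
  { s with reg := fun r' => if r' = r then x else s.reg r' }

/-- Write the word `x` into cell `i` of array `a`. -/
def State.setArr (s : State) (a i x : ℕ) : State :=
  { s with arr := fun a' i' => if a' = a ∧ i' = i then x else s.arr a' i' }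

/-- Arithmetic expressions. There is no multiplication, division or bit operation. -/
inductive Expr where
  | const (k : ℕ)
  | reg (r : ℕ)
  | load (a : ℕ) (i : Expr)
  | add (e f : Expr)
  | sub (e f : Expr)

/-- The value of an expression (`sub` is truncated subtraction). -/
def Expr.eval (s : State) : Expr → ℕ
  | .const k => k
  | .reg r => s.reg r
  | .load a i => s.arr a (i.eval s)
  | .add e f => e.eval s + f.eval s
  | .sub e f => e.eval s - f.eval s

/-- Number of elementary steps for evaluating an expression: one per constant, register access,
array access and arithmetic operation. -/
def Expr.cost : Expr → ℕ
  | .const _ => 1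
  | .reg _ => 1
  | .load _ i => i.cost + 1
  | .add e f => e.cost + f.cost + 1
  | .sub e f => e.cost + f.cost + 1

/-- Tests, used as guards of conditionals and loops. -/
inductive Test where
  | lt (e f : Expr)
  | eq (e f : Expr)
  | not (b : Test)
  | and (b c : Test)
  | or (b c : Test)

/-- Truth of a test in a state. -/
def Test.holds (s : State) : Test → Prop
  | .lt e f => e.eval s < f.eval s
  | .eq e f => e.eval s = f.eval s
  | .not b => ¬ b.holds s
  | .and b c => b.holds s ∧ c.holds s
  | .or b c => b.holds s ∨ c.holds s

/-- Number of elementary steps for evaluating a test. -/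
def Test.cost : Test → ℕ
  | .lt e f => e.cost + f.cost + 1
  | .eq e f => e.cost + f.cost + 1
  | .not b => b.cost + 1
  | .and b c => b.cost + c.cost + 1
  | .or b c => b.cost + c.cost + 1

/-- Programs. A program is a finite object; it mentions only finitely many registers, arrays and
constants, none of which depends on the input. -/
inductive Program where
  | skip
  | set (r : ℕ) (e : Expr)
  | store (a : ℕ) (i e : Expr)
  | seq (p q : Program)
  | ite (b : Test) (p q : Program)
  | while (b : Test) (p : Program)

/-- `Exec W p s t s'`: on a machine whose words hold the numbers `0, …, W`, the program `p`
started in state `s` halts after exactly `t` elementary steps in state `s'`, and every word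
written and every address written to on the way is at most `W`.
(An instruction whose result or address exceeds `W` has no execution.
The value of a subexpression exceeds the stored words by at most a constant factor, which depends
only on the program.) -/
inductive Exec (W : ℕ) : Program → State → ℕ → State → Prop where
  | skip (s : State) : Exec W .skip s 1 s
  | set (s : State) (r : ℕ) (e : Expr) (he : e.eval s ≤ W) :
      Exec W (.set r e) s (e.cost + 1) (s.setReg r (e.eval s))
  | store (s : State) (a : ℕ) (i e : Expr) (hi : i.eval s ≤ W) (he : e.eval s ≤ W) :
      Exec W (.store a i e) s (i.cost + e.cost + 1) (s.setArr a (i.eval s) (e.eval s))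
  | seq {p q : Program} {s s' s'' : State} {t t' : ℕ}
      (hp : Exec W p s t s') (hq : Exec W q s' t' s'') :
      Exec W (.seq p q) s (t + t') s''
  | iteTrue {b : Test} {p q : Program} {s s' : State} {t : ℕ}
      (hb : b.holds s) (hp : Exec W p s t s') :
      Exec W (.ite b p q) s (b.cost + 1 + t) s'
  | iteFalse {b : Test} {p q : Program} {s s' : State} {t : ℕ}
      (hb : ¬ b.holds s) (hq : Exec W q s t s') :
      Exec W (.ite b p q) s (b.cost + 1 + t) s'
  | whileTrue {b : Test} {p : Program} {s s' s'' : State} {t t' : ℕ}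
      (hb : b.holds s) (hp : Exec W p s t s') (hw : Exec W (.while b p) s' t' s'') :
      Exec W (.while b p) s (b.cost + 1 + t + t') s''
  | whileFalse {b : Test} {p : Program} {s : State} (hb : ¬ b.holds s) :
      Exec W (.while b p) s (b.cost + 1) s

end WordRAM

/-! ### Straight-line right-angle-crossing drawings -/

namespace RAC

/-- The Euclidean plane. -/
abbrev Plane : Type := EuclideanSpace ℝ (Fin 2)

/-- The vertex positions with natural number coordinates `X v`, `Y v`. -/
noncomputable def gridPos {V : Type*} (X Y : V → ℕ) (v : V) : Plane :=
  !₂[(X v : ℝ), (Y v : ℝ)]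

/-- The straight-line edges `uv` and `u'v'` are distinct and have a common interior point. -/
def Crosses {V : Type*} (p : V → Plane) (u v u' v' : V) : Prop :=
  s(u, v) ≠ s(u', v') ∧
    (openSegment ℝ (p u) (p v) ∩ openSegment ℝ (p u') (p v')).Nonempty

/-- The straight-line edge `uv` is crossed by no edge of `G`. -/
def CrossingFree {V : Type*} (G : SimpleGraph V) (p : V → Plane) (u v : V) : Prop :=
  ∀ u' v' : V, G.Adj u' v' → ¬ Crosses p u v u' v'

/-- Placing every vertex `v` at the point `p v` and drawing the edges as line segments is a
straight-line RAC drawing of `G`: vertices are distinct points, no edge passes through a vertex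
other than its ends, and any two edges that cross do so at a right angle.
(By the first two conditions no two edges overlap, and edges with a common end do not cross.) -/
structure IsRACDrawing {V : Type*} (G : SimpleGraph V) (p : V → Plane) : Prop where
  injective : Function.Injective p
  avoids : ∀ u v w : V, G.Adj u v → w ≠ u → w ≠ v → p w ∉ segment ℝ (p u) (p v)
  rightAngle : ∀ u v u' v' : V, G.Adj u v → G.Adj u' v' → Crosses p u v u' v' →
    inner ℝ (p v - p u) (p v' - p u') = 0

/-- The segment between the positions of `u` and `v` is horizontal. -/
def Horizontal {V : Type*} (p : V → Plane) (u v : V) : Prop := p u 1 = p v 1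

/-- The segment between the positions of `u` and `v` is vertical. -/
def Vertical {V : Type*} (p : V → Plane) (u v : V) : Prop := p u 0 = p v 0

/-- A proper 3-edge-coloring: distinct edges with a common end have distinct colors. The color
classes of `0`, `1`, `2` are three matchings `M₁`, `M₂`, `M₃`. -/
abbrev EdgeColoring {V : Type*} (G : SimpleGraph V) : Type _ := G.lineGraph.Coloring (Fin 3)

/-- How the drawing reflects the coloring: `M₁` is drawn horizontally and `M₃` vertically, up to
at most one exceptional edge of each in every connected component; the edges of `M₂` and the
exceptional edges are crossing-free. -/
structure RespectsColoring {V : Type*} (G : SimpleGraph V) (c : EdgeColoring G)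
    (p : V → Plane) : Prop where
  middle_free : ∀ (u v : V) (h : G.Adj u v), c ⟨s(u, v), h⟩ = 1 → CrossingFree G p u v
  first_horizontal : ∀ (u v : V) (h : G.Adj u v), c ⟨s(u, v), h⟩ = 0 →
    Horizontal p u v ∨ CrossingFree G p u v
  first_unique : ∀ (u v u' v' : V) (h : G.Adj u v) (h' : G.Adj u' v'),
    c ⟨s(u, v), h⟩ = 0 → c ⟨s(u', v'), h'⟩ = 0 → G.Reachable u u' →
    ¬ Horizontal p u v → ¬ Horizontal p u' v' → s(u, v) = s(u', v')
  last_vertical : ∀ (u v : V) (h : G.Adj u v), c ⟨s(u, v), h⟩ = 2 →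
    Vertical p u v ∨ CrossingFree G p u v
  last_unique : ∀ (u v u' v' : V) (h : G.Adj u v) (h' : G.Adj u' v'),
    c ⟨s(u, v), h⟩ = 2 → c ⟨s(u', v'), h'⟩ = 2 → G.Reachable u u' →
    ¬ Vertical p u v → ¬ Vertical p u' v' → s(u, v) = s(u', v')

/-! ### Input of the drawing algorithm -/

/-- A representation of an edge-colored graph on the vertices `0, …, n - 1` as a list of its `m`
edges: edge number `i` joins `src i` and `tgt i`. Every edge is listed exactly once; the order of
the list and the order of the two ends of an edge are arbitrary. -/
structure EdgeList {n : ℕ} (G : SimpleGraph (Fin n)) (m : ℕ) where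
  edge : Fin m ≃ G.edgeSet
  src : Fin m → Fin n
  tgt : Fin m → Fin n
  ends : ∀ i, (edge i : Sym2 (Fin n)) = s(src i, tgt i)

/-- The initial memory content: `n` and `m` in the registers `0` and `1`; the two ends and the
color of edge number `i` in cell `i` of the arrays `0`, `1`, `2`; zero everywhere else. -/
def EdgeList.input {n m : ℕ} {G : SimpleGraph (Fin n)} (L : EdgeList G m) (c : EdgeColoring G) :
    WordRAM.State where
  reg := fun r => if r = 0 then n else if r = 1 then m else 0
  arr := fun a i =>
    if h : i < m then
      if a = 0 then (L.src ⟨i, h⟩ : ℕ)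
      else if a = 1 then (L.tgt ⟨i, h⟩ : ℕ)
      else if a = 2 then (c (L.edge ⟨i, h⟩) : ℕ)
      else 0
    else 0

end RAC

/-! The colored graph is first completed to a cubic one: take four copies of `G` and, where color
`i` is missing at a vertex, join its copies by the perfect matching `quad i` of K₄ (`copies`).
Restricting a drawing of the result to the first copies draws `G`, so each color class may be taken
to be a perfect matching `f i`.

Give every `f 0`-edge a row and every `f 2`-edge a column of its own. Colors 0 and 2 are then
horizontal and vertical, and it remains to order rows and columns so that the `f 1`-edges are
crossed by nothing. Rows are numbered along the cycles of colors 0 and 1, so that an `f 1`-edge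
joins consecutive rows (`Rung`, `Link`), except for one closing edge per cycle. Columns are numbered
along the cycles of colors 2 and 1, again with one closing edge per cycle. The two numberings are
interleaved. A later row cycle is started only where a column traversal is about to leave through an
`f 1`-edge; this edge closes the row cycle, lies in two consecutive columns, and its left end is to
the left of all else in the rows of its cycle (`Bracket`, `Closing`). After the first one, column
traversals are started from the rows in increasing order, at the upper end of a link whose lower end
has no column yet. All vertices that get columns later, other than the lower end, are then at least
as high as the upper end, so nothing crosses this link, which closes the column cycle and may span
many columns (`Sweep.start`, `ColWalk.finish`).

Only the closing edge of the first row cycle, the root from `q` to `f 1 q`, fits neither pattern.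
Its ends lie in the lowest row and in the leftmost column; `q` is moved down and `f 1 q` to the
left, so far that all other vertices are strictly on one side of the root (`Layout.sep_root`). This
tilts just the edges from `q` to `f 0 q` and from `f 1 q` to `f 2 (f 1 q)`, the exceptional ones,
which stay crossing-free (`Layout.sep_first`, `Layout.sep_last`). Components are placed along a
diagonal (`Good.union`).

Absence of crossings is always shown by a weakly separating line with integer coefficients (`Sep`).
Each step of a traversal uses up a new row or column, so the counters of rows and columns pay for
the running time. -/

namespace WordRAM

/-! ### Rules for proving that programs halt with given result and time. -/

@[simp] theorem State.setReg_arr (s : State) (r x : ℕ) : (s.setReg r x).arr = s.arr := rfl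

@[simp] theorem State.setArr_reg (s : State) (a i x : ℕ) : (s.setArr a i x).reg = s.reg := rfl

theorem State.setReg_reg (s : State) (r x r' : ℕ) :
    (s.setReg r x).reg r' = if r' = r then x else s.reg r' := rfl

theorem State.setArr_arr (s : State) (a i x a' : ℕ) :
    (s.setArr a i x).arr a' = if a' = a then Function.update (s.arr a') i x else s.arr a' := by
  funext j
  by_cases h : a' = a
  · subst h
    by_cases hj : j = i <;> simp [State.setArr, hj]
  · simp [State.setArr, h]

/-- `p` started in `s` halts, and `Q` holds of the number of steps and the final state. -/
def Run (W : ℕ) (p : Program) (s : State) (Q : ℕ → State → Prop) : Prop :=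
  ∃ t s', Exec W p s t s' ∧ Q t s'

variable {W : ℕ} {p q : Program} {s : State} {Q Q' : ℕ → State → Prop}

theorem Run.mono (h : Run W p s Q) (hQ : ∀ t s', Q t s' → Q' t s') : Run W p s Q' := by
  obtain ⟨t, s', he, hq⟩ := h
  exact ⟨t, s', he, hQ _ _ hq⟩

theorem Run.skip (h : Q 1 s) : Run W .skip s Q := ⟨_, _, .skip s, h⟩

theorem Run.set {r : ℕ} {e : Expr} (he : e.eval s ≤ W)
    (h : Q (e.cost + 1) (s.setReg r (e.eval s))) : Run W (.set r e) s Q :=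
  ⟨_, _, .set s r e he, h⟩

theorem Run.store {a : ℕ} {i e : Expr} (hi : i.eval s ≤ W) (he : e.eval s ≤ W)
    (h : Q (i.cost + e.cost + 1) (s.setArr a (i.eval s) (e.eval s))) :
    Run W (.store a i e) s Q :=
  ⟨_, _, .store s a i e hi he, h⟩

theorem Run.seq (h : Run W p s fun t s' => Run W q s' fun t' s'' => Q (t + t') s'') :
    Run W (.seq p q) s Q := by
  obtain ⟨t, s', he, t', s'', he', hq⟩ := h
  exact ⟨_, _, .seq he he', hq⟩

theorem Run.ite {b : Test} (h₁ : b.holds s → Run W p s fun t => Q (b.cost + 1 + t))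
    (h₂ : ¬ b.holds s → Run W q s fun t => Q (b.cost + 1 + t)) : Run W (.ite b p q) s Q := by
  by_cases hb : b.holds s
  · obtain ⟨t, s', he, hq⟩ := h₁ hb
    exact ⟨_, _, .iteTrue hb he, hq⟩
  · obtain ⟨t, s', he, hq⟩ := h₂ hb
    exact ⟨_, _, .iteFalse hb he, hq⟩

/-- Loop rule: the invariant `I` may speak about the time elapsed; `μ` decreases. -/
theorem Run.loop {b : Test} (I : ℕ → State → Prop) (μ : State → ℕ) (h₀ : I 0 s)
    (step : ∀ t s, I t s → b.holds s →
      Run W p s fun t' s' => I (t + (b.cost + 1) + t') s' ∧ μ s' < μ s)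
    (fin : ∀ t s, I t s → ¬ b.holds s → Q (t + (b.cost + 1)) s) :
    Run W (.while b p) s Q := by
  -- Induction on a bound `k` for `μ`; the time `t` already spent must be general, since `I` refers
  -- to it.
  have key : ∀ k t s, μ s ≤ k → I t s →
      Run W (.while b p) s fun t' s' => Q (t + t') s' := by
    intro k
    induction k with
    | zero =>
      intro t s hk hI
      by_cases hb : b.holds s
      · obtain ⟨t', s', -, -, hlt⟩ := step t s hI hb
        omega
      · exact ⟨_, _, .whileFalse hb, fin t s hI hb⟩
    | succ k ih =>
      intro t s hk hI
      by_cases hb : b.holds s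
      · obtain ⟨t', s', he, hI', hlt⟩ := step t s hI hb
        obtain ⟨t'', s'', he', hq⟩ := ih _ s' (by omega) hI'
        refine ⟨_, _, .whileTrue hb he he', ?_⟩
        convert hq using 1
        omega
      · exact ⟨_, _, .whileFalse hb, fin t s hI hb⟩
  simpa using key (μ s) 0 s le_rfl h₀

end WordRAM

namespace RAC

/-! ### Separating lines, and how they certify a drawing. -/

/-- The segments `uv` and `u'v'` lie on different sides of a line, and not both on it. -/
def Sep (X Y : ℕ → ℕ) (u v u' v' : ℕ) : Prop :=
  ∃ α β κ : ℤ, α * X u + β * Y u ≤ κ ∧ α * X v + β * Y v ≤ κ ∧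
    κ ≤ α * X u' + β * Y u' ∧ κ ≤ α * X v' + β * Y v' ∧
    (α * X u + β * Y u < κ ∨ α * X v + β * Y v < κ ∨
      κ < α * X u' + β * Y u' ∨ κ < α * X v' + β * Y v')

theorem Sep.symm {X Y : ℕ → ℕ} {u v u' v' : ℕ} (h : Sep X Y u v u' v') : Sep X Y u' v' u v := by
  obtain ⟨α, β, κ, h1, h2, h3, h4, h5⟩ := h
  refine ⟨-α, -β, -κ, ?_, ?_, ?_, ?_, ?_⟩ <;> simp only [neg_mul] <;> omega

theorem Sep.swap_left {X Y : ℕ → ℕ} {u v u' v' : ℕ} (h : Sep X Y u v u' v') :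
    Sep X Y v u u' v' := by
  obtain ⟨α, β, κ, h1, h2, h3, h4, h5⟩ := h
  exact ⟨α, β, κ, h2, h1, h3, h4, by omega⟩

theorem Sep.swap_right {X Y : ℕ → ℕ} {u v u' v' : ℕ} (h : Sep X Y u v u' v') :
    Sep X Y u v v' u' := by
  obtain ⟨α, β, κ, h1, h2, h3, h4, h5⟩ := h
  exact ⟨α, β, κ, h1, h2, h4, h3, by omega⟩

/-- A linear form takes at a point of an open segment a mean of its values at the ends. Both weights
are positive, so strictness at a single end will suffice in `Sep.disjoint`. -/
theorem mem_openSegment_form {X Y : ℕ → ℕ} {u v : ℕ} {z : Plane}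
    (hz : z ∈ openSegment ℝ (gridPos X Y u) (gridPos X Y v)) (α β : ℤ) :
    ∃ a b : ℝ, 0 < a ∧ 0 < b ∧ a + b = 1 ∧
      α * z 0 + β * z 1 =
        a * ((α * X u + β * Y u : ℤ) : ℝ) + b * ((α * X v + β * Y v : ℤ) : ℝ) := by
  obtain ⟨a, b, ha, hb, hab, rfl⟩ := hz
  refine ⟨a, b, ha, hb, hab, ?_⟩
  simp [gridPos]
  ring

theorem Sep.disjoint {X Y : ℕ → ℕ} {u v u' v' : ℕ} (h : Sep X Y u v u' v') :
    ¬ (openSegment ℝ (gridPos X Y u) (gridPos X Y v) ∩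
      openSegment ℝ (gridPos X Y u') (gridPos X Y v')).Nonempty := by
  rintro ⟨z, hz, hz'⟩
  obtain ⟨α, β, κ, h1, h2, h3, h4, h5⟩ := h
  obtain ⟨a, b, ha, hb, hab, e⟩ := mem_openSegment_form hz α β
  obtain ⟨a', b', ha', hb', hab', e'⟩ := mem_openSegment_form hz' α β
  generalize α * X u + β * Y u = x at *
  generalize α * X v + β * Y v = y at *
  generalize α * X u' + β * Y u' = x' at *
  generalize α * X v' + β * Y v' = y' at *
  rw [e] at e'
  have g1 : (x : ℝ) ≤ κ := by exact_mod_cast h1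
  have g2 : (y : ℝ) ≤ κ := by exact_mod_cast h2
  have g3 : (κ : ℝ) ≤ x' := by exact_mod_cast h3
  have g4 : (κ : ℝ) ≤ y' := by exact_mod_cast h4
  -- At a common point the two means agree. The four distances to the line then sum to zero with
  -- positive weights, although one of them is positive.
  have k1 : a * (κ - x) + b * (κ - y) + a' * (x' - κ) + b' * (y' - κ) = 0 := by
    have : κ = (a + b) * κ := by rw [hab, one_mul]
    linear_combination (κ : ℝ) * hab - (κ : ℝ) * hab' - e'
  have m1 := mul_nonneg ha.le (sub_nonneg.2 g1)
  have m2 := mul_nonneg hb.le (sub_nonneg.2 g2)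
  have m3 := mul_nonneg ha'.le (sub_nonneg.2 g3)
  have m4 := mul_nonneg hb'.le (sub_nonneg.2 g4)
  rcases h5 with h | h | h | h
  · have : (x : ℝ) < κ := by exact_mod_cast h
    linarith [mul_pos ha (sub_pos.2 this)]
  · have : (y : ℝ) < κ := by exact_mod_cast h
    linarith [mul_pos hb (sub_pos.2 this)]
  · have : (κ : ℝ) < x' := by exact_mod_cast h
    linarith [mul_pos ha' (sub_pos.2 this)]
  · have : (κ : ℝ) < y' := by exact_mod_cast h
    linarith [mul_pos hb' (sub_pos.2 this)]

/-- A simple cubic graph on `0, …, N - 1` as the union of the perfect matchings `f 0, f 1, f 2`. -/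
structure Mates (N : ℕ) (f : Fin 3 → ℕ → ℕ) : Prop where
  lt : ∀ i, ∀ v < N, f i v < N
  invol : ∀ i, ∀ v < N, f i (f i v) = v
  ne_self : ∀ i, ∀ v < N, f i v ≠ v
  ne : ∀ i j, i ≠ j → ∀ v < N, f i v ≠ f j v

/-- `u` and `v` belong to the same closed sets of vertices. -/
def Conn (N : ℕ) (f : Fin 3 → ℕ → ℕ) (u v : ℕ) : Prop :=
  ∀ Z : Set ℕ, (∀ i, ∀ w < N, w ∈ Z → f i w ∈ Z) → u ∈ Z → v ∈ Z

/-- The vertices in `S` and the edges between them are drawn as required. -/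
structure Good (N : ℕ) (f : Fin 3 → ℕ → ℕ) (S : Set ℕ) (X Y : ℕ → ℕ) : Prop where
  inj : ∀ u ∈ S, ∀ v ∈ S, X u = X v → Y u = Y v → u = v
  avoid : ∀ i, ∀ u ∈ S, ∀ w ∈ S, w ≠ u → w ≠ f i u → Sep X Y u (f i u) w w
  par : ∀ i, ∀ u ∈ S, ∀ v ∈ S, v ≠ u → v ≠ f i u → Sep X Y u (f i u) v (f i v)
  mid : ∀ j, j ≠ 1 → ∀ u ∈ S, ∀ v ∈ S, Sep X Y u (f 1 u) v (f j v)
  hor : ∀ u ∈ S, Y u = Y (f 0 u) ∨ ∀ v ∈ S, Sep X Y u (f 0 u) v (f 2 v)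
  ver : ∀ u ∈ S, X u = X (f 2 u) ∨ ∀ v ∈ S, Sep X Y u (f 2 u) v (f 0 v)
  hor_unique : ∀ u ∈ S, ∀ v ∈ S, Conn N f u v → Y u ≠ Y (f 0 u) → Y v ≠ Y (f 0 v) →
    v = u ∨ v = f 0 u
  ver_unique : ∀ u ∈ S, ∀ v ∈ S, Conn N f u v → X u ≠ X (f 2 u) → X v ≠ X (f 2 v) →
    v = u ∨ v = f 2 u

section

variable {n N : ℕ} {G : SimpleGraph (Fin n)} {c : EdgeColoring G} {f : Fin 3 → ℕ → ℕ}
  {φ : Fin n → ℕ} {X Y : ℕ → ℕ}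

theorem exists_color {u v : Fin n} (h : G.Adj u v)
    (hφ : ∀ u v (h : G.Adj u v), φ v = f (c ⟨s(u, v), h⟩) (φ u)) :
    ∃ i, i = c ⟨s(u, v), h⟩ ∧ φ v = f i (φ u) := ⟨_, rfl, hφ u v h⟩

theorem not_crosses_of_sep {u v u' v' : Fin n} (h : Sep X Y (φ u) (φ v) (φ u') (φ v')) :
    ¬ Crosses (gridPos (fun v => X (φ v)) (fun v => Y (φ v))) u v u' v' :=
  fun hc => h.disjoint hc.2

/-- Transfers components of `G` to the cubic graph, where invariance under the matchings is easier
to handle than walks. -/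
theorem conn_of_reachable (hlt : ∀ v, φ v < N)
    (hφ : ∀ u v (h : G.Adj u v), φ v = f (c ⟨s(u, v), h⟩) (φ u))
    {u v : Fin n} (h : G.Reachable u v) : Conn N f (φ u) (φ v) := by
  intro Z hZ hu
  obtain ⟨w⟩ := h
  induction w with
  | nil => exact hu
  | cons hadj _ ih =>
    apply ih
    rw [hφ _ _ hadj]
    exact hZ _ _ (hlt _) hu

/-- Two edges of one color either coincide, possibly with ends exchanged, or share no vertex, and
then `Good.par` separates them. -/
theorem Good.same_color {S : Set ℕ} (hg : Good N f S X Y) (hS : ∀ v, φ v ∈ S)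
    (hinj : Function.Injective φ)
    {u v u' v' : Fin n} {i : Fin 3} (e : φ v = f i (φ u)) (e' : φ v' = f i (φ u'))
    (hm : f i (f i (φ u)) = φ u) :
    ¬ Crosses (gridPos (fun v => X (φ v)) (fun v => Y (φ v))) u v u' v' := by
  intro hc
  by_cases h1 : u' = u
  · subst h1
    have : v' = v := hinj (e'.trans e.symm)
    exact hc.1 (by rw [this])
  by_cases h2 : u' = v
  · subst h2
    have : v' = u := hinj (by rw [e', e, hm])
    exact hc.1 (by rw [this, Sym2.eq_swap])
  refine not_crosses_of_sep ?_ hc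
  rw [e, e']
  exact hg.par i _ (hS _) _ (hS _) (fun h => h1 (hinj h)) (fun h => h2 (hinj (h.trans e.symm)))

/-- The only place where the plane enters: `φ` embeds `G` into the cubic graph respecting colors,
and each requirement on the drawing is read off from a field of `Good`. -/
theorem Good.drawing {S : Set ℕ} (hg : Good N f S X Y) (hf : Mates N f) (hS : ∀ v, φ v ∈ S)
    (hlt : ∀ v, φ v < N) (hinj : Function.Injective φ)
    (hφ : ∀ u v (h : G.Adj u v), φ v = f (c ⟨s(u, v), h⟩) (φ u)) :
    IsRACDrawing G (gridPos (fun v => X (φ v)) (fun v => Y (φ v))) ∧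
      RespectsColoring G c (gridPos (fun v => X (φ v)) (fun v => Y (φ v))) := by
  have c0 : ∀ v : Fin n, gridPos (fun v => X (φ v)) (fun v => Y (φ v)) v 0 = X (φ v) :=
    fun v => by simp [gridPos]
  have c1 : ∀ v : Fin n, gridPos (fun v => X (φ v)) (fun v => Y (φ v)) v 1 = Y (φ v) :=
    fun v => by simp [gridPos]
  have inj : Function.Injective (gridPos (fun v => X (φ v)) (fun v => Y (φ v))) := by
    intro u v h
    have h0 := congrArg (fun z : Plane => z 0) h
    have h1 := congrArg (fun z : Plane => z 1) h
    simp only [c0, c1] at h0 h1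
    exact hinj (hg.inj _ (hS _) _ (hS _) (by exact_mod_cast h0) (by exact_mod_cast h1))
  have mid : ∀ u v (h : G.Adj u v), c ⟨s(u, v), h⟩ = 1 →
      CrossingFree G (gridPos (fun v => X (φ v)) (fun v => Y (φ v))) u v := by
    intro u v h hc u' v' h'
    have e := hφ u v h
    rw [hc] at e
    obtain ⟨j, -, e'⟩ := exists_color h' hφ
    by_cases hj : j = 1
    · subst hj
      exact hg.same_color hS hinj e e' (hf.invol _ _ (hlt _))
    · refine not_crosses_of_sep ?_
      rw [e, e']
      exact hg.mid j hj _ (hS _) _ (hS _)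
  have hor : ∀ u v (h : G.Adj u v), c ⟨s(u, v), h⟩ = 0 →
      Horizontal (gridPos (fun v => X (φ v)) (fun v => Y (φ v))) u v ∨
      CrossingFree G (gridPos (fun v => X (φ v)) (fun v => Y (φ v))) u v := by
    intro u v h hc
    have e := hφ u v h
    rw [hc] at e
    rcases hg.hor _ (hS u) with h1 | h1
    · left
      rw [Horizontal, c1, c1, e, h1]
    · right
      intro u' v' h'
      obtain ⟨j, hj, e'⟩ := exists_color h' hφ
      fin_cases j
      · exact hg.same_color hS hinj e e' (hf.invol _ _ (hlt _))
      · refine not_crosses_of_sep ?_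
        rw [e, e']
        exact (hg.mid 0 (by decide) _ (hS _) _ (hS _)).symm
      · refine not_crosses_of_sep ?_
        rw [e, e']
        exact h1 _ (hS _)
  have ver : ∀ u v (h : G.Adj u v), c ⟨s(u, v), h⟩ = 2 →
      Vertical (gridPos (fun v => X (φ v)) (fun v => Y (φ v))) u v ∨
      CrossingFree G (gridPos (fun v => X (φ v)) (fun v => Y (φ v))) u v := by
    intro u v h hc
    have e := hφ u v h
    rw [hc] at e
    rcases hg.ver _ (hS u) with h1 | h1
    · left
      rw [Vertical, c0, c0, e, h1]
    · right
      intro u' v' h'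
      obtain ⟨j, hj, e'⟩ := exists_color h' hφ
      fin_cases j
      · refine not_crosses_of_sep ?_
        rw [e, e']
        exact h1 _ (hS _)
      · refine not_crosses_of_sep ?_
        rw [e, e']
        exact (hg.mid 2 (by decide) _ (hS _) _ (hS _)).symm
      · exact hg.same_color hS hinj e e' (hf.invol _ _ (hlt _))
  have cross_symm : ∀ u v u' v', Crosses (gridPos (fun v => X (φ v)) (fun v => Y (φ v))) u v u' v' →
      Crosses (gridPos (fun v => X (φ v)) (fun v => Y (φ v))) u' v' u v :=
    fun u v u' v' h => ⟨h.1.symm, by rw [Set.inter_comm]; exact h.2⟩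
  have perp : ∀ u v u' v' (h : G.Adj u v) (h' : G.Adj u' v'), c ⟨s(u, v), h⟩ = 0 →
      c ⟨s(u', v'), h'⟩ = 2 → Crosses (gridPos (fun v => X (φ v)) (fun v => Y (φ v))) u v u' v' →
      inner ℝ (gridPos (fun v => X (φ v)) (fun v => Y (φ v)) v -
        gridPos (fun v => X (φ v)) (fun v => Y (φ v)) u)
        (gridPos (fun v => X (φ v)) (fun v => Y (φ v)) v' -
        gridPos (fun v => X (φ v)) (fun v => Y (φ v)) u') = 0 := by
    intro u v u' v' h h' hc hc' hx
    have h1 := (hor u v h hc).resolve_right fun hh => hh _ _ h' hx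
    have h2 := (ver u' v' h' hc').resolve_right fun hh => hh _ _ h (cross_symm _ _ _ _ hx)
    rw [Horizontal] at h1
    rw [Vertical] at h2
    simp [PiLp.inner_apply, Fin.sum_univ_two, h1, h2]
  refine ⟨⟨inj, ?_, ?_⟩, ⟨mid, hor, ?_, ver, ?_⟩⟩
  · intro u v w h hwu hwv hw
    have e := hφ u v h
    have hs := hg.avoid (c ⟨s(u, v), h⟩) _ (hS u) _ (hS w) (fun h => hwu (hinj h))
      (fun h => hwv (hinj (h.trans e.symm)))
    rw [← e] at hs
    -- The point `w` counts as the degenerate segment from `w` to `w`, whose open segment is `{w}`.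
    refine hs.disjoint ⟨gridPos X Y (φ w), ?_, ?_⟩
    · have hw' := hw
      rw [← insert_endpoints_openSegment] at hw'
      rcases hw' with h | h | h
      · exact absurd (inj h) hwu
      · exact absurd (inj h) hwv
      · exact h
    · rw [openSegment_same]; rfl
  · intro u v u' v' h h' hx
    obtain ⟨i, hi, e⟩ := exists_color h hφ
    obtain ⟨j, hj, e'⟩ := exists_color h' hφ
    by_cases hij : i = j
    · subst hij
      exact absurd hx (hg.same_color hS hinj e e' (hf.invol _ _ (hlt _)))
    by_cases hi1 : i = 1
    · subst hi1
      exact absurd hx (mid u v h hi.symm _ _ h')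
    by_cases hj1 : j = 1
    · subst hj1
      exact absurd (cross_symm _ _ _ _ hx) (mid u' v' h' hj.symm _ _ h)
    -- A crossing pair has colors 0 and 2; neither edge is crossing-free, so neither is exceptional.
    rcases (by fin_cases i <;> fin_cases j <;> simp_all : (i = 0 ∧ j = 2) ∨ (i = 2 ∧ j = 0))
      with ⟨rfl, rfl⟩ | ⟨rfl, rfl⟩
    · exact perp _ _ _ _ h h' hi.symm hj.symm hx
    · rw [real_inner_comm]
      exact perp _ _ _ _ h' h hj.symm hi.symm (cross_symm _ _ _ _ hx)
  · intro u v u' v' h h' hc hc' hr h1 h2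
    have e := hφ u v h
    have e' := hφ u' v' h'
    rw [hc] at e
    rw [hc'] at e'
    rw [Horizontal, c1, c1, e] at h1
    rw [Horizontal, c1, c1, e'] at h2
    rcases hg.hor_unique _ (hS u) _ (hS u') (conn_of_reachable hlt hφ hr)
      (fun h => h1 (by rw [h])) (fun h => h2 (by rw [h])) with h3 | h3
    · have h4 := hinj h3
      subst h4
      rw [hinj (e.trans e'.symm)]
    · rw [← e] at h3
      have h4 := hinj h3
      subst h4
      rw [e, hf.invol _ _ (hlt _)] at e'
      rw [hinj e', Sym2.eq_swap]
  · intro u v u' v' h h' hc hc' hr h1 h2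
    have e := hφ u v h
    have e' := hφ u' v' h'
    rw [hc] at e
    rw [hc'] at e'
    rw [Vertical, c0, c0, e] at h1
    rw [Vertical, c0, c0, e'] at h2
    rcases hg.ver_unique _ (hS u) _ (hS u') (conn_of_reachable hlt hφ hr)
      (fun h => h1 (by rw [h])) (fun h => h2 (by rw [h])) with h3 | h3
    · have h4 := hinj h3
      subst h4
      rw [hinj (e.trans e'.symm)]
    · rw [← e] at h3
      have h4 := hinj h3
      subst h4
      rw [e, hf.invol _ _ (hlt _)] at e'
      rw [hinj e', Sym2.eq_swap]

end

/-! ### Geometry of one component: a layout yields a good drawing. -/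

theorem Sep.of_fst {X Y : ℕ → ℕ} {u v u' v' : ℕ} (κ : ℕ) (h1 : X u ≤ κ) (h2 : X v ≤ κ)
    (h3 : κ ≤ X u') (h4 : κ ≤ X v') (h : X u < κ ∨ X v < κ ∨ κ < X u' ∨ κ < X v') :
    Sep X Y u v u' v' :=
  ⟨1, 0, κ, by omega, by omega, by omega, by omega, by omega⟩

theorem Sep.of_snd {X Y : ℕ → ℕ} {u v u' v' : ℕ} (κ : ℕ) (h1 : Y u ≤ κ) (h2 : Y v ≤ κ)
    (h3 : κ ≤ Y u') (h4 : κ ≤ Y v') (h : Y u < κ ∨ Y v < κ ∨ κ < Y u' ∨ κ < Y v') :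
    Sep X Y u v u' v' :=
  ⟨0, 1, κ, by omega, by omega, by omega, by omega, by omega⟩

/-- The edge from `a` to `f 1 a` leads from a row to the next one, and no column crosses it.
Only one of the two vertices in a row satisfies `up`. -/
structure Link (f : Fin 3 → ℕ → ℕ) (S : Set ℕ) (row col : ℕ → ℕ) (up : ℕ → Prop) (a : ℕ) :
    Prop where
  up : up a
  row_succ : row (f 1 a) = row a + 1
  clear : ∀ w ∈ S, col a < col w ∧ col w < col (f 1 a) ∨ col (f 1 a) < col w ∧ col w < col a →
    row (f 1 a) ≤ row w

/-- The edge from `a` to `f 1 a` closes a cycle of `f 0` and `f 1`. Its ends are the lowest and the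
highest vertex of the cycle, and it is to the left of all other vertices of the cycle. -/
structure Closing (f : Fin 3 → ℕ → ℕ) (S : Set ℕ) (row col : ℕ → ℕ) (a : ℕ) : Prop where
  col_succ : col (f 1 a) = col a + 1
  row_lt : row a < row (f 1 a)
  closed : ∀ w ∈ S, row a ≤ row w → row w ≤ row (f 1 a) →
    row a ≤ row (f 1 w) ∧ row (f 1 w) ≤ row (f 1 a)
  left : ∀ w ∈ S, row a ≤ row w → row w ≤ row (f 1 a) → w = a ∨ col a < col w

/-- Rows and columns for one component. The edge from `q` to `f 1 q` is the root. -/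
structure Layout (N : ℕ) (f : Fin 3 → ℕ → ℕ) (S : Set ℕ) (row col : ℕ → ℕ) (up : ℕ → Prop)
    (sx ex sy ey q : ℕ) : Prop where
  lt : ∀ v ∈ S, v < N
  closed : ∀ i, ∀ v ∈ S, f i v ∈ S
  root_mem : q ∈ S
  row_mem : ∀ v ∈ S, sy < row v ∧ row v ≤ ey
  col_mem : ∀ v ∈ S, sx < col v ∧ col v ≤ ex
  row_mate : ∀ v ∈ S, row (f 0 v) = row v
  col_mate : ∀ v ∈ S, col (f 2 v) = col v
  row_inj : ∀ u ∈ S, ∀ v ∈ S, row u = row v → v = u ∨ v = f 0 u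
  col_inj : ∀ u ∈ S, ∀ v ∈ S, col u = col v → v = u ∨ v = f 2 u
  up_mate : ∀ v ∈ S, up v → ¬ up (f 0 v)
  root_row : row q = sy + 1
  root_col : col (f 1 q) = sx + 1
  edge : ∀ v ∈ S, (Link f S row col up v ∨ Closing f S row col v ∨ v = q) ∨
    (Link f S row col up (f 1 v) ∨ Closing f S row col (f 1 v) ∨ f 1 v = q)

/-- The coordinates for a layout: the ends `q` and `f 1 q` of the root are moved out. -/
structure Coords (f : Fin 3 → ℕ → ℕ) (S : Set ℕ) (row col : ℕ → ℕ) (sx ex sy ey q : ℕ)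
    (X Y : ℕ → ℕ) : Prop where
  fst : ∀ v ∈ S, v ≠ f 1 q → X v = col v + ex
  snd : ∀ v ∈ S, v ≠ q → Y v = row v + ey
  fst_root : X (f 1 q) = 2 * sx + 1
  snd_root : Y q = 2 * sy + 1

section

variable {N : ℕ} {f : Fin 3 → ℕ → ℕ} {S : Set ℕ} {row col : ℕ → ℕ} {up : ℕ → Prop}
  {sx ex sy ey q : ℕ} {X Y : ℕ → ℕ}

/-- The shift by `ex` leaves the interval from `2 * sx` to `sx + ex` empty of regular vertices; `f 1
q` is moved to its left end. This is the form of the coordinates that `omega` can use. -/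
theorem Layout.fst_cases (L : Layout N f S row col up sx ex sy ey q)
    (K : Coords f S row col sx ex sy ey q X Y) {v : ℕ} (hv : v ∈ S) :
    (v = f 1 q ∧ col v = sx + 1 ∧ X v = 2 * sx + 1 ∧ sx < ex) ∨
      (v ≠ f 1 q ∧ X v = col v + ex ∧ sx < col v ∧ col v ≤ ex) := by
  have := L.col_mem v hv
  by_cases h : v = f 1 q
  · left
    have h2 := L.root_col
    subst h
    exact ⟨rfl, h2, K.fst_root, by omega⟩
  · exact .inr ⟨h, K.fst v hv h, this⟩

theorem Layout.snd_cases (L : Layout N f S row col up sx ex sy ey q)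
    (K : Coords f S row col sx ex sy ey q X Y) {v : ℕ} (hv : v ∈ S) :
    (v = q ∧ row v = sy + 1 ∧ Y v = 2 * sy + 1 ∧ sy < ey) ∨
      (v ≠ q ∧ Y v = row v + ey ∧ sy < row v ∧ row v ≤ ey) := by
  have := L.row_mem v hv
  by_cases h : v = q
  · left
    have h2 := L.root_row
    subst h
    exact ⟨rfl, h2, K.snd_root, by omega⟩
  · exact .inr ⟨h, K.snd v hv h, this⟩

theorem Layout.fst_bounds (L : Layout N f S row col up sx ex sy ey q)
    (K : Coords f S row col sx ex sy ey q X Y) {v : ℕ} (hv : v ∈ S) :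
    2 * sx < X v ∧ X v ≤ 2 * ex := by
  rcases L.fst_cases K hv with h | h <;> omega

theorem Layout.snd_bounds (L : Layout N f S row col up sx ex sy ey q)
    (K : Coords f S row col sx ex sy ey q X Y) {v : ℕ} (hv : v ∈ S) :
    2 * sy < Y v ∧ Y v ≤ 2 * ey := by
  rcases L.snd_cases K hv with h | h <;> omega

/-- The gap left by the shifts is as wide as the component, so the line through the moved ends of
the root passes strictly below and to the left of all other vertices. -/
theorem Layout.sep_root (L : Layout N f S row col up sx ex sy ey q)
    (K : Coords f S row col sx ex sy ey q X Y) (hf : Mates N f) {v w : ℕ} (hv : v ∈ S) (hw : w ∈ S)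
    (h : (v ≠ q ∧ v ≠ f 1 q) ∨ (w ≠ q ∧ w ≠ f 1 q)) : Sep X Y q (f 1 q) v w := by
  have hq := L.root_mem
  have hp := L.closed 1 _ hq
  have hqp : f 1 q ≠ q := hf.ne_self 1 q (L.lt _ hq)
  have rp := L.row_mem _ hp
  have cq := L.col_mem _ hq
  have e1 := K.fst q hq hqp.symm
  have e2 := K.snd (f 1 q) hp hqp
  have e3 := K.fst_root
  have e4 := K.snd_root
  set y : ℤ := (row (f 1 q) : ℤ) - (sy + 1) with hy
  set x : ℤ := (col q : ℤ) - (sx + 1) with hx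
  set A : ℤ := (ex : ℤ) - sx with hA
  set B : ℤ := (ey : ℤ) - sy with hB
  have y0 : 0 ≤ y := by omega
  have x0 : 0 ≤ x := by omega
  have xA : x + 1 ≤ A := by omega
  have yB : y + 1 ≤ B := by omega
  -- From `f 1 q` to `q` the coordinates change by `x + A` and `-(y + B)`, so `(y + B, x + A)` is
  -- normal to the root.
  have key : (y + B) * X q + (x + A) * Y q = (y + B) * X (f 1 q) + (x + A) * Y (f 1 q) := by
    rw [e1, e2, e3, e4]
    have h1 : ((col q + ex : ℕ) : ℤ) = x + (sx + 1 + ex) := by push_cast; omega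
    have h2 : ((row (f 1 q) + ey : ℕ) : ℤ) = y + (sy + 1 + ey) := by push_cast; omega
    rw [h1, h2, hA, hB]
    push_cast
    ring
  have pos : ∀ u ∈ S, u ≠ q → u ≠ f 1 q →
      (y + B) * X (f 1 q) + (x + A) * Y (f 1 q) < (y + B) * X u + (x + A) * Y u := by
    intro u hu h1 h2
    have c := L.col_mem u hu
    have r := L.row_mem u hu
    have g1 : (X (f 1 q) : ℤ) + A ≤ X u := by rw [e3, K.fst u hu h2]; push_cast; omega
    have g2 : (Y (f 1 q) : ℤ) - y ≤ Y u := by rw [e2, K.snd u hu h1]; push_cast; omega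
    have g3 := mul_le_mul_of_nonneg_left g1 (by omega : 0 ≤ y + B)
    have g4 := mul_le_mul_of_nonneg_left g2 (by omega : 0 ≤ x + A)
    -- The form exceeds its value on the root by at least `A * B - x * y`, which is positive because
    -- offsets within the component are less than its numbers of columns and rows.
    have g5 : x * y < A * B := mul_lt_mul'' (by omega) (by omega) x0 y0
    have g6 : (y + B) * (X (f 1 q) + A) + (x + A) * (Y (f 1 q) - y) =
        (y + B) * X (f 1 q) + (x + A) * Y (f 1 q) + (A * B - x * y) := by ring
    linarith
  have ge : ∀ u ∈ S,
      (y + B) * X (f 1 q) + (x + A) * Y (f 1 q) ≤ (y + B) * X u + (x + A) * Y u := by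
    intro u hu
    by_cases h1 : u = q
    · rw [h1, key]
    by_cases h2 : u = f 1 q
    · rw [h2]
    exact (pos u hu h1 h2).le
  refine ⟨y + B, x + A, _, key.le, le_rfl, ge v hv, ge w hw, ?_⟩
  rcases h with h | h
  · exact .inr (.inr (.inl (pos v hv h.1 h.2)))
  · exact .inr (.inr (.inr (pos w hw h.1 h.2)))

theorem Layout.ne_root_of_lt (L : Layout N f S row col up sx ex sy ey q)
    {v w : ℕ} (hw : w ∈ S) (h : row w < row v) : v ≠ q := by
  have := L.row_mem w hw
  have := L.root_row
  rintro rfl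
  omega

theorem Layout.ne_root_of_col_lt (L : Layout N f S row col up sx ex sy ey q)
    {v w : ℕ} (hw : w ∈ S) (h : col w < col v) : v ≠ f 1 q := by
  have := L.col_mem w hw
  have := L.root_col
  rintro rfl
  omega

/-- The exception `w = q` is real: `q` has been moved below its own row, so its mate under `f 0` is
now higher. -/
theorem Layout.snd_le (L : Layout N f S row col up sx ex sy ey q)
    (K : Coords f S row col sx ex sy ey q X Y) {v w : ℕ} (hv : v ∈ S) (hw : w ∈ S)
    (h : row v ≤ row w) (hw' : w ≠ q) : Y v ≤ Y w := by
  rcases L.snd_cases K hv with h1 | h1 <;> rcases L.snd_cases K hw with h2 | h2 <;> omega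

theorem Layout.snd_lt (L : Layout N f S row col up sx ex sy ey q)
    (K : Coords f S row col sx ex sy ey q X Y) {v w : ℕ} (hv : v ∈ S) (hw : w ∈ S)
    (h : row v < row w) : Y v < Y w := by
  have := L.ne_root_of_lt hv h
  rcases L.snd_cases K hv with h1 | h1 <;> rcases L.snd_cases K hw with h2 | h2 <;> omega

theorem Layout.fst_le (L : Layout N f S row col up sx ex sy ey q)
    (K : Coords f S row col sx ex sy ey q X Y) {v w : ℕ} (hv : v ∈ S) (hw : w ∈ S)
    (h : col v ≤ col w) (hw' : w ≠ f 1 q) : X v ≤ X w := by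
  rcases L.fst_cases K hv with h1 | h1 <;> rcases L.fst_cases K hw with h2 | h2 <;> omega

theorem Layout.fst_lt (L : Layout N f S row col up sx ex sy ey q)
    (K : Coords f S row col sx ex sy ey q X Y) {v w : ℕ} (hv : v ∈ S) (hw : w ∈ S)
    (h : col v < col w) : X v < X w := by
  have := L.ne_root_of_col_lt hv h
  rcases L.fst_cases K hv with h1 | h1 <;> rcases L.fst_cases K hw with h2 | h2 <;> omega

/-- Two vertices in different rows are separated from vertices weakly below or weakly above. -/
theorem Layout.sep_of_row (L : Layout N f S row col up sx ex sy ey q)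
    (K : Coords f S row col sx ex sy ey q X Y) {a b v w : ℕ} (ha : a ∈ S) (hb : b ∈ S)
    (hv : v ∈ S) (hw : w ∈ S) (hab : row a < row b) (haq : a ≠ q)
    (h : (row v ≤ row a ∧ row w ≤ row a) ∨ (row b ≤ row v ∧ row b ≤ row w)) :
    Sep X Y a b v w := by
  have hlt := L.snd_lt K ha hb hab
  rcases h with ⟨h1, h2⟩ | ⟨h1, h2⟩
  · exact (Sep.of_snd (Y a) (L.snd_le K hv ha h1 haq) (L.snd_le K hw ha h2 haq) le_rfl hlt.le
      (by omega)).symm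
  · exact Sep.of_snd (Y b) hlt.le le_rfl
      (L.snd_le K hb hv h1 (L.ne_root_of_lt ha (by omega)))
      (L.snd_le K hb hw h2 (L.ne_root_of_lt ha (by omega))) (by omega)

/-- Two vertices in different columns are separated from vertices weakly to the left or weakly to
the right. -/
theorem Layout.sep_of_col (L : Layout N f S row col up sx ex sy ey q)
    (K : Coords f S row col sx ex sy ey q X Y) {a b v w : ℕ} (ha : a ∈ S) (hb : b ∈ S)
    (hv : v ∈ S) (hw : w ∈ S) (hab : col a < col b) (hap : a ≠ f 1 q)
    (h : (col v ≤ col a ∧ col w ≤ col a) ∨ (col b ≤ col v ∧ col b ≤ col w)) :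
    Sep X Y a b v w := by
  have hlt := L.fst_lt K ha hb hab
  rcases h with ⟨h1, h2⟩ | ⟨h1, h2⟩
  · exact (Sep.of_fst (X a) (L.fst_le K hv ha h1 hap) (L.fst_le K hw ha h2 hap) le_rfl hlt.le
      (by omega)).symm
  · exact Sep.of_fst (X b) hlt.le le_rfl
      (L.fst_le K hb hv h1 (L.ne_root_of_col_lt ha (by omega)))
      (L.fst_le K hb hw h2 (L.ne_root_of_col_lt ha (by omega))) (by omega)

/-- Each row has only one vertex satisfying `up`, so different links start in different rows and
occupy different strips between consecutive rows. -/
theorem Layout.sep_link_link (L : Layout N f S row col up sx ex sy ey q)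
    (K : Coords f S row col sx ex sy ey q X Y) {a b : ℕ} (ha : a ∈ S) (hb : b ∈ S)
    (ha' : Link f S row col up a) (hb' : Link f S row col up b) (haq : a ≠ q) (hbq : b ≠ q)
    (h : b ≠ a) : Sep X Y a (f 1 a) b (f 1 b) := by
  have h1 := ha'.row_succ
  have h2 := hb'.row_succ
  have ha1 := L.closed 1 a ha
  have hb1 := L.closed 1 b hb
  rcases lt_trichotomy (row a) (row b) with h3 | h3 | h3
  · exact L.sep_of_row K ha ha1 hb hb1 (by omega) haq (.inr (by omega))
  · rcases L.row_inj a ha b hb h3 with h4 | h4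
    · exact absurd h4 h
    · exact absurd (h4 ▸ hb'.up) (L.up_mate a ha ha'.up)
  · exact (L.sep_of_row K hb hb1 ha ha1 (by omega) hbq (.inr (by omega))).symm

/-- Within the rows of its cycle, a closing edge has everything except its left end in its second
column or further right. -/
theorem Layout.sep_closing_of_range (L : Layout N f S row col up sx ex sy ey q)
    (K : Coords f S row col sx ex sy ey q X Y) {a v w : ℕ} (ha : a ∈ S) (hv : v ∈ S) (hw : w ∈ S)
    (hl : Closing f S row col a) (hap : a ≠ f 1 q) (hva : v ≠ a) (hwa : w ≠ a)
    (h1 : row a ≤ row v) (h2 : row v ≤ row (f 1 a)) (h3 : row a ≤ row w)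
    (h4 : row w ≤ row (f 1 a)) : Sep X Y a (f 1 a) v w := by
  have g1 := (hl.left v hv h1 h2).resolve_left hva
  have g2 := (hl.left w hw h3 h4).resolve_left hwa
  have := hl.col_succ
  exact L.sep_of_col K ha (L.closed 1 a ha) hv hw (by omega) hap (.inr (by omega))

theorem Layout.sep_link_closing (L : Layout N f S row col up sx ex sy ey q)
    (K : Coords f S row col sx ex sy ey q X Y) {a b : ℕ} (ha : a ∈ S)
    (hb : b ∈ S) (ha' : Link f S row col up a) (hb' : Closing f S row col b) (haq : a ≠ q)
    (hbp : b ≠ f 1 q) (h : b ≠ a) (h' : b ≠ f 1 a) :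
    Sep X Y a (f 1 a) b (f 1 b) := by
  have h1 := ha'.row_succ
  have h2 := hb'.row_lt
  have ha1 := L.closed 1 a ha
  have hb1 := L.closed 1 b hb
  by_cases c1 : row (f 1 a) ≤ row b
  · exact L.sep_of_row K ha ha1 hb hb1 (by omega) haq (.inr (by omega))
  by_cases c2 : row (f 1 b) ≤ row a
  · exact L.sep_of_row K ha ha1 hb hb1 (by omega) haq (.inl (by omega))
  exact (L.sep_closing_of_range K hb ha ha1 hb' hbp h.symm h'.symm
    (by omega) (by omega) (by omega) (by omega)).symm

/-- If one edge starts within the row range of the other, that range contains both its ends, and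
`sep_closing_of_range` applies; otherwise the ranges are disjoint and a horizontal line separates.
-/
theorem Layout.sep_closing_closing (L : Layout N f S row col up sx ex sy ey q)
    (K : Coords f S row col sx ex sy ey q X Y) {a b : ℕ} (ha : a ∈ S)
    (hb : b ∈ S) (ha' : Closing f S row col a) (hb' : Closing f S row col b) (haq : a ≠ q)
    (hap : a ≠ f 1 q) (hbp : b ≠ f 1 q) (h : b ≠ a) (h' : b ≠ f 1 a) (h'' : f 1 b ≠ a) :
    Sep X Y a (f 1 a) b (f 1 b) := by
  have h1 := ha'.row_lt
  have h2 := hb'.row_lt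
  have hb1 := L.closed 1 b hb
  have ha1 := L.closed 1 a ha
  by_cases c1 : row a ≤ row b ∧ row b ≤ row (f 1 a)
  · have := ha'.closed b hb c1.1 c1.2
    exact L.sep_closing_of_range K ha hb hb1 ha' hap h h'' c1.1 c1.2 this.1 this.2
  by_cases c2 : row b ≤ row a ∧ row a ≤ row (f 1 b)
  · have := hb'.closed a ha c2.1 c2.2
    exact (L.sep_closing_of_range K hb ha ha1 hb' hbp h.symm h'.symm c2.1 c2.2 this.1 this.2).symm
  exact L.sep_of_row K ha ha1 hb hb1 h1 haq (by omega)

/-- Every edge of `f 1` can be oriented as a link, a closing edge or the root. -/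
theorem Layout.oriented (L : Layout N f S row col up sx ex sy ey q) (hf : Mates N f)
    {P : ℕ → ℕ → Prop} (hP : ∀ a b, P a b → P b a)
    (hroot : P q (f 1 q))
    (hlink : ∀ a ∈ S, Link f S row col up a → a ≠ q → a ≠ f 1 q → P a (f 1 a))
    (hclosing : ∀ a ∈ S, Closing f S row col a → a ≠ q → a ≠ f 1 q → P a (f 1 a)) :
    ∀ a ∈ S, P a (f 1 a) := by
  have hq := L.lt _ L.root_mem
  have key : ∀ a ∈ S, (Link f S row col up a ∨ Closing f S row col a ∨ a = q) → P a (f 1 a) := by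
    intro a ha h
    by_cases haq : a = q
    · subst haq
      exact hroot
    by_cases hap : a = f 1 q
    · subst hap
      rw [hf.invol 1 q hq]
      exact hP _ _ hroot
    rcases h with h | h | h
    · exact hlink a ha h haq hap
    · exact hclosing a ha h haq hap
    · exact absurd h haq
  intro a ha
  rcases L.edge a ha with h | h
  · exact key a ha h
  · have := key _ (L.closed 1 a ha) h
    rw [hf.invol 1 a (L.lt a ha)] at this
    exact hP _ _ this

theorem Layout.ne_col (L : Layout N f S row col up sx ex sy ey q) (hf : Mates N f) {a : ℕ}
    (ha : a ∈ S) : col a ≠ col (f 1 a) := by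
  intro h
  rcases L.col_inj a ha _ (L.closed 1 a ha) h with h | h
  · exact hf.ne_self 1 a (L.lt a ha) h
  · exact hf.ne 1 2 (by decide) a (L.lt a ha) h

/-- Horizontal edges cannot enter the strip between the consecutive rows of a link, and vertical
ones cannot enter that between the consecutive columns of a closing edge. The remaining two cases
rest on `Link.clear` and `Closing.left`; the root has its own line. -/
theorem Layout.sep_mid (L : Layout N f S row col up sx ex sy ey q)
    (K : Coords f S row col sx ex sy ey q X Y) (hf : Mates N f) {j : Fin 3} (hj : j ≠ 1) {v : ℕ}
    (hv : v ∈ S) : ∀ a ∈ S, Sep X Y a (f 1 a) v (f j v) := by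
  have hq := L.root_mem
  have hvj := L.closed j v hv
  refine L.oriented hf (P := fun a b => Sep X Y a b v (f j v)) (fun _ _ h => h.swap_left) ?_ ?_ ?_
  · apply L.sep_root K hf hv hvj
    by_cases h1 : v = q
    · subst h1
      exact .inr ⟨hf.ne_self _ _ (L.lt _ hv), hf.ne _ _ hj _ (L.lt _ hv)⟩
    by_cases h2 : v = f 1 q
    · subst h2
      refine .inr ⟨fun h => hf.ne j 1 hj _ (L.lt _ hv) ?_, hf.ne_self _ _ (L.lt _ hv)⟩
      rw [h, hf.invol 1 q (L.lt _ hq)]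
    exact .inl ⟨h1, h2⟩
  · intro a ha hl haq hap
    have ha1 := L.closed 1 a ha
    have hr := hl.row_succ
    rcases (by fin_cases j <;> simp_all : j = 0 ∨ j = 2) with rfl | rfl
    · have := L.row_mate v hv
      exact L.sep_of_row K ha ha1 hv hvj (by omega) haq (by omega)
    · have hc := L.col_mate v hv
      have hne := L.ne_col hf ha
      by_cases hb : col a < col v ∧ col v < col (f 1 a) ∨ col (f 1 a) < col v ∧ col v < col a
      · have h1 := hl.clear v hv hb
        have h2 := hl.clear _ hvj (by rwa [hc])
        exact L.sep_of_row K ha ha1 hv hvj (by omega) haq (.inr ⟨h1, h2⟩)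
      · have hap1 : f 1 a ≠ f 1 q := by
          intro e
          apply haq
          rw [← hf.invol 1 a (L.lt a ha), e, hf.invol 1 q (L.lt q hq)]
        rcases Nat.lt_or_gt_of_ne hne with h | h
        · exact L.sep_of_col K ha ha1 hv hvj h hap (by omega)
        · exact (L.sep_of_col K ha1 ha hv hvj h hap1 (by omega)).swap_left
  · intro a ha hl haq hap
    have ha1 := L.closed 1 a ha
    have hr := hl.row_lt
    have hs := hl.col_succ
    rcases (by fin_cases j <;> simp_all : j = 0 ∨ j = 2) with rfl | rfl
    · have hm := L.row_mate v hv
      by_cases h1 : row v ≤ row a ∨ row (f 1 a) ≤ row v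
      · exact L.sep_of_row K ha ha1 hv hvj hr haq (by omega)
      · refine L.sep_closing_of_range K ha hv hvj hl hap ?_ ?_ ?_ ?_ ?_ ?_
        · rintro rfl; omega
        · intro h; rw [h] at hm; omega
        all_goals omega
    · have hm := L.col_mate v hv
      exact L.sep_of_col K ha ha1 hv hvj (by omega) hap (by omega)

theorem Layout.sep_mid_mid (L : Layout N f S row col up sx ex sy ey q)
    (K : Coords f S row col sx ex sy ey q X Y) (hf : Mates N f) :
    ∀ u ∈ S, ∀ v ∈ S, v ≠ u → v ≠ f 1 u → Sep X Y u (f 1 u) v (f 1 v) := by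
  intro u hu v hv
  refine L.oriented hf (P := fun a b => ∀ v ∈ S, v ≠ a → v ≠ b → Sep X Y a b v (f 1 v))
    (fun _ _ h v hv h1 h2 => (h v hv h2 h1).swap_left) ?_ ?_ ?_ u hu v hv
  · intro v hv h1 h2
    exact L.sep_root K hf hv (L.closed 1 v hv) (.inl ⟨h1, h2⟩)
  · intro a ha hl haq hap v hv e1 e2
    -- The second edge is oriented as well. All four inequalities between ends are carried along, so
    -- that the statement is symmetric in the ends of the second edge.
    refine L.oriented hf
      (P := fun x y => x ≠ a → x ≠ f 1 a → y ≠ a → y ≠ f 1 a → Sep X Y a (f 1 a) x y)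
      (fun x y h h1 h2 h3 h4 => (h h3 h4 h1 h2).swap_right) ?_ ?_ ?_ v hv e1 e2 ?_ ?_
    · intro _ _ _ _
      exact (L.sep_root K hf ha (L.closed 1 a ha) (.inl ⟨haq, hap⟩)).symm
    · intro b hb hl' hbq hbp h1 _ _ _
      exact L.sep_link_link K ha hb hl hl' haq hbq h1
    · intro b hb hl' hbq hbp h1 h2 _ _
      exact L.sep_link_closing K ha hb hl hl' haq hbp h1 h2
    · rintro rfl
      exact e2 (hf.invol 1 v (L.lt v hv)).symm
    · intro h
      exact e1 (by rw [← hf.invol 1 v (L.lt v hv), h, hf.invol 1 a (L.lt a ha)])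
  · intro a ha hl haq hap v hv e1 e2
    refine L.oriented hf
      (P := fun x y => x ≠ a → x ≠ f 1 a → y ≠ a → y ≠ f 1 a → Sep X Y a (f 1 a) x y)
      (fun x y h h1 h2 h3 h4 => (h h3 h4 h1 h2).swap_right) ?_ ?_ ?_ v hv e1 e2 ?_ ?_
    · intro _ _ _ _
      exact (L.sep_root K hf ha (L.closed 1 a ha) (.inl ⟨haq, hap⟩)).symm
    · intro b hb hl' hbq hbp h1 h2 h3 h4
      exact (L.sep_link_closing K hb ha hl' hl hbq hap h1.symm h3.symm).symm
    · intro b hb hl' hbq hbp h1 h2 h3 h4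
      exact L.sep_closing_closing K ha hb hl hl' haq hap hbp h1 h2 h3
    · rintro rfl
      exact e2 (hf.invol 1 v (L.lt v hv)).symm
    · intro h
      exact e1 (by rw [← hf.invol 1 v (L.lt v hv), h, hf.invol 1 a (L.lt a ha)])

theorem Layout.sep_rows (L : Layout N f S row col up sx ex sy ey q)
    (K : Coords f S row col sx ex sy ey q X Y) {a b v w : ℕ} (ha : a ∈ S) (hb : b ∈ S)
    (hv : v ∈ S) (hw : w ∈ S) (hab : row a = row b) (hvw : row v = row w)
    (h : row a ≠ row v) : Sep X Y a b v w := by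
  have key : ∀ {a b v w : ℕ}, a ∈ S → b ∈ S → v ∈ S → w ∈ S → row a = row b → row v = row w →
      row a < row v → Sep X Y a b v w := by
    intro a b v w ha hb hv hw hab hvw h
    have h1 := L.ne_root_of_lt ha h
    have h2 := L.ne_root_of_lt ha (v := w) (by omega)
    have := L.snd_cases K ha
    have := L.snd_cases K hb
    have := K.snd v hv h1
    have := K.snd w hw h2
    exact Sep.of_snd (row a + ey) (by omega) (by omega) (by omega) (by omega) (by omega)
  rcases Nat.lt_or_gt_of_ne h with h | h
  · exact key ha hb hv hw hab hvw h
  · exact (key hv hw ha hb hvw hab h).symm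

theorem Layout.sep_cols (L : Layout N f S row col up sx ex sy ey q)
    (K : Coords f S row col sx ex sy ey q X Y) {a b v w : ℕ} (ha : a ∈ S) (hb : b ∈ S)
    (hv : v ∈ S) (hw : w ∈ S) (hab : col a = col b) (hvw : col v = col w)
    (h : col a ≠ col v) : Sep X Y a b v w := by
  have key : ∀ {a b v w : ℕ}, a ∈ S → b ∈ S → v ∈ S → w ∈ S → col a = col b → col v = col w →
      col a < col v → Sep X Y a b v w := by
    intro a b v w ha hb hv hw hab hvw h
    have h1 := L.ne_root_of_col_lt ha h
    have h2 := L.ne_root_of_col_lt ha (v := w) (by omega)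
    have := L.fst_cases K ha
    have := L.fst_cases K hb
    have := K.fst v hv h1
    have := K.fst w hw h2
    exact Sep.of_fst (col a + ex) (by omega) (by omega) (by omega) (by omega) (by omega)
  rcases Nat.lt_or_gt_of_ne h with h | h
  · exact key ha hb hv hw hab hvw h
  · exact (key hv hw ha hb hvw hab h).symm

theorem Layout.sep_point (L : Layout N f S row col up sx ex sy ey q)
    (K : Coords f S row col sx ex sy ey q X Y) (hf : Mates N f) {w : ℕ} (hw : w ∈ S) :
    ∀ a ∈ S, w ≠ a → w ≠ f 1 a → Sep X Y a (f 1 a) w w := by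
  refine L.oriented hf (P := fun a b => w ≠ a → w ≠ b → Sep X Y a b w w)
    (fun _ _ h h1 h2 => (h h2 h1).swap_left) ?_ ?_ ?_
  · intro h1 h2
    exact L.sep_root K hf hw hw (.inl ⟨h1, h2⟩)
  · intro a ha hl haq hap _ _
    have := hl.row_succ
    exact L.sep_of_row K ha (L.closed 1 a ha) hw hw (by omega) haq (by omega)
  · intro a ha hl haq hap _ _
    have := hl.col_succ
    exact L.sep_of_col K ha (L.closed 1 a ha) hw hw (by omega) hap (by omega)

/-- The tilted edge at `q` hangs below the lowest row, which bounds all vertical edges from below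
except the one at `q`. That one is separated by its own column, to one side of which `f 0 q` lies.
-/
theorem Layout.sep_first (L : Layout N f S row col up sx ex sy ey q)
    (K : Coords f S row col sx ex sy ey q X Y) (hf : Mates N f) {v : ℕ} (hv : v ∈ S) :
    Sep X Y q (f 0 q) v (f 2 v) := by
  have hq := L.root_mem
  have hqN := L.lt q hq
  have hy := L.closed 0 q hq
  have hz := L.closed 2 q hq
  have hv2 := L.closed 2 v hv
  have yq := hf.ne_self 0 q hqN
  by_cases hc : col q = col v
  · have hne : col q ≠ col (f 0 q) := by
      intro h
      rcases L.col_inj q hq _ hy h with h | h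
      · exact yq h
      · exact hf.ne 0 2 (by decide) q hqN h
    have hcv := L.col_mate v hv
    have n1 : q ≠ f 1 q := (hf.ne_self 1 q hqN).symm
    have n2 : f 2 q ≠ f 1 q := hf.ne 2 1 (by decide) q hqN
    have x1 := K.fst q hq n1
    have x2 := K.fst _ hz n2
    have c2 := L.col_mate q hq
    have xy := K.fst _ hy (hf.ne 0 1 (by decide) q hqN)
    have nv : ∀ w ∈ S, col q = col w → X w = X q := by
      intro w hw h
      rcases L.col_inj q hq w hw h with rfl | rfl
      · rfl
      · omega
    have xv := nv v hv hc
    have xv2 := nv _ hv2 (by omega)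
    rcases Nat.lt_or_gt_of_ne hne with h | h
    · exact (Sep.of_fst (X q) (by omega) (by omega) le_rfl (by omega) (by omega)).symm
    · exact Sep.of_fst (X q) le_rfl (by omega) (by omega) (by omega) (by omega)
  · have n1 : v ≠ q := fun h => hc (by rw [h])
    have n2 : f 2 v ≠ q := fun h => hc (by rw [← h, L.col_mate v hv])
    have := K.snd v hv n1
    have := K.snd _ hv2 n2
    have := K.snd _ hy yq
    have := K.snd_root
    have := L.root_row
    have := L.row_mem _ hv
    have := L.row_mem _ hv2
    have := L.row_mate _ hq
    exact Sep.of_snd (Y (f 0 q)) (by omega) (by omega) (by omega) (by omega) (by omega)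

/-- The mirror image of `sep_first`, with rows and columns exchanged and `f 1 q` in the place of
`q`. -/
theorem Layout.sep_last (L : Layout N f S row col up sx ex sy ey q)
    (K : Coords f S row col sx ex sy ey q X Y) (hf : Mates N f) {v : ℕ} (hv : v ∈ S) :
    Sep X Y (f 1 q) (f 2 (f 1 q)) v (f 0 v) := by
  have hq := L.root_mem
  have hp := L.closed 1 q hq
  have hpN := L.lt _ hp
  have hpq : f 1 (f 1 q) = q := hf.invol 1 q (L.lt q hq)
  have hK := K.fst_root
  have hL := L.root_col
  have hfst := K.fst
  generalize f 1 q = p at *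
  have hy := L.closed 2 p hp
  have hz := L.closed 0 p hp
  have hv2 := L.closed 0 v hv
  have yq := hf.ne_self 2 p hpN
  by_cases hc : row p = row v
  · have hne : row p ≠ row (f 2 p) := by
      intro h
      rcases L.row_inj p hp _ hy h with h | h
      · exact yq h
      · exact hf.ne 2 0 (by decide) p hpN h
    have hcv := L.row_mate v hv
    have n1 : p ≠ q := by
      have := (hf.ne_self 1 p hpN).symm
      rwa [hpq] at this
    have n2 : f 0 p ≠ q := by
      have := hf.ne 0 1 (by decide) p hpN
      rwa [hpq] at this
    have n3 : f 2 p ≠ q := by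
      have := hf.ne 2 1 (by decide) p hpN
      rwa [hpq] at this
    have x1 := K.snd p hp n1
    have x2 := K.snd _ hz n2
    have c2 := L.row_mate p hp
    have xy := K.snd _ hy n3
    have nv : ∀ w ∈ S, row p = row w → Y w = Y p := by
      intro w hw h
      rcases L.row_inj p hp w hw h with rfl | rfl
      · rfl
      · omega
    have xv := nv v hv hc
    have xv2 := nv _ hv2 (by omega)
    rcases Nat.lt_or_gt_of_ne hne with h | h
    · exact (Sep.of_snd (Y p) (by omega) (by omega) le_rfl (by omega) (by omega)).symm
    · exact Sep.of_snd (Y p) le_rfl (by omega) (by omega) (by omega) (by omega)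
  · have n1 : v ≠ p := fun h => hc (by rw [h])
    have n2 : f 0 v ≠ p := fun h => hc (by rw [← h, L.row_mate v hv])
    have := hfst v hv n1
    have := hfst _ hv2 n2
    have := hfst _ hy yq
    have := L.col_mem _ hv
    have := L.col_mem _ hv2
    have := L.col_mate _ hp
    exact Sep.of_fst (X (f 2 p)) (by omega) (by omega) (by omega) (by omega) (by omega)

theorem Layout.good (L : Layout N f S row col up sx ex sy ey q)
    (K : Coords f S row col sx ex sy ey q X Y) (hf : Mates N f) : Good N f S X Y := by
  have hq := L.root_mem
  have hor : ∀ u ∈ S, u = q ∨ f 0 u = q ∨ Y u = Y (f 0 u) := by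
    intro u hu
    by_cases h1 : u = q
    · exact .inl h1
    by_cases h2 : f 0 u = q
    · exact .inr (.inl h2)
    have := L.row_mate u hu
    have := K.snd u hu h1
    have := K.snd _ (L.closed 0 u hu) h2
    omega
  have ver : ∀ u ∈ S, u = f 1 q ∨ f 2 u = f 1 q ∨ X u = X (f 2 u) := by
    intro u hu
    by_cases h1 : u = f 1 q
    · exact .inl h1
    by_cases h2 : f 2 u = f 1 q
    · exact .inr (.inl h2)
    have := L.col_mate u hu
    have := K.fst u hu h1
    have := K.fst _ (L.closed 2 u hu) h2
    omega
  refine ⟨?_, ?_, ?_, ?_, ?_, ?_, ?_, ?_⟩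
  · intro u hu v hv hX hY
    have hr : row u = row v := by
      by_contra h
      rcases Nat.lt_or_gt_of_ne h with h | h
      · have := L.snd_lt K hu hv h
        omega
      · have := L.snd_lt K hv hu h
        omega
    have hc : col u = col v := by
      by_contra h
      rcases Nat.lt_or_gt_of_ne h with h | h
      · have := L.fst_lt K hu hv h
        omega
      · have := L.fst_lt K hv hu h
        omega
    rcases L.row_inj u hu v hv hr with h1 | h1
    · exact h1.symm
    rcases L.col_inj u hu v hv hc with h2 | h2
    · exact h2.symm
    exact absurd (h1.symm.trans h2) (hf.ne 0 2 (by decide) u (L.lt u hu))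
  · intro i u hu w hw h1 h2
    rcases (by fin_cases i <;> simp : i = 0 ∨ i = 1 ∨ i = 2) with rfl | rfl | rfl
    · exact L.sep_rows K hu (L.closed 0 u hu) hw hw (L.row_mate u hu).symm rfl
        fun h => (L.row_inj u hu w hw h).elim h1 h2
    · exact L.sep_point K hf hw u hu h1 h2
    · exact L.sep_cols K hu (L.closed 2 u hu) hw hw (L.col_mate u hu).symm rfl
        fun h => (L.col_inj u hu w hw h).elim h1 h2
  · intro i u hu w hw h1 h2
    rcases (by fin_cases i <;> simp : i = 0 ∨ i = 1 ∨ i = 2) with rfl | rfl | rfl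
    · exact L.sep_rows K hu (L.closed 0 u hu) hw (L.closed 0 w hw) (L.row_mate u hu).symm
        (L.row_mate w hw).symm fun h => (L.row_inj u hu w hw h).elim h1 h2
    · exact L.sep_mid_mid K hf u hu w hw h1 h2
    · exact L.sep_cols K hu (L.closed 2 u hu) hw (L.closed 2 w hw) (L.col_mate u hu).symm
        (L.col_mate w hw).symm fun h => (L.col_inj u hu w hw h).elim h1 h2
  · exact fun j hj u hu v hv => L.sep_mid K hf hj hv u hu
  · intro u hu
    rcases hor u hu with rfl | h | h
    · exact .inr fun v hv => L.sep_first K hf hv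
    · right
      intro v hv
      have := L.sep_first K hf hv
      rw [← h, hf.invol 0 u (L.lt u hu)] at this
      exact this.swap_left
    · exact .inl h
  · intro u hu
    rcases ver u hu with rfl | h | h
    · exact .inr fun v hv => L.sep_last K hf hv
    · right
      intro v hv
      have := L.sep_last K hf hv
      rw [← h, hf.invol 2 u (L.lt u hu)] at this
      exact this.swap_left
    · exact .inl h
  · intro u hu v hv _ h1 h2
    have i1 := hf.invol 0 u (L.lt u hu)
    have i2 := hf.invol 0 v (L.lt v hv)
    rcases hor u hu with h | h | h <;> rcases hor v hv with h' | h' | h' <;> grind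
  · intro u hu v hv _ h1 h2
    have i1 := hf.invol 2 u (L.lt u hu)
    have i2 := hf.invol 2 v (L.lt v hv)
    rcases ver u hu with h | h | h <;> rcases ver v hv with h' | h' | h' <;> grind

end

/-! ### Combining drawings of different components. -/

/-- Two drawings of closed sets, one above and to the right of the other. -/
theorem Good.union {N : ℕ} {f : Fin 3 → ℕ → ℕ} {S T : Set ℕ} {X Y : ℕ → ℕ} {x : ℕ}
    (hS : Good N f S X Y) (hT : Good N f T X Y)
    (cS : ∀ i, ∀ v ∈ S, f i v ∈ S) (cT : ∀ i, ∀ v ∈ T, f i v ∈ T)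
    (xS : ∀ v ∈ S, X v ≤ x) (xT : ∀ v ∈ T, x < X v) :
    Good N f (S ∪ T) X Y := by
  have sep : ∀ {a b c d}, a ∈ S → b ∈ S → c ∈ T → d ∈ T → Sep X Y a b c d := by
    intro a b c d ha hb hc hd
    have := xT d hd
    exact Sep.of_fst x (xS a ha) (xS b hb) (xT c hc).le this.le (by omega)
  -- `S` itself is a closed set that contains `u` but not `v`, so uniqueness of exceptional edges
  -- need only be checked within each part.
  have conn : ∀ {u v}, u ∈ S → v ∈ T → ¬ Conn N f u v := by
    intro u v hu hv h
    have h1 := h S (fun i w _ hw => cS i w hw) hu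
    have := xS v h1
    have := xT v hv
    omega
  have conn' : ∀ {u v}, u ∈ T → v ∈ S → ¬ Conn N f u v := by
    intro u v hu hv h
    have h1 := h T (fun i w _ hw => cT i w hw) hu
    have := xS v hv
    have := xT v h1
    omega
  refine ⟨?_, ?_, ?_, ?_, ?_, ?_, ?_, ?_⟩
  · rintro u (hu | hu) v (hv | hv) hX hY
    · exact hS.inj u hu v hv hX hY
    · have := xS u hu
      have := xT v hv
      omega
    · have := xS v hv
      have := xT u hu
      omega
    · exact hT.inj u hu v hv hX hY
  · rintro i u (hu | hu) v (hv | hv) h1 h2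
    · exact hS.avoid i u hu v hv h1 h2
    · exact sep hu (cS _ _ hu) hv hv
    · exact (sep hv hv hu (cT _ _ hu)).symm
    · exact hT.avoid i u hu v hv h1 h2
  · rintro i u (hu | hu) v (hv | hv) h1 h2
    · exact hS.par i u hu v hv h1 h2
    · exact sep hu (cS _ _ hu) hv (cT _ _ hv)
    · exact (sep hv (cS _ _ hv) hu (cT _ _ hu)).symm
    · exact hT.par i u hu v hv h1 h2
  · rintro j hj u (hu | hu) v (hv | hv)
    · exact hS.mid j hj u hu v hv
    · exact sep hu (cS _ _ hu) hv (cT _ _ hv)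
    · exact (sep hv (cS _ _ hv) hu (cT _ _ hu)).symm
    · exact hT.mid j hj u hu v hv
  · rintro u (hu | hu)
    · refine (hS.hor u hu).imp_right fun h => ?_
      rintro v (hv | hv)
      · exact h v hv
      · exact sep hu (cS _ _ hu) hv (cT _ _ hv)
    · refine (hT.hor u hu).imp_right fun h => ?_
      rintro v (hv | hv)
      · exact (sep hv (cS _ _ hv) hu (cT _ _ hu)).symm
      · exact h v hv
  · rintro u (hu | hu)
    · refine (hS.ver u hu).imp_right fun h => ?_
      rintro v (hv | hv)
      · exact h v hv
      · exact sep hu (cS _ _ hu) hv (cT _ _ hv)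
    · refine (hT.ver u hu).imp_right fun h => ?_
      rintro v (hv | hv)
      · exact (sep hv (cS _ _ hv) hu (cT _ _ hu)).symm
      · exact h v hv
  · rintro u (hu | hu) v (hv | hv) hc h1 h2
    · exact hS.hor_unique u hu v hv hc h1 h2
    · exact absurd hc (conn hu hv)
    · exact absurd hc (conn' hu hv)
    · exact hT.hor_unique u hu v hv hc h1 h2
  · rintro u (hu | hu) v (hv | hv) hc h1 h2
    · exact hS.ver_unique u hu v hv hc h1 h2
    · exact absurd hc (conn hu hv)
    · exact absurd hc (conn' hu hv)
    · exact hT.ver_unique u hu v hv hc h1 h2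

/-! ### Rows: traversing the cycles of colors 0 and 1. -/

/-- The labels that are not zero have been kept; new labels are larger than `k`. -/
structure Extends (N : ℕ) (lab lab' : ℕ → ℕ) (k : ℕ) : Prop where
  keep : ∀ v < N, lab v ≠ 0 → lab' v = lab v
  new : ∀ v < N, lab v = 0 → lab' v ≠ 0 → k < lab' v

/-- The rows `1, …, cy` have been assigned; row `ρ + 1` consists of `R ρ` and its mate. -/
structure Rows (N : ℕ) (f : Fin 3 → ℕ → ℕ) (row R : ℕ → ℕ) (cy : ℕ) : Prop where
  lt : ∀ ρ < cy, R ρ < N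
  fst : ∀ ρ < cy, row (R ρ) = ρ + 1
  snd : ∀ ρ < cy, row (f 0 (R ρ)) = ρ + 1
  le : ∀ v < N, row v ≠ 0 → row v ≤ cy
  mem : ∀ v < N, row v ≠ 0 → v = R (row v - 1) ∨ v = f 0 (R (row v - 1))

/-- The edge from `v` to `f 1 v` leads from the second vertex of a row to the next row. -/
def Rung (f : Fin 3 → ℕ → ℕ) (row R : ℕ → ℕ) (v : ℕ) : Prop :=
  row v ≠ 0 ∧ v = f 0 (R (row v - 1)) ∧ row (f 1 v) = row v + 1

section

variable {N : ℕ} {f : Fin 3 → ℕ → ℕ} {row R row' R' : ℕ → ℕ} {cy cy' : ℕ}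

theorem Rows.mate (h : Rows N f row R cy) (hf : Mates N f) {v : ℕ} (hv : v < N) (h0 : row v ≠ 0) :
    row (f 0 v) = row v := by
  have h1 := h.le v hv h0
  have h2 := h.fst (row v - 1) (by omega)
  have h3 := h.snd (row v - 1) (by omega)
  have h4 := h.lt (row v - 1) (by omega)
  rcases h.mem v hv h0 with h5 | h5
  · rw [← h5] at h3
    omega
  · have := hf.invol 0 _ h4
    rw [← h5] at this
    rw [this]
    omega

theorem Rows.mate_eq_zero (h : Rows N f row R cy) (hf : Mates N f) {v : ℕ} (hv : v < N)
    (h0 : row v = 0) : row (f 0 v) = 0 := by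
  by_contra h1
  have := h.mate hf (hf.lt 0 v hv) h1
  rw [hf.invol 0 v hv] at this
  omega

/-- The first vertices of different rows are different. This bounds the word size, the coordinates
and the number of iterations. -/
theorem Rows.le_card (h : Rows N f row R cy) : cy ≤ N := by
  have : (Finset.range cy).card ≤ (Finset.range N).card := by
    apply Finset.card_le_card_of_injOn R
    · intro ρ hρ
      simp only [Finset.coe_range, Set.mem_Iio] at hρ ⊢
      exact h.lt ρ hρ
    · intro a ha b hb hab
      simp only [Finset.coe_range, Set.mem_Iio] at ha hb
      have h1 := h.fst a ha
      have h2 := h.fst b hb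
      rw [hab] at h1
      omega
  simpa using this

theorem Rows.inj (h : Rows N f row R cy) (hf : Mates N f) {u v : ℕ} (hu : u < N) (hv : v < N)
    (h0 : row u ≠ 0) (e : row u = row v) : v = u ∨ v = f 0 u := by
  have h1 := h.mem u hu h0
  have h2 := h.mem v hv (by omega)
  have h3 := h.lt (row u - 1) (by have := h.le u hu h0; omega)
  have := hf.invol 0 _ h3
  rw [← e] at h2
  grind

theorem Rung.mono (hrows : Rows N f row R cy) (hext : Extends N row row' cy)
    (hR : ∀ ρ < cy, R' ρ = R ρ) (hf : Mates N f) {v : ℕ} (hv : v < N)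
    (h : Rung f row R v) : Rung f row' R' v := by
  obtain ⟨h0, hup, hs⟩ := h
  have h1 := hext.keep v hv h0
  have h2 := hext.keep (f 1 v) (hf.lt 1 v hv) (by omega)
  refine ⟨by omega, ?_, by omega⟩
  rw [h1, hR _ (by have := hrows.le v hv h0; omega)]
  exact hup

/-- Later labels never turn an edge with both ends already labelled into a rung, so conditions on
rungs can be checked at the time the ends get their rows. -/
theorem Rung.anti (hrows : Rows N f row R cy) (hext : Extends N row row' cy)
    (hR : ∀ ρ < cy, R' ρ = R ρ) (hf : Mates N f) {v : ℕ} (hv : v < N) (h0 : row v ≠ 0)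
    (h1 : row (f 1 v) ≠ 0) (h : Rung f row' R' v) : Rung f row R v := by
  obtain ⟨-, hup, hs⟩ := h
  have h1 := hext.keep v hv h0
  have h2 := hext.keep (f 1 v) (hf.lt 1 v hv) ‹_›
  refine ⟨h0, ?_, by omega⟩
  rwa [h1, hR _ (by have := hrows.le v hv h0; omega)] at hup

/-- State of the traversal along `f 0` and `f 1` that starts at `v₀` and has arrived at `v`. -/
structure RowWalk (N : ℕ) (f : Fin 3 → ℕ → ℕ) (row₀ R₀ : ℕ → ℕ) (cy₀ v₀ : ℕ) (row R : ℕ → ℕ)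
    (cy v : ℕ) : Prop where
  lt : v < N
  zero : row₀ v₀ = 0
  rows : Rows N f row R cy
  ext : Extends N row₀ row cy₀
  keep : ∀ ρ < cy₀, R ρ = R₀ ρ
  le : cy₀ ≤ cy
  front : ∀ y < N, row y ≠ 0 → y = v₀ ∨ f 1 y = v ∨ (row (f 1 y) ≠ 0 ∧ y ≠ v)
  start : (v = v₀ ∧ row v₀ = 0 ∧ cy = cy₀) ∨
    (row (f 1 v) = cy ∧ f 1 v = f 0 (R (cy - 1)) ∧ row v₀ = cy₀ + 1 ∧ R cy₀ = v₀ ∧ cy₀ < cy)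
  status : ∀ y < N, row₀ y = 0 → row y ≠ 0 →
    y = v₀ ∨ f 1 y = v ∨ Rung f row R y ∨ Rung f row R (f 1 y)

/-- Result of the traversal along `f 0` and `f 1` that starts at `v₀`. -/
structure RowCycle (N : ℕ) (f : Fin 3 → ℕ → ℕ) (row₀ R₀ : ℕ → ℕ) (cy₀ v₀ : ℕ) (row R : ℕ → ℕ)
    (cy : ℕ) : Prop where
  rows : Rows N f row R cy
  ext : Extends N row₀ row cy₀
  keep : ∀ ρ < cy₀, R ρ = R₀ ρ
  le : cy₀ ≤ cy
  closed : ∀ y < N, row y ≠ 0 → row (f 1 y) ≠ 0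
  start_ne : row v₀ ≠ 0
  start : row₀ v₀ = 0 → row v₀ = cy₀ + 1 ∧ row (f 1 v₀) = cy ∧ R cy₀ = v₀ ∧ cy₀ + 1 < cy
  status : ∀ y < N, row₀ y = 0 → row y ≠ 0 → row₀ v₀ = 0 ∧
    (y = v₀ ∨ f 1 y = v₀ ∨ Rung f row R y ∨ Rung f row R (f 1 y))

variable {row₀ R₀ : ℕ → ℕ} {cy₀ v₀ v : ℕ}

theorem RowWalk.init (hr : Rows N f row R cy) (hv : v < N) (h0 : row v = 0)
    (hc : ∀ y < N, row y ≠ 0 → row (f 1 y) ≠ 0) : RowWalk N f row R cy v row R cy v where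
  lt := hv
  zero := h0
  rows := hr
  ext := ⟨fun _ _ _ => rfl, fun _ _ h h' => absurd h h'⟩
  keep _ _ := rfl
  le := le_rfl
  front y hy h := .inr (.inr ⟨hc y hy h, by rintro rfl; exact h h0⟩)
  start := .inl ⟨rfl, h0, rfl⟩
  status _ _ h h' := absurd h h'

theorem Rows.step (h : Rows N f row R cy) (hf : Mates N f) (hv : v < N) (h0 : row v = 0)
    (hrow : ∀ y, row' y = if y = v ∨ y = f 0 v then cy + 1 else row y)
    (hR : ∀ ρ, R' ρ = if ρ = cy then v else R ρ) : Rows N f row' R' (cy + 1) := by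
  have h0' := h.mate_eq_zero hf hv h0
  refine ⟨?_, ?_, ?_, ?_, ?_⟩
  · intro ρ hρ
    have := h.lt ρ
    grind
  · intro ρ hρ
    have := h.fst ρ
    grind
  · intro ρ hρ
    have := h.snd ρ
    have := h.lt ρ
    have := hf.invol 0 (R ρ)
    grind
  · intro w hw
    have := h.le w hw
    grind
  · intro w hw
    have := h.le w hw
    have := h.mem w hw
    grind

/-- The walk enters a new row at `v` and leaves it from `f 0 v`. Thus the edge it arrived by becomes
a rung, and the one at `f 0 v` becomes the pending edge of `status`. -/
theorem RowWalk.step (h : RowWalk N f row₀ R₀ cy₀ v₀ row R cy v) (hf : Mates N f)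
    (h0 : row v = 0) (hrow : ∀ y, row' y = if y = v ∨ y = f 0 v then cy + 1 else row y)
    (hR : ∀ ρ, R' ρ = if ρ = cy then v else R ρ) :
    RowWalk N f row₀ R₀ cy₀ v₀ row' R' (cy + 1) (f 1 (f 0 v)) := by
  have hv := h.lt
  have hz := hf.lt 0 v hv
  have h0' := h.rows.mate_eq_zero hf hv h0
  have hzv := hf.ne_self 0 v hv
  have e1 := hf.invol 1 v hv
  have e2 := hf.invol 1 _ hz
  have e3 := hf.invol 0 v hv
  have ne := hf.ne 0 1 (by decide) v hv
  have ext : Extends N row row' cy := ⟨by grind, by grind⟩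
  have hR' : ∀ ρ < cy, R' ρ = R ρ := fun ρ hρ => by rw [hR, if_neg (by omega)]
  have le := h.le
  have hst := h.start
  have hrv : row' v = cy + 1 := by rw [hrow]; simp
  refine ⟨hf.lt 1 _ hz, h.zero, h.rows.step hf hv h0 hrow hR, ⟨?_, ?_⟩, ?_, by omega, ?_, ?_, ?_⟩
  · intro y hy hy0
    have h1 := h.ext.keep y hy hy0
    rw [ext.keep y hy (by omega), h1]
  · intro y hy hy0
    have := h.ext.new y hy hy0
    grind
  · intro ρ hρ
    rw [hR' ρ (by omega), h.keep ρ hρ]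
  · intro y hy hy0
    have := hf.invol 1 y hy
    have := h.front y hy
    grind
  · right
    have hcy : R' cy = v := by rw [hR]; simp
    refine ⟨?_, ?_, ?_, ?_, by omega⟩
    · rw [e2, hrow]; simp
    · rw [e2]; simp [hcy]
    · grind
    · grind
  · intro y hy hy0 hy1
    by_cases hyr : row y = 0
    · have : y = v ∨ y = f 0 v := by grind
      rcases this with rfl | rfl
      · rcases hst with hst | ⟨g1, g2, -, -, g5⟩
        · exact .inl hst.1
        · right; right; right
          have k1 : row' (f 1 y) = cy := by rw [ext.keep _ (hf.lt 1 y hv) (by omega), g1]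
          refine ⟨?_, ?_, ?_⟩
          · omega
          · rw [k1, hR' _ (by omega)]; exact g2
          · rw [e1, hrv, k1]
      · exact .inr (.inl rfl)
    · rcases h.status y hy hy0 hyr with g | g | g | g
      · exact .inl g
      · have hyv : y = f 1 v := by rw [← g, hf.invol 1 y hy]
        subst hyv
        rcases hst with hst | ⟨g1, g2, -, -, g5⟩
        · have := h.ext.new _ hy hy0 hyr
          have := h.rows.le _ hy hyr
          omega
        · right; right; left
          have k1 : row' (f 1 v) = cy := by rw [ext.keep _ hy (by omega), g1]
          refine ⟨?_, ?_, ?_⟩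
          · omega
          · rw [k1, hR' _ (by omega)]; exact g2
          · rw [e1, hrv, k1]
      · exact .inr (.inr (.inl (g.mono h.rows ext hR' hf hy)))
      · exact .inr (.inr (.inr (g.mono h.rows ext hR' hf (hf.lt 1 y hy))))

/-- By `front`, a labelled vertex at which the walk arrives can only be its start. The edge it
arrives by then joins the last row of the cycle to the first. -/
theorem RowWalk.finish (h : RowWalk N f row₀ R₀ cy₀ v₀ row R cy v) (hf : Mates N f)
    (h0 : row v ≠ 0) : RowCycle N f row₀ R₀ cy₀ v₀ row R cy := by
  have hv := h.lt
  have hv1 := hf.ne_self 1 v hv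
  have e : v = v₀ := by
    have := h.front v hv h0
    grind
  subst e
  obtain ⟨-, hst, -⟩ | ⟨g1, g2, g3, g4, g5⟩ := h.start
  · exact absurd hst h0
  have inv := hf.invol 1
  refine ⟨h.rows, h.ext, h.keep, h.le, ?_, h0, ?_, ?_⟩
  · intro y hy hy0
    have := h.front y hy hy0
    have := inv y hy
    grind
  · intro h1
    refine ⟨g3, g1, g4, ?_⟩
    by_contra hc
    have h1 : row v = row (f 1 v) := by omega
    -- With one row only, `f 1 v` would be `v` or `f 0 v`; the graph is simple.
    rcases h.rows.inj hf hv (hf.lt 1 v hv) h0 h1 with h2 | h2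
    · exact hv1 h2
    · exact hf.ne 1 0 (by decide) v hv h2
  · exact fun y hy h1 h2 => ⟨h.zero, h.status y hy h1 h2⟩

theorem RowCycle.refl (hr : Rows N f row R cy) (h0 : row v ≠ 0)
    (hc : ∀ y < N, row y ≠ 0 → row (f 1 y) ≠ 0) : RowCycle N f row R cy v row R cy where
  rows := hr
  ext := ⟨fun _ _ _ => rfl, fun _ _ h h' => absurd h h'⟩
  keep _ _ := rfl
  le := le_rfl
  closed := hc
  start_ne := h0
  start h := absurd h h0
  status _ _ h h' := absurd h h'

end

/-! ### Columns: traversing the cycles of colors 2 and 1, and opening new row cycles. -/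

/-- The columns `1, …, cx` have been assigned. -/
structure Cols (N : ℕ) (f : Fin 3 → ℕ → ℕ) (col : ℕ → ℕ) (cx : ℕ) : Prop where
  le : ∀ v < N, col v ≠ 0 → col v ≤ cx
  mate : ∀ v < N, col v ≠ 0 → col (f 2 v) = col v
  inj : ∀ u < N, ∀ v < N, col u ≠ 0 → col u = col v → v = u ∨ v = f 2 u
  surj : ∀ i < cx, ∃ v < N, col v = i + 1

/-- The rows from that of `a` to that of `f 1 a` are closed under `f 1`, and `a` is the leftmost
vertex there. -/
structure Bracket (N : ℕ) (f : Fin 3 → ℕ → ℕ) (row col : ℕ → ℕ) (a : ℕ) : Prop where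
  row_ne : row a ≠ 0
  col_ne : col a ≠ 0
  row_lt : row a < row (f 1 a)
  closed : ∀ w < N, row a ≤ row w → row w ≤ row (f 1 a) →
    row a ≤ row (f 1 w) ∧ row (f 1 w) ≤ row (f 1 a)
  left : ∀ w < N, row a ≤ row w → row w ≤ row (f 1 a) → w = a ∨ col w = 0 ∨ col a < col w

/-- Partially assigned rows and columns. The vertices in the first `sy` rows are those of earlier
components, which occupy the first `sx` columns. The current component contains `q`. -/
structure Stage (N : ℕ) (f : Fin 3 → ℕ → ℕ) (sy sx q : ℕ) (row col R : ℕ → ℕ) (cy cx : ℕ) :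
    Prop where
  rows : Rows N f row R cy
  cols : Cols N f col cx
  col_row : ∀ v < N, col v ≠ 0 → row v ≠ 0
  closed : ∀ v < N, row v ≠ 0 → row (f 1 v) ≠ 0
  old : ∀ v < N, row v ≠ 0 → row v ≤ sy → col v ≠ 0 ∧ row (f 1 v) ≤ sy
  old_col : ∀ v < N, col v ≠ 0 → (row v ≤ sy ↔ col v ≤ sx)
  lt : q < N
  row_root : row q = sy + 1
  le_row : sy < cy
  le_col : sx ≤ cx

/-- No traversal of columns is under way. -/
structure Settled (N : ℕ) (f : Fin 3 → ℕ → ℕ) (sy q : ℕ) (row col R : ℕ → ℕ) : Prop where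
  closed : ∀ v < N, col v ≠ 0 → col (f 1 v) ≠ 0
  status : ∀ y < N, sy < row y → Rung f row R y ∨ Rung f row R (f 1 y) ∨
    (Bracket N f row col y ∧ col (f 1 y) = col y + 1) ∨
    (Bracket N f row col (f 1 y) ∧ col y = col (f 1 y) + 1) ∨ y = q ∨ f 1 y = q
  clear : ∀ y < N, sy < row y → Rung f row R y → col y ≠ 0 → col (f 1 y) ≠ 0 → ∀ w < N,
    (col y < col w ∧ col w < col (f 1 y) ∨ col (f 1 y) < col w ∧ col w < col y) →
    row (f 1 y) ≤ row w

/-- State of the traversal along `f 2` and `f 1` that starts at `u₀` and has arrived at `u`. -/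
structure ColWalk (N : ℕ) (f : Fin 3 → ℕ → ℕ) (sy sx q : ℕ) (row₀ col₀ R₀ : ℕ → ℕ)
    (cy₀ cx₀ u₀ : ℕ) (row col R : ℕ → ℕ) (cy cx u : ℕ) : Prop where
  lt : u < N
  row_ne : row u ≠ 0
  zero : col₀ u₀ = 0
  stage : Stage N f sy sx q row col R cy cx
  row_ext : Extends N row₀ row cy₀
  col_ext : Extends N col₀ col cx₀
  keep : ∀ ρ < cy₀, R ρ = R₀ ρ
  le_row : cy₀ ≤ cy
  le_col : cx₀ ≤ cx
  front : ∀ y < N, col y ≠ 0 → y = u₀ ∨ f 1 y = u ∨ (col (f 1 y) ≠ 0 ∧ y ≠ u)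
  start : (u = u₀ ∧ col u₀ = 0 ∧ cx = cx₀) ∨ (col (f 1 u) = cx ∧ col u₀ = cx₀ + 1 ∧ cx₀ < cx)
  status : ∀ y < N, sy < row y → Rung f row R y ∨ Rung f row R (f 1 y) ∨
    (Bracket N f row col y ∧
      (col (f 1 y) = col y + 1 ∨ (f 1 y = u ∧ y ≠ f 1 u₀ ∧ col y = cx))) ∨
    (Bracket N f row col (f 1 y) ∧
      (col y = col (f 1 y) + 1 ∨ (y = u ∧ y ≠ u₀ ∧ col (f 1 y) = cx))) ∨
    y = q ∨ f 1 y = q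
  clear : ∀ y < N, sy < row y → Rung f row R y → y ≠ f 1 u₀ → col y ≠ 0 → col (f 1 y) ≠ 0 →
    ∀ w < N, (col y < col w ∧ col w < col (f 1 y) ∨ col (f 1 y) < col w ∧ col w < col y) →
    row (f 1 y) ≤ row w

section

variable {N : ℕ} {f : Fin 3 → ℕ → ℕ} {row col R row' col' R' : ℕ → ℕ} {cy cx cy' cx' : ℕ}
  {sy sx q u v : ℕ}

theorem Cols.mate_eq_zero (h : Cols N f col cx) (hf : Mates N f) {v : ℕ} (hv : v < N)
    (h0 : col v = 0) : col (f 2 v) = 0 := by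
  by_contra h1
  have := h.mate _ (hf.lt 2 v hv) h1
  rw [hf.invol 2 v hv] at this
  omega

theorem Cols.le_card (h : Cols N f col cx) : cx ≤ N := by
  have : (Finset.range cx).card ≤ (Finset.range N).card := by
    apply Finset.card_le_card_of_surjOn (fun v => col v - 1)
    intro i hi
    simp only [Finset.coe_range, Set.mem_Iio] at hi
    obtain ⟨v, hv, e⟩ := h.surj i hi
    exact ⟨v, by simpa using hv, by simp [e]⟩
  simpa using this

theorem Cols.step (h : Cols N f col cx) (hf : Mates N f) (hu : u < N) (h0 : col u = 0)
    (hcol : ∀ y, col' y = if y = u ∨ y = f 2 u then cx + 1 else col y) :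
    Cols N f col' (cx + 1) := by
  have h0' := h.mate_eq_zero hf hu h0
  have e := hf.invol 2 u hu
  refine ⟨?_, ?_, ?_, ?_⟩
  · intro v hv
    have := h.le v hv
    grind
  · intro v hv
    have := h.mate v hv
    have := hf.invol 2 v hv
    grind
  · intro v hv w hw
    have := h.inj v hv w hw
    have := h.le v hv
    have := h.le w hw
    grind
  · intro i hi
    by_cases hc : i = cx
    · exact ⟨u, hu, by simp [hcol, hc]⟩
    · obtain ⟨v, hv, e⟩ := h.surj i (by omega)
      exact ⟨v, hv, by grind⟩

/-- New rows lie above the range of the bracket and new columns lie to the right of its left end. -/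
theorem Bracket.mono (h : Bracket N f row col v) (hf : Mates N f) (hv : v < N)
    (hr : Rows N f row R cy) (hc : Cols N f col cx) (her : Extends N row row' cy)
    (hec : Extends N col col' cx) : Bracket N f row' col' v := by
  have h1 := h.row_ne
  have h2 := h.col_ne
  have h3 := h.row_lt
  have hv1 := hf.lt 1 v hv
  have e1 := her.keep v hv h1
  have e2 := hec.keep v hv h2
  have e3 := her.keep _ hv1 (by omega)
  have l3 := hr.le _ hv1 (by omega)
  have l2 := hc.le v hv h2
  have key : ∀ w < N, row' v ≤ row' w → row' w ≤ row' (f 1 v) → row' w = row w ∧ row w ≠ 0 := by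
    intro w hw a1 a2
    by_cases h0 : row w = 0
    · have := her.new w hw h0 (by omega)
      omega
    · exact ⟨her.keep w hw h0, h0⟩
  refine ⟨by omega, by omega, by omega, ?_, ?_⟩
  · intro w hw a1 a2
    have k := key w hw a1 a2
    have := h.closed w hw (by omega) (by omega)
    have := her.keep (f 1 w) (hf.lt 1 w hw) (by omega)
    omega
  · intro w hw a1 a2
    have k := key w hw a1 a2
    have := h.left w hw (by omega) (by omega)
    have := hec.keep w hw
    have := hec.new w hw
    omega

variable {row₀ col₀ R₀ : ℕ → ℕ} {cy₀ cx₀ u₀ : ℕ}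

theorem ColWalk.init (h : Stage N f sy sx q row col R cy cx) (hs : Settled N f sy q row col R)
    (hu : u < N) (h0 : col u = 0) (hr : row u ≠ 0) :
    ColWalk N f sy sx q row col R cy cx u row col R cy cx u where
  lt := hu
  row_ne := hr
  zero := h0
  stage := h
  row_ext := ⟨fun _ _ _ => rfl, fun _ _ h h' => absurd h h'⟩
  col_ext := ⟨fun _ _ _ => rfl, fun _ _ h h' => absurd h h'⟩
  keep _ _ := rfl
  le_row := le_rfl
  le_col := le_rfl
  front y hy h := .inr (.inr ⟨hs.closed y hy h, by rintro rfl; exact h h0⟩)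
  start := .inl ⟨rfl, h0, rfl⟩
  status y hy h := by
    have := hs.status y hy h
    tauto
  clear y hy h hr _ := hs.clear y hy h hr

theorem Stage.step (h : Stage N f sy sx q row col R cy cx) (hf : Mates N f) (hu : u < N)
    (h0 : col u = 0) (hr : row u ≠ 0)
    (hcol : ∀ y, col' y = if y = u ∨ y = f 2 u then cx + 1 else col y)
    (hrow : RowCycle N f row R cy (f 2 u) row' R' cy') :
    Stage N f sy sx q row' col' R' cy' (cx + 1) := by
  have h0' := h.cols.mate_eq_zero hf hu h0
  have hce : Extends N col col' cx := ⟨by grind, by grind⟩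
  have hsy := h.le_row
  have hsx := h.le_col
  have hle := hrow.le
  have old : ∀ v < N, row' v ≤ sy → row' v ≠ 0 → row v = row' v := by
    intro v hv a b
    by_cases c : row v = 0
    · have := hrow.ext.new v hv c b
      omega
    · exact (hrow.ext.keep v hv c).symm
  refine ⟨hrow.rows, h.cols.step hf hu h0 hcol, ?_, hrow.closed, ?_, ?_, h.lt, ?_, by omega,
    by omega⟩
  · intro v hv a
    have := h.col_row v hv
    have := hrow.ext.keep v hv
    have := hrow.ext.keep u hu
    have := hrow.start_ne
    grind
  · intro v hv a b
    have k := old v hv b a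
    have := h.old v hv (by omega) (by omega)
    have := hce.keep v hv this.1
    have := h.closed v hv (by omega)
    have := hrow.ext.keep (f 1 v) (hf.lt 1 v hv) this
    omega
  · intro v hv a
    by_cases c : col v = 0
    · have := hce.new v hv c a
      constructor
      · intro b
        by_cases d : row' v = 0
        · exfalso
          have : v = u ∨ v = f 2 u := by grind
          have := hrow.start_ne
          have := hrow.ext.keep u hu hr
          grind
        · have k := old v hv b d
          exact absurd c (h.old v hv (by omega) (by omega)).1
      · omega
    · have := h.old_col v hv c
      have := hce.keep v hv c
      have := hrow.ext.keep v hv (h.col_row v hv c)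
      omega
  · have := h.row_root
    have := hrow.ext.keep q h.lt (by omega)
    omega

/-- The row cycle opened at `f 2 u` is closed by the edge from `f 2 u` to `f 1 (f 2 u)`, which is
exactly the edge the column traversal follows next. So its ends get consecutive columns. -/
theorem ColWalk.step (h : ColWalk N f sy sx q row₀ col₀ R₀ cy₀ cx₀ u₀ row col R cy cx u)
    (hf : Mates N f) (hu₀ : u₀ < N) (hr₀ : row₀ u₀ ≠ 0) (hr₁ : row₀ (f 1 u₀) ≠ 0)
    (hrows : Rows N f row₀ R₀ cy₀)
    (hnr : ¬ Rung f row₀ R₀ u₀) (h0 : col u = 0)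
    (hcol : ∀ y, col' y = if y = u ∨ y = f 2 u then cx + 1 else col y)
    (hrow : RowCycle N f row R cy (f 2 u) row' R' cy') :
    ColWalk N f sy sx q row₀ col₀ R₀ cy₀ cx₀ u₀ row' col' R' cy' (cx + 1) (f 1 (f 2 u)) := by
  have hu := h.lt
  have hw := hf.lt 2 u hu
  have h0' := h.stage.cols.mate_eq_zero hf hu h0
  have hce : Extends N col col' cx := ⟨by grind, by grind⟩
  have hle := hrow.le
  have le1 := h.le_row
  have le2 := h.le_col
  have hwu := hf.ne_self 2 u hu
  have e1 := hf.invol 1 u hu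
  have e2 := hf.invol 1 _ hw
  have e3 := hf.invol 1 u₀ hu₀
  have e4 := hf.invol 2 u hu
  have ne := hf.ne 2 1 (by decide) u hu
  have hst := h.start
  have hrz := hrow.start_ne
  have ext' : Extends N row₀ row' cy₀ := by
    refine ⟨?_, ?_⟩
    · intro y hy hy0
      have h1 := h.row_ext.keep y hy hy0
      rw [hrow.ext.keep y hy (by omega), h1]
    · intro y hy hy0
      have := h.row_ext.new y hy hy0
      have := hrow.ext.new y hy
      have := hrow.ext.keep y hy
      grind
  have keep' : ∀ ρ < cy₀, R' ρ = R₀ ρ := fun ρ hρ => by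
    rw [hrow.keep ρ (by omega), h.keep ρ hρ]
  have hnr' : ¬ Rung f row' R' u₀ := fun hr => hnr (hr.anti hrows ext' keep' hf hu₀ hr₀ hr₁)
  have cu : col' u = cx + 1 := by simp [hcol]
  have cw : col' (f 2 u) = cx + 1 := by simp [hcol]
  refine ⟨hf.lt 1 _ hw, hrow.closed _ hw hrz, h.zero,
    h.stage.step hf hu h0 h.row_ne hcol hrow, ext', ⟨?_, ?_⟩, keep', by omega, by omega,
    ?_, ?_, ?_, ?_⟩
  · intro y hy hy0
    have h1 := h.col_ext.keep y hy hy0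
    rw [hce.keep y hy (by omega), h1]
  · intro y hy hy0
    have := h.col_ext.new y hy hy0
    have := hce.new y hy
    have := hce.keep y hy
    grind
  · intro y hy hy0
    have := hf.invol 1 y hy
    have := h.front y hy
    grind
  · right
    rw [e2]
    have := hce.keep u₀ hu₀
    grind
  · intro y hy hys
    have hy1 := hf.lt 1 y hy
    have ey := hf.invol 1 y hy
    by_cases hyr : row y = 0
    · obtain ⟨g0, g⟩ := hrow.status y hy hyr (by omega)
      -- The new rows belong to a single new cycle, hence are closed under `f 1`, and of their
      -- vertices only `f 2 u` has a column so far.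
      have br : Bracket N f row' col' (f 2 u) := by
        obtain ⟨a1, a2, a3, a4⟩ := hrow.start g0
        refine ⟨hrz, by omega, by omega, ?_, ?_⟩
        · intro w hw b1 b2
          have c0 : row w = 0 := by
            by_contra c
            have := hrow.ext.keep w hw c
            have := h.stage.rows.le w hw c
            omega
          have c1 : row (f 1 w) = 0 := by
            by_contra c
            have := h.stage.closed _ (hf.lt 1 w hw) c
            rw [hf.invol 1 w hw] at this
            exact this c0
          have c2 := hrow.closed w hw (by omega)
          have := hrow.ext.new _ (hf.lt 1 w hw) c1 c2
          have := hrow.rows.le _ (hf.lt 1 w hw) c2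
          omega
        · intro w hw b1 b2
          have c0 : row w = 0 := by
            by_contra c
            have := hrow.ext.keep w hw c
            have := h.stage.rows.le w hw c
            omega
          have := h.stage.col_row w hw
          have := h.row_ne
          grind
      -- A bracket opened here is not the edge that closes the column cycle: `f 1 u₀` had a row from
      -- the outset, while `f 2 u` had none.
      have hwx : f 2 u ≠ f 1 u₀ := by
        intro e
        have := h.row_ext.keep _ (hf.lt 1 u₀ hu₀) hr₁
        rw [← e] at this
        rw [← e] at hr₁
        omega
      rcases g with g | g | g | g
      · subst g
        exact .inr (.inr (.inl ⟨br, .inr ⟨rfl, hwx, cw⟩⟩))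
      · right; right; right; left
        rw [g]
        refine ⟨br, .inr ⟨by rw [← g, ey], ?_, cw⟩⟩
        rintro rfl
        exact hwx g.symm
      · exact .inl g
      · exact .inr (.inl g)
    · have hry := hrow.ext.keep y hy hyr
      rcases h.status y hy (by omega) with g | g | ⟨g, g'⟩ | ⟨g, g'⟩ | g
      · exact .inl (g.mono h.stage.rows hrow.ext hrow.keep hf hy)
      · exact .inr (.inl (g.mono h.stage.rows hrow.ext hrow.keep hf hy1))
      · refine .inr (.inr (.inl ⟨g.mono hf hy h.stage.rows h.stage.cols hrow.ext hce, .inl ?_⟩))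
        have c1 := g.col_ne
        have c2 := hce.keep y hy c1
        rcases g' with g' | g'
        · rw [hce.keep _ hy1 (by omega), g', c2]
        · rw [g'.1, cu]; omega
      · refine .inr (.inr (.inr (.inl
          ⟨g.mono hf hy1 h.stage.rows h.stage.cols hrow.ext hce, .inl ?_⟩)))
        have c1 := g.col_ne
        have c2 := hce.keep _ hy1 c1
        rcases g' with g' | g'
        · rw [hce.keep _ hy (by omega), g', c2]
        · rw [g'.1, cu, ← g'.1]; omega
      · exact .inr (.inr (.inr (.inr g)))
  · intro y hy hys hru hyu c1 c2 w hwN hw'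
    have hy1 := hf.lt 1 y hy
    have ey := hf.invol 1 y hy
    have hyu' : y ≠ u₀ := by rintro rfl; exact hnr' hru
    have hyu1 : f 1 y ≠ u₀ := by rintro rfl; exact hyu ey.symm
    by_cases d1 : col y = 0 ∨ col (f 1 y) = 0
    · exfalso
      -- If one end has just received column `cx + 1`, it is not `f 2 u`, whose mate still lacks a
      -- column. So it is `u`, its mate has column `cx`, and no column lies strictly between.
      have fw : ∀ z < N, f 1 z = f 2 u → z ≠ u₀ → f 1 z ≠ f 1 u₀ → col' z = 0 := by
        intro z hz a1 a2 a3
        have := h.front z hz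
        have : z ≠ u ∧ z ≠ f 2 u := by
          constructor
          · rintro rfl; exact ne a1.symm
          · rintro rfl; exact hf.ne_self 1 _ hw a1
        grind
      have hwle := h.stage.cols.le w hwN
      have : col' w ≤ cx + 1 := by rw [hcol]; split <;> omega
      rcases d1 with d1 | d1
      · have : y = u ∨ y = f 2 u := by grind
        rcases this with rfl | rfl
        · grind
        · have := fw (f 1 (f 2 u)) hy1 e2 hyu1 (by rw [e2]; exact hyu)
          grind
      · have : f 1 y = u ∨ f 1 y = f 2 u := by grind
        rcases this with e | e
        · grind
        · have := fw y hy e hyu' (by intro e'; apply hyu'; rw [← ey, e', e3])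
          grind
    · push Not at d1
      have r1 := h.stage.col_row y hy d1.1
      have r2 := h.stage.col_row _ hy1 d1.2
      have l1 := h.stage.cols.le y hy d1.1
      have l2 := h.stage.cols.le _ hy1 d1.2
      have k1 := hce.keep y hy d1.1
      have k2 := hce.keep _ hy1 d1.2
      have k3 := hrow.ext.keep y hy r1
      have k4 := hrow.ext.keep _ hy1 r2
      have d3 : col w ≠ 0 := by
        intro e
        have := hce.new w hwN e
        omega
      have k5 := hce.keep w hwN d3
      have k6 := hrow.ext.keep w hwN (h.stage.col_row w hwN d3)
      have := h.clear y hy (by omega)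
        (hru.anti h.stage.rows hrow.ext hrow.keep hf hy r1 r2) hyu d1.1 d1.2 w hwN (by omega)
      omega

/-- The closing edge at `u₀` is the only one not covered by the invariant. If it is a rung, its
lower end is `f 1 u₀`, and the columns between its ends were all assigned during this walk; `hx` and
the labels of new rows bound the heights of their vertices. -/
theorem ColWalk.finish (h : ColWalk N f sy sx q row₀ col₀ R₀ cy₀ cx₀ u₀ row col R cy cx u)
    (hf : Mates N f) (hu₀ : u₀ < N) (hr₀ : row₀ u₀ ≠ 0) (hr₁ : row₀ (f 1 u₀) ≠ 0)
    (hrows : Rows N f row₀ R₀ cy₀) (hcols : Cols N f col₀ cx₀)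
    (hnr : ¬ Rung f row₀ R₀ u₀) (h0 : col u ≠ 0)
    (hx : Rung f row₀ R₀ (f 1 u₀) → ∀ w < N, col₀ w = 0 → row₀ w ≠ 0 →
      w = f 1 u₀ ∨ row₀ u₀ ≤ row₀ w) :
    Settled N f sy q row col R ∧ col u₀ = cx₀ + 1 := by
  have hu := h.lt
  have e : u = u₀ := by
    have := h.front u hu h0
    have := hf.ne_self 1 u hu
    grind
  subst e
  obtain ⟨-, hst, -⟩ | ⟨g1, g2, g3⟩ := h.start
  · exact absurd hst h0
  have e1 := hf.invol 1 u hu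
  refine ⟨⟨?_, ?_, ?_⟩, g2⟩
  · intro y hy hy0
    have := h.front y hy hy0
    have := hf.invol 1 y hy
    grind
  · intro y hy hys
    have := h.status y hy hys
    have := hf.invol 1 y hy
    have := hf.ne_self 1 y hy
    grind
  · intro y hy hys hru c1 c2 w hw hw'
    by_cases hyu : y = f 1 u
    · subst hyu
      rw [e1] at hw' ⊢
      have hlx := h.stage.cols.le _ hy c1
      have hcw : col₀ w = 0 := by
        by_contra c
        have := h.col_ext.keep w hw c
        have := hcols.le w hw c
        omega
      have k1 := h.row_ext.keep u hu hr₀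
      have k2 := hrows.le u hu hr₀
      by_cases hrw : row₀ w = 0
      · have := h.row_ext.new w hw hrw (h.stage.col_row w hw (by omega))
        omega
      · have k3 := h.row_ext.keep w hw hrw
        have := hx (hru.anti hrows h.row_ext h.keep hf hy hr₁ (by rwa [e1])) w hw hcw hrw
        rcases this with rfl | h
        · omega
        · omega
    · exact h.clear y hy hys hru hyu c1 c2 w hw hw'

end

/-! ### One component: the root, the sweep over its rows, the resulting layout. -/

/-- Rows and columns have been assigned to a union of components. -/
structure Finished (N : ℕ) (f : Fin 3 → ℕ → ℕ) (row col R : ℕ → ℕ) (cy cx : ℕ) : Prop where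
  rows : Rows N f row R cy
  cols : Cols N f col cx
  col_row : ∀ v < N, col v ≠ 0 → row v ≠ 0
  row_col : ∀ v < N, row v ≠ 0 → col v ≠ 0
  closed : ∀ v < N, row v ≠ 0 → row (f 1 v) ≠ 0

/-- Result of the traversal along `f 2` and `f 1` that starts at `u₀`. -/
structure ColCycle (N : ℕ) (f : Fin 3 → ℕ → ℕ) (sy sx q : ℕ) (row₀ col₀ R₀ : ℕ → ℕ)
    (cy₀ cx₀ u₀ : ℕ) (row col R : ℕ → ℕ) (cy cx : ℕ) : Prop where
  stage : Stage N f sy sx q row col R cy cx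
  settled : Settled N f sy q row col R
  row_ext : Extends N row₀ row cy₀
  col_ext : Extends N col₀ col cx₀
  keep : ∀ ρ < cy₀, R ρ = R₀ ρ
  le_row : cy₀ ≤ cy
  le_col : cx₀ ≤ cx
  start_ne : col u₀ ≠ 0
  start : col₀ u₀ = 0 → col u₀ = cx₀ + 1

/-- The second vertices of the rows `sy + 1, …, a` of the current component have columns. -/
structure Sweep (N : ℕ) (f : Fin 3 → ℕ → ℕ) (sy sx q : ℕ) (row₀ row col R : ℕ → ℕ)
    (cy cx a : ℕ) : Prop where
  stage : Stage N f sy sx q row col R cy cx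
  settled : Settled N f sy q row col R
  ext : Extends N row₀ row sy
  root : col (f 1 q) = sx + 1
  le : sy ≤ a
  le' : a ≤ cy
  done : ∀ ρ < a, sy ≤ ρ → col (f 0 (R ρ)) ≠ 0

section

variable {N : ℕ} {f : Fin 3 → ℕ → ℕ} {row col R row' col' R' row₀ col₀ R₀ : ℕ → ℕ}
  {cy cx cy' cx' cy₀ cx₀ : ℕ} {sy sx q u v u₀ a : ℕ}

theorem ColWalk.cycle (h : ColWalk N f sy sx q row₀ col₀ R₀ cy₀ cx₀ u₀ row col R cy cx u)
    (hf : Mates N f) (hu₀ : u₀ < N) (hr₀ : row₀ u₀ ≠ 0) (hr₁ : row₀ (f 1 u₀) ≠ 0)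
    (hrows : Rows N f row₀ R₀ cy₀) (hcols : Cols N f col₀ cx₀)
    (hnr : ¬ Rung f row₀ R₀ u₀) (h0 : col u ≠ 0)
    (hx : Rung f row₀ R₀ (f 1 u₀) → ∀ w < N, col₀ w = 0 → row₀ w ≠ 0 →
      w = f 1 u₀ ∨ row₀ u₀ ≤ row₀ w) :
    ColCycle N f sy sx q row₀ col₀ R₀ cy₀ cx₀ u₀ row col R cy cx := by
  obtain ⟨h1, h2⟩ := h.finish hf hu₀ hr₀ hr₁ hrows hcols hnr h0 hx
  exact ⟨h.stage, h1, h.row_ext, h.col_ext, h.keep, h.le_row, h.le_col, by omega, fun _ => h2⟩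

theorem ColCycle.refl (h : Stage N f sy sx q row col R cy cx) (hs : Settled N f sy q row col R)
    (h0 : col u ≠ 0) : ColCycle N f sy sx q row col R cy cx u row col R cy cx where
  stage := h
  settled := hs
  row_ext := ⟨fun _ _ _ => rfl, fun _ _ h h' => absurd h h'⟩
  col_ext := ⟨fun _ _ _ => rfl, fun _ _ h h' => absurd h h'⟩
  keep _ _ := rfl
  le_row := le_rfl
  le_col := le_rfl
  start_ne := h0
  start h := absurd h h0

theorem Finished.stage (h : Finished N f row col R cy cx) (hf : Mates N f) (hq : q < N)
    (h0 : row q = 0) (hc : RowCycle N f row R cy q row' R' cy') :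
    Stage N f cy cx q row' col R' cy' cx := by
  have hst := hc.start h0
  refine ⟨hc.rows, h.cols, ?_, hc.closed, ?_, ?_, hq, hst.1, by omega, le_rfl⟩
  · intro v hv c
    have := h.col_row v hv c
    rw [hc.ext.keep v hv this]
    exact this
  · intro v hv c d
    have e : row v ≠ 0 := by
      intro e
      have := hc.ext.new v hv e c
      omega
    refine ⟨h.row_col v hv e, ?_⟩
    have e1 := h.closed v hv e
    have := hc.ext.keep _ (hf.lt 1 v hv) e1
    have := h.rows.le _ (hf.lt 1 v hv) e1
    omega
  · intro v hv c
    have e := h.col_row v hv c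
    have := hc.ext.keep v hv e
    have := h.rows.le v hv e
    have := h.cols.le v hv c
    omega

theorem Finished.settled (h : Finished N f row col R cy cx) (hf : Mates N f)
    (hc : RowCycle N f row R cy q row' R' cy') : Settled N f cy q row' col R' := by
  have key : ∀ y < N, cy < row' y → row y = 0 := by
    intro y hy c
    by_contra d
    have := hc.ext.keep y hy d
    have := h.rows.le y hy d
    omega
  refine ⟨?_, ?_, ?_⟩
  · intro v hv c
    exact h.row_col _ (hf.lt 1 v hv) (h.closed v hv (h.col_row v hv c))
  · intro y hy c
    rcases (hc.status y hy (key y hy c) (by omega)).2 with g | g | g | g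
    · exact .inr (.inr (.inr (.inr (.inl g))))
    · exact .inr (.inr (.inr (.inr (.inr g))))
    · exact .inl g
    · exact .inr (.inl g)
  · intro y hy c _ d
    exact absurd (key y hy c) (h.col_row y hy d)

/-- The root joins the lowest row of its cycle to the highest, and `q` is the first vertex of its
row. Hence the first column traversal may start at `f 1 q`: both conditions on its closing edge are
met trivially. -/
theorem RowCycle.root_not_rung (hc : RowCycle N f row R cy q row' R' cy') (hf : Mates N f)
    (hq : q < N) (h0 : row q = 0) :
    ¬ Rung f row' R' (f 1 q) ∧ ¬ Rung f row' R' (f 1 (f 1 q)) := by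
  have hst := hc.start h0
  rw [hf.invol 1 q hq]
  constructor
  · rintro ⟨-, -, h⟩
    rw [hf.invol 1 q hq] at h
    omega
  · rintro ⟨-, h, -⟩
    rw [hst.1, Nat.add_sub_cancel, hst.2.2.1] at h
    exact hf.ne_self 0 q hq h.symm

theorem Finished.col_root (h : Finished N f row col R cy cx) (hf : Mates N f) (hq : q < N)
    (h0 : row q = 0) : col (f 1 q) = 0 := by
  by_contra c
  have h1 := h.closed _ (hf.lt 1 q hq) (h.col_row _ (hf.lt 1 q hq) c)
  rw [hf.invol 1 q hq] at h1
  exact h1 h0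

theorem ColCycle.sweep (h : ColCycle N f sy sx q row' col₀ R₀ cy₀ sx (f 1 q) row col R cy cx)
    (hr : Extends N row₀ row' sy) (h0 : col₀ (f 1 q) = 0) (hle : sy ≤ cy₀) :
    Sweep N f sy sx q row₀ row col R cy cx sy where
  stage := h.stage
  settled := h.settled
  ext := by
    have := h.row_ext
    refine ⟨?_, ?_⟩
    · intro v hv c
      have := hr.keep v hv c
      have := h.row_ext.keep v hv
      omega
    · intro v hv c d
      have := hr.new v hv c
      have := h.row_ext.new v hv
      have := h.row_ext.keep v hv
      omega
  root := h.start h0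
  le := le_rfl
  le' := h.stage.le_row.le
  done _ h1 h2 := by omega

/-- Second vertices are covered by `done`. A first vertex is the upper end of a rung from the
previous row, an end of a bracket, or an end of the root; in each case its `f 1`-edge already has a
column at one end, hence at both. So even the first vertex of row `a + 1` has a column. -/
theorem Sweep.col_ne (h : Sweep N f sy sx q row₀ row col R cy cx a) (hf : Mates N f)
    {x : ℕ} (hx : x < N) (h0 : row x ≠ 0) (hxa : row x ≤ a ∨ x = R a) : col x ≠ 0 := by
  intro c
  have hs := h.stage
  have hx1 := hf.lt 1 x hx
  have ex := hf.invol 1 x hx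
  have cl := h.settled.closed
  have hsx : sy < row x := by
    by_contra d
    exact (hs.old x hx h0 (by omega)).1 c
  have hle := hs.rows.le x hx h0
  have c1 : col (f 1 x) = 0 := by
    by_contra d
    have := cl _ hx1 d
    rw [ex] at this
    exact this c
  have hqc : col (f 1 q) ≠ 0 := by have := h.root; omega
  have hra : row x ≤ a + 1 := by
    rcases hxa with d | d
    · omega
    · by_cases e : a < cy
      · have := hs.rows.fst a e
        rw [← d] at this
        omega
      · have := h.le'
        omega
  -- A vertex without a column must be the first of its row.
  have hm : x = R (row x - 1) := by
    rcases hs.rows.mem x hx h0 with d | d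
    · exact d
    · rcases hxa with e | e
      · have := h.done (row x - 1) (by omega) (by omega)
        rw [← d] at this
        exact absurd c this
      · by_cases e' : a < cy
        · have := hs.rows.fst a e'
          rw [← e] at this
          rwa [this]
        · have := h.le'
          have := h.done (row x - 1) (by omega) (by omega)
          rw [← d] at this
          exact absurd c this
  rcases h.settled.status x hx hsx with g | g | g | g | g | g
  · have := g.2.1
    rw [← hm] at this
    exact hf.ne_self 0 x hx this.symm
  · obtain ⟨g0, g1, g2⟩ := g
    rw [ex] at g2
    have : sy < row (f 1 x) := by
      by_contra d
      have := (hs.old _ hx1 g0 (by omega)).2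
      rw [ex] at this
      omega
    have := h.done (row (f 1 x) - 1) (by omega) (by omega)
    rw [← g1] at this
    exact this c1
  · exact g.1.col_ne c
  · exact g.1.col_ne c1
  · rw [g] at c1
    exact hqc c1
  · rw [← g, ex] at hqc
    exact hqc c

/-- The reason for sweeping upwards: by `col_ne`, apart from the lower end of the link from row `a +
1`, all vertices without a column are in row `a + 2` or higher, which is the row of its upper end.
-/
theorem Sweep.start (h : Sweep N f sy sx q row₀ row col R cy cx a) (hf : Mates N f)
    (ha : a < cy) (h0 : col (f 1 (f 0 (R a))) = 0) :
    ¬ Rung f row R (f 1 (f 0 (R a))) ∧ (Rung f row R (f 1 (f 1 (f 0 (R a)))) →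
      ∀ w < N, col w = 0 → row w ≠ 0 → w = f 1 (f 1 (f 0 (R a))) ∨
        row (f 1 (f 0 (R a))) ≤ row w) := by
  have hR := h.stage.rows.lt a ha
  have hx := hf.lt 0 _ hR
  have hrx := h.stage.rows.snd a ha
  rw [hf.invol 1 _ hx]
  constructor
  · rintro ⟨g0, -, g⟩
    rw [hf.invol 1 _ hx] at g
    exact h.col_ne hf (hf.lt 1 _ hx) g0 (.inl (by omega)) h0
  · rintro ⟨-, -, g⟩ w hw c d
    by_cases e : row w = a + 1
    · rcases h.stage.rows.mem w hw d with e' | e'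
      · rw [e, Nat.add_sub_cancel] at e'
        exact absurd c (h.col_ne hf hw d (.inr e'))
      · rw [e, Nat.add_sub_cancel] at e'
        exact .inl e'
    · right
      by_contra e'
      exact h.col_ne hf hw d (.inl (by omega)) c

theorem Sweep.step (h : Sweep N f sy sx q row₀ row col R cy cx a) (hf : Mates N f)
    (ha : a < cy)
    (hc : ColCycle N f sy sx q row col R cy cx (f 1 (f 0 (R a))) row' col' R' cy' cx') :
    Sweep N f sy sx q row₀ row' col' R' cy' cx' (a + 1) := by
  have hle := h.le
  have hR := h.stage.rows.lt a ha
  have hx := hf.lt 0 _ hR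
  have h1 := hc.settled.closed _ (hf.lt 1 _ hx) hc.start_ne
  rw [hf.invol 1 _ hx] at h1
  have hsy := h.stage.le_row
  have hlr := hc.le_row
  refine ⟨hc.stage, hc.settled, ⟨?_, ?_⟩, ?_, by omega, by omega, ?_⟩
  · intro v hv c
    have := h.ext.keep v hv c
    have := hc.row_ext.keep v hv
    omega
  · intro v hv c d
    have := h.ext.new v hv c
    have := hc.row_ext.new v hv
    have := hc.row_ext.keep v hv
    omega
  · have := h.root
    rw [hc.col_ext.keep _ (hf.lt 1 q h.stage.lt) (by omega), this]
  · intro ρ hρ hs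
    rw [hc.keep ρ (by omega)]
    by_cases e : ρ = a
    · rwa [e]
    · have h2 := h.done ρ (by omega) hs
      rwa [hc.col_ext.keep _ (hf.lt 0 _ (h.stage.rows.lt ρ (by omega))) h2]

theorem Sweep.finished (h : Sweep N f sy sx q row₀ row col R cy cx cy) (hf : Mates N f) :
    Finished N f row col R cy cx where
  rows := h.stage.rows
  cols := h.stage.cols
  col_row := h.stage.col_row
  row_col v hv h0 := h.col_ne hf hv h0 (.inl (h.stage.rows.le v hv h0))
  closed := h.stage.closed

/-- Once all columns are assigned, the exemptions for missing columns in `Settled` and `Bracket` are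
void, so rungs are links and brackets are closing edges. -/
theorem Sweep.layout (h : Sweep N f sy sx q row₀ row col R cy cx cy) (hf : Mates N f) :
    Layout N f {v | v < N ∧ sy < row v} row col (fun v => v = f 0 (R (row v - 1)))
      sx cx sy cy q := by
  have fin := h.finished hf
  have hs := h.stage
  have hrow : ∀ v < N, sy < row v → sx < col v := by
    intro v hv c
    have := hs.old_col v hv (fin.row_col v hv (by omega))
    omega
  have hrow' : ∀ v < N, sx < col v → sy < row v := by
    intro v hv c
    have := hs.old_col v hv (by omega)
    omega
  have m0 : ∀ v < N, sy < row v → row (f 0 v) = row v :=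
    fun v hv c => hs.rows.mate hf hv (by omega)
  have m2 : ∀ v < N, sx < col v → col (f 2 v) = col v :=
    fun v hv c => hs.cols.mate v hv (by omega)
  have link : ∀ v < N, sy < row v → Rung f row R v →
      Link f {v | v < N ∧ sy < row v} row col (fun v => v = f 0 (R (row v - 1))) v := by
    intro v hv c g
    refine ⟨g.2.1, g.2.2, ?_⟩
    intro w hw hw'
    have hv1 := hf.lt 1 v hv
    exact h.settled.clear v hv c g (fin.row_col v hv g.1)
      (fin.row_col _ hv1 (fin.closed v hv g.1)) w hw.1 hw'
  have clos : ∀ v < N, Bracket N f row col v → col (f 1 v) = col v + 1 →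
      Closing f {v | v < N ∧ sy < row v} row col v := by
    intro v hv g g'
    refine ⟨g', g.row_lt, fun w hw => g.closed w hw.1, fun w hw c d => ?_⟩
    have := g.left w hw.1 c d
    have := fin.row_col w hw.1 (by have := hw.2; omega)
    omega
  have hq1 := hf.lt 1 q hs.lt
  have rung_row : ∀ v < N, sy < row v → Rung f row R (f 1 v) → sy < row (f 1 v) := by
    intro v hv c g
    by_contra d
    have := (hs.old _ (hf.lt 1 v hv) g.1 (by omega)).2
    rw [hf.invol 1 v hv] at this
    omega
  refine ⟨fun v hv => hv.1, ?_, ⟨hs.lt, by have := hs.row_root; omega⟩, ?_, ?_, ?_, ?_, ?_, ?_,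
    ?_, hs.row_root, h.root, ?_⟩
  · rintro i v ⟨hv, c⟩
    refine ⟨hf.lt i v hv, ?_⟩
    rcases (by fin_cases i <;> simp : i = 0 ∨ i = 1 ∨ i = 2) with rfl | rfl | rfl
    · rw [m0 v hv c]
      exact c
    · by_contra d
      have hv1 := hf.lt 1 v hv
      have := (hs.old _ hv1 (hs.closed v hv (by omega)) (by omega)).2
      rw [hf.invol 1 v hv] at this
      omega
    · have := hrow v hv c
      exact hrow' _ (hf.lt 2 v hv) (by rw [m2 v hv this]; exact this)
  · rintro v ⟨hv, c⟩
    exact ⟨c, hs.rows.le v hv (by omega)⟩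
  · rintro v ⟨hv, c⟩
    have := hrow v hv c
    exact ⟨this, hs.cols.le v hv (by omega)⟩
  · exact fun v hv => m0 v hv.1 hv.2
  · exact fun v hv => m2 v hv.1 (hrow v hv.1 hv.2)
  · rintro u ⟨hu, c⟩ v ⟨hv, d⟩ e
    exact hs.rows.inj hf hu hv (by omega) e
  · rintro u ⟨hu, c⟩ v ⟨hv, d⟩ e
    have := hrow u hu c
    exact hs.cols.inj u hu v hv (by omega) e
  · rintro v ⟨hv, c⟩ e e'
    rw [m0 v hv c] at e'
    exact hf.ne_self 0 v hv (e'.trans e.symm)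
  · rintro v ⟨hv, c⟩
    rcases h.settled.status v hv c with g | g | g | g | g | g
    · exact .inl (.inl (link v hv c g))
    · exact .inr (.inl (link _ (hf.lt 1 v hv) (rung_row v hv c g) g))
    · exact .inl (.inr (.inl (clos v hv g.1 g.2)))
    · exact .inr (.inr (.inl (clos _ (hf.lt 1 v hv) g.1 (by rw [hf.invol 1 v hv]; exact g.2))))
    · exact .inl (.inr (.inr g))
    · exact .inr (.inr (.inr g))

end

/-! ### Adding a component to the drawing. -/

theorem Sep.congr {X Y X' Y' : ℕ → ℕ} {a b c d : ℕ} (h : Sep X Y a b c d)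
    (ha : X' a = X a ∧ Y' a = Y a) (hb : X' b = X b ∧ Y' b = Y b) (hc : X' c = X c ∧ Y' c = Y c)
    (hd : X' d = X d ∧ Y' d = Y d) : Sep X' Y' a b c d := by
  simpa only [Sep, ha, hb, hc, hd] using h

theorem Good.congr {N : ℕ} {f : Fin 3 → ℕ → ℕ} {S : Set ℕ} {X Y X' Y' : ℕ → ℕ}
    (h : Good N f S X Y) (cl : ∀ i, ∀ v ∈ S, f i v ∈ S) (e : ∀ v ∈ S, X' v = X v ∧ Y' v = Y v) :
    Good N f S X' Y' := by
  have sep : ∀ {a b c d}, Sep X Y a b c d → a ∈ S → b ∈ S → c ∈ S → d ∈ S → Sep X' Y' a b c d :=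
    fun h ha hb hc hd => h.congr (e _ ha) (e _ hb) (e _ hc) (e _ hd)
  refine ⟨?_, ?_, ?_, ?_, ?_, ?_, ?_, ?_⟩
  · intro u hu v hv
    rw [(e u hu).1, (e u hu).2, (e v hv).1, (e v hv).2]
    exact h.inj u hu v hv
  · exact fun i u hu w hw h1 h2 => sep (h.avoid i u hu w hw h1 h2) hu (cl _ _ hu) hw hw
  · exact fun i u hu w hw h1 h2 =>
      sep (h.par i u hu w hw h1 h2) hu (cl _ _ hu) hw (cl _ _ hw)
  · exact fun j hj u hu v hv => sep (h.mid j hj u hu v hv) hu (cl _ _ hu) hv (cl _ _ hv)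
  · intro u hu
    rw [(e u hu).2, (e _ (cl 0 u hu)).2]
    exact (h.hor u hu).imp_right fun g v hv => sep (g v hv) hu (cl _ _ hu) hv (cl _ _ hv)
  · intro u hu
    rw [(e u hu).1, (e _ (cl 2 u hu)).1]
    exact (h.ver u hu).imp_right fun g v hv => sep (g v hv) hu (cl _ _ hu) hv (cl _ _ hv)
  · intro u hu v hv
    rw [(e u hu).2, (e _ (cl 0 u hu)).2, (e v hv).2, (e _ (cl 0 v hv)).2]
    exact h.hor_unique u hu v hv
  · intro u hu v hv
    rw [(e u hu).1, (e _ (cl 2 u hu)).1, (e v hv).1, (e _ (cl 2 v hv)).1]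
    exact h.ver_unique u hu v hv

theorem Finished.closed_all {N : ℕ} {f : Fin 3 → ℕ → ℕ} {row col R : ℕ → ℕ} {cy cx : ℕ}
    (h : Finished N f row col R cy cx) (hf : Mates N f) (i : Fin 3) (v : ℕ) (hv : v < N)
    (h0 : row v ≠ 0) : row (f i v) ≠ 0 := by
  rcases (by fin_cases i <;> simp : i = 0 ∨ i = 1 ∨ i = 2) with rfl | rfl | rfl
  · rw [h.rows.mate hf hv h0]
    exact h0
  · exact h.closed v hv h0
  · refine h.col_row _ (hf.lt 2 v hv) ?_
    have := h.row_col v hv h0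
    rw [h.cols.mate v hv this]
    exact this

/-- A union of components that has been drawn. -/
structure Drawn (N : ℕ) (f : Fin 3 → ℕ → ℕ) (row : ℕ → ℕ) (cy cx : ℕ) (X Y : ℕ → ℕ) : Prop where
  good : Good N f {v | v < N ∧ row v ≠ 0} X Y
  le : ∀ v < N, row v ≠ 0 → X v ≤ 2 * cx ∧ Y v ≤ 2 * cy

/-- Earlier vertices have first coordinate at most `2 * sx`, and new ones have a larger one, even
after `f 1 q` is moved. -/
theorem Sweep.drawn {N : ℕ} {f : Fin 3 → ℕ → ℕ} {row₀ col₀ R₀ row col R X₀ Y₀ X Y : ℕ → ℕ}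
    {cy cx sy sx q : ℕ}
    (h : Sweep N f sy sx q row₀ row col R cy cx cy) (hf : Mates N f)
    (h₀ : Finished N f row₀ col₀ R₀ sy sx) (hd : Drawn N f row₀ sy sx X₀ Y₀)
    (hX : ∀ v < N, row₀ v ≠ 0 → X v = X₀ v ∧ Y v = Y₀ v)
    (hC : Coords f {v | v < N ∧ sy < row v} row col sx cx sy cy q X Y) :
    Drawn N f row cy cx X Y := by
  have hl := h.layout hf
  have hset : {v | v < N ∧ row v ≠ 0} = {v | v < N ∧ row₀ v ≠ 0} ∪ {v | v < N ∧ sy < row v} := by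
    ext v
    simp only [Set.mem_ofPred_eq, Set.mem_union]
    have := h.ext.keep v
    have := h.ext.new v
    have := h₀.rows.le v
    constructor
    · rintro ⟨hv, c⟩
      by_cases e : row₀ v = 0
      · exact .inr ⟨hv, by omega⟩
      · exact .inl ⟨hv, e⟩
    · rintro (⟨hv, c⟩ | ⟨hv, c⟩)
      · exact ⟨hv, by omega⟩
      · exact ⟨hv, by omega⟩
  have cl₀ : ∀ i, ∀ v ∈ {v | v < N ∧ row₀ v ≠ 0}, f i v ∈ {v | v < N ∧ row₀ v ≠ 0} :=
    fun i v hv => ⟨hf.lt i v hv.1, h₀.closed_all hf i v hv.1 hv.2⟩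
  refine ⟨?_, ?_⟩
  · rw [hset]
    refine Good.union (x := 2 * sx) (hd.good.congr cl₀ fun v hv => hX v hv.1 hv.2) (hl.good hC hf)
      cl₀ hl.closed ?_ ?_
    · intro v hv
      rw [(hX v hv.1 hv.2).1]
      exact (hd.le v hv.1 hv.2).1
    · exact fun v hv => (hl.fst_bounds hC hv).1
  · intro v hv c
    have hm : v ∈ {v | v < N ∧ row v ≠ 0} := ⟨hv, c⟩
    rw [hset] at hm
    rcases hm with hm | hm
    · have h1 := hX v hv hm.2
      have h2 := hd.le v hv hm.2
      have := h.stage.le_row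
      have := h.stage.le_col
      omega
    · exact ⟨(hl.fst_bounds hC hm).2, (hl.snd_bounds hC hm).2⟩

/-! ### Programs that draw a cubic graph: correctness and running time. -/

open WordRAM

/-- Only the listed registers and arrays have changed. -/
structure Frame (regs arrs : List ℕ) (s s' : State) : Prop where
  reg : ∀ r, r ∉ regs → s'.reg r = s.reg r
  arr : ∀ a, a ∉ arrs → s'.arr a = s.arr a

theorem Frame.refl {regs arrs : List ℕ} (s : State) : Frame regs arrs s s :=
  ⟨fun _ _ => rfl, fun _ _ => rfl⟩

theorem Frame.trans {regs arrs : List ℕ} {s s' s'' : State} (h : Frame regs arrs s s')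
    (h' : Frame regs arrs s' s'') : Frame regs arrs s s'' :=
  ⟨fun r hr => (h'.reg r hr).trans (h.reg r hr), fun a ha => (h'.arr a ha).trans (h.arr a ha)⟩

theorem Frame.mono {regs arrs regs' arrs' : List ℕ} {s s' : State} (h : Frame regs arrs s s')
    (hr : regs ⊆ regs') (ha : arrs ⊆ arrs') : Frame regs' arrs' s s' :=
  ⟨fun r hr' => h.reg r fun hh => hr' (hr hh), fun a ha' => h.arr a fun hh => ha' (ha hh)⟩

theorem Frame.setReg {regs arrs : List ℕ} {s s' : State} (h : Frame regs arrs s s') {r x : ℕ}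
    (hr : r ∈ regs) : Frame regs arrs s (s'.setReg r x) := by
  refine ⟨fun r' hr' => ?_, fun a ha => h.arr a ha⟩
  rw [State.setReg_reg, if_neg (by rintro rfl; exact hr' hr), h.reg r' hr']

theorem Frame.setArr {regs arrs : List ℕ} {s s' : State} (h : Frame regs arrs s s') {a i x : ℕ}
    (ha : a ∈ arrs) : Frame regs arrs s (s'.setArr a i x) := by
  refine ⟨fun r hr => h.reg r hr, fun a' ha' => ?_⟩
  rw [State.setArr_arr, if_neg (by rintro rfl; exact ha' ha), h.arr a' ha']

/-- The arrays `5`, `6`, `7` hold the mates. -/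
structure HasMates (N : ℕ) (f : Fin 3 → ℕ → ℕ) (s : State) : Prop where
  fst : ∀ v < N, s.arr 5 v = f 0 v
  mid : ∀ v < N, s.arr 6 v = f 1 v
  snd : ∀ v < N, s.arr 7 v = f 2 v

theorem HasMates.frame {N : ℕ} {f : Fin 3 → ℕ → ℕ} {regs arrs : List ℕ} {s s' : State}
    (h : HasMates N f s) (hF : Frame regs arrs s s') (h5 : 5 ∉ arrs) (h6 : 6 ∉ arrs)
    (h7 : 7 ∉ arrs) : HasMates N f s' := by
  refine ⟨?_, ?_, ?_⟩
  · rw [hF.arr 5 h5]; exact h.fst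
  · rw [hF.arr 6 h6]; exact h.mid
  · rw [hF.arr 7 h7]; exact h.snd

/-- Assigns rows along the cycle of `f 0` and `f 1` through the vertex in register `6`. -/
def rowLoop : Program :=
  .while (.eq (.load 8 (.reg 6)) (.const 0)) <|
    .seq (.set 7 (.load 5 (.reg 6))) <|
    .seq (.store 8 (.reg 6) (.add (.reg 3) (.const 1))) <|
    .seq (.store 8 (.reg 7) (.add (.reg 3) (.const 1))) <|
    .seq (.store 10 (.reg 3) (.reg 6)) <|
    .seq (.set 3 (.add (.reg 3) (.const 1))) <|
    .set 6 (.load 6 (.reg 7))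

/-- Arrays `8`, `9`, `10` hold rows, columns and first vertices of rows; registers `3` and `4` count
rows and columns. Time is charged to the growth of register `3`, so that later bounds telescope. -/
theorem rowLoop_run {N W : ℕ} {f : Fin 3 → ℕ → ℕ} {s : State} (hf : Mates N f) (hW : 2 * N + 2 ≤ W)
    (hm : HasMates N f s) (hv : s.reg 6 < N)
    (hr : Rows N f (s.arr 8) (s.arr 10) (s.reg 3))
    (hc : ∀ y < N, s.arr 8 y ≠ 0 → s.arr 8 (f 1 y) ≠ 0) :
    Run W rowLoop s fun t s' =>
      RowCycle N f (s.arr 8) (s.arr 10) (s.reg 3) (s.reg 6) (s'.arr 8) (s'.arr 10) (s'.reg 3) ∧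
        Frame [3, 6, 7] [8, 10] s s' ∧ t + 40 * s.reg 3 ≤ 40 * s'.reg 3 + 40 := by
  by_cases h0 : s.arr 8 (s.reg 6) = 0
  · refine Run.loop (fun t s' =>
      RowWalk N f (s.arr 8) (s.arr 10) (s.reg 3) (s.reg 6) (s'.arr 8) (s'.arr 10) (s'.reg 3)
        (s'.reg 6) ∧ Frame [3, 6, 7] [8, 10] s s' ∧ t + 40 * s.reg 3 ≤ 40 * s'.reg 3)
      (fun s' => N - s'.reg 3) ⟨RowWalk.init hr hv h0 hc, Frame.refl s, by omega⟩ ?_ ?_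
    · rintro t s' ⟨hw, hF, ht⟩ hb
      have hm' := hm.frame hF (by decide) (by decide) (by decide)
      have hv' := hw.lt
      simp only [Test.holds, Expr.eval] at hb
      have hz := hf.lt 0 _ hv'
      have hcy := hw.rows.le_card
      have h5 := hm'.fst _ hv'
      have h6 := hm'.mid _ hz
      have hs := hw.step (row' := Function.update (Function.update (s'.arr 8) (s'.reg 6)
          (s'.reg 3 + 1)) (f 0 (s'.reg 6)) (s'.reg 3 + 1))
        (R' := Function.update (s'.arr 10) (s'.reg 3) (s'.reg 6)) hf hb
        (by intro y; simp only [Function.update_apply]; split_ifs <;> grind)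
        (by intro ρ; simp only [Function.update_apply])
      have hs' := hs.rows.le_card
      have hl := hs.lt
      refine Run.seq (Run.set ?_ ?_)
      · simp [Expr.eval]; omega
      refine Run.seq (Run.store ?_ ?_ ?_)
      · simp [Expr.eval, State.setReg_reg]; omega
      · simp [Expr.eval, State.setReg_reg]; omega
      refine Run.seq (Run.store ?_ ?_ ?_)
      · simp [Expr.eval, State.setReg_reg]; omega
      · simp [Expr.eval, State.setReg_reg]; omega
      refine Run.seq (Run.store ?_ ?_ ?_)
      · simp [Expr.eval, State.setReg_reg]; omega
      · simp [Expr.eval, State.setReg_reg]; omega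
      refine Run.seq (Run.set ?_ ?_)
      · simp [Expr.eval, State.setReg_reg]; omega
      refine Run.set ?_ ?_
      · simp [Expr.eval, State.setReg_reg, State.setArr_arr, h5, h6]; omega
      refine ⟨⟨?_, ?_, ?_⟩, ?_⟩
      · simpa [Expr.eval, State.setReg_reg, State.setArr_arr, h5, h6] using hs
      · repeat' first
          | exact hF | refine Frame.setReg ?_ (by decide) | refine Frame.setArr ?_ (by decide)
      · simp [Expr.eval, Expr.cost, Test.cost, State.setReg_reg]
        omega
      · simp [Expr.eval, State.setReg_reg]
        omega
    · rintro t s' ⟨hw, hF, ht⟩ hb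
      simp only [Test.holds, Expr.eval] at hb
      refine ⟨hw.finish hf hb, hF, ?_⟩
      simp [Expr.cost, Test.cost]
      omega
  -- A start that already has a row costs only the test, so the column traversal may call this loop
  -- at every step.
  · refine ⟨_, s, .whileFalse (by simpa [Test.holds, Expr.eval] using h0), RowCycle.refl hr h0 hc,
      Frame.refl s, ?_⟩
    simp [Expr.cost, Test.cost]
    omega

/-- Assigns columns along the cycle of `f 2` and `f 1` through the vertex in register `8`, and rows
along the cycles of `f 0` and `f 1` that it meets. -/
def colLoop : Program :=
  .while (.eq (.load 9 (.reg 8)) (.const 0)) <|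
    .seq (.set 9 (.load 7 (.reg 8))) <|
    .seq (.store 9 (.reg 8) (.add (.reg 4) (.const 1))) <|
    .seq (.store 9 (.reg 9) (.add (.reg 4) (.const 1))) <|
    .seq (.set 4 (.add (.reg 4) (.const 1))) <|
    .seq (.set 6 (.reg 9)) <|
    .seq rowLoop <|
    .set 8 (.load 6 (.reg 9))

theorem colLoop_run {N W sy sx q : ℕ} {f : Fin 3 → ℕ → ℕ} {s : State} (hf : Mates N f)
    (hW : 2 * N + 2 ≤ W) (hm : HasMates N f s) (hu : s.reg 8 < N) (hr : s.arr 8 (s.reg 8) ≠ 0)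
    (hs : Stage N f sy sx q (s.arr 8) (s.arr 9) (s.arr 10) (s.reg 3) (s.reg 4))
    (ht : Settled N f sy q (s.arr 8) (s.arr 9) (s.arr 10))
    (hx : s.arr 9 (s.reg 8) = 0 → ¬ Rung f (s.arr 8) (s.arr 10) (s.reg 8) ∧
      (Rung f (s.arr 8) (s.arr 10) (f 1 (s.reg 8)) → ∀ w < N, s.arr 9 w = 0 → s.arr 8 w ≠ 0 →
        w = f 1 (s.reg 8) ∨ s.arr 8 (s.reg 8) ≤ s.arr 8 w)) :
    Run W colLoop s fun t s' =>
      ColCycle N f sy sx q (s.arr 8) (s.arr 9) (s.arr 10) (s.reg 3) (s.reg 4) (s.reg 8)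
        (s'.arr 8) (s'.arr 9) (s'.arr 10) (s'.reg 3) (s'.reg 4) ∧
      Frame [3, 4, 6, 7, 8, 9] [8, 9, 10] s s' ∧
      t + 200 * (s.reg 3 + s.reg 4) ≤ 200 * (s'.reg 3 + s'.reg 4) + 200 := by
  by_cases h0 : s.arr 9 (s.reg 8) = 0
  · obtain ⟨hx1, hx2⟩ := hx h0
    have hr1 := hs.closed _ hu hr
    refine Run.loop (fun t s' =>
      ColWalk N f sy sx q (s.arr 8) (s.arr 9) (s.arr 10) (s.reg 3) (s.reg 4) (s.reg 8)
        (s'.arr 8) (s'.arr 9) (s'.arr 10) (s'.reg 3) (s'.reg 4) (s'.reg 8) ∧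
      Frame [3, 4, 6, 7, 8, 9] [8, 9, 10] s s' ∧
      t + 200 * (s.reg 3 + s.reg 4) ≤ 200 * (s'.reg 3 + s'.reg 4))
      (fun s' => N - s'.reg 4) ⟨ColWalk.init hs ht hu h0 hr, Frame.refl s, by omega⟩ ?_ ?_
    · rintro t s' ⟨hw, hF, ht⟩ hb
      have hm' := hm.frame hF (by decide) (by decide) (by decide)
      have hu' := hw.lt
      simp only [Test.holds, Expr.eval] at hb
      have hz := hf.lt 2 _ hu'
      have hcx := hw.stage.cols.le_card
      have h7 := hm'.snd _ hu'
      have h6 := hm'.mid _ hz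
      have hcol : ∀ y, (Function.update (Function.update (s'.arr 9) (s'.reg 8)
          (s'.reg 4 + 1)) (f 2 (s'.reg 8)) (s'.reg 4 + 1)) y =
          if y = s'.reg 8 ∨ y = f 2 (s'.reg 8) then s'.reg 4 + 1 else s'.arr 9 y := by
        intro y; simp only [Function.update_apply]; split_ifs <;> grind
      have hs' := (hw.stage.cols.step hf hu' hb hcol).le_card
      refine Run.seq (Run.set ?_ ?_)
      · simp [Expr.eval]; omega
      refine Run.seq (Run.store ?_ ?_ ?_)
      · simp [Expr.eval, State.setReg_reg]; omega
      · simp [Expr.eval, State.setReg_reg]; omega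
      refine Run.seq (Run.store ?_ ?_ ?_)
      · simp [Expr.eval, State.setReg_reg]; omega
      · simp [Expr.eval, State.setReg_reg]; omega
      refine Run.seq (Run.set ?_ ?_)
      · simp [Expr.eval, State.setReg_reg]; omega
      refine Run.seq (Run.set ?_ ?_)
      · simp [Expr.eval, State.setReg_reg]; omega
      simp only [Expr.eval, State.setReg_reg, State.setArr_reg, Expr.cost]
      simp only [Nat.reduceEqDiff, if_true, if_false, h7]
      generalize hS : State.setReg _ 6 _ = S
      have e8 : S.arr 8 = s'.arr 8 := by subst hS; simp [State.setArr_arr]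
      have e10 : S.arr 10 = s'.arr 10 := by subst hS; simp [State.setArr_arr]
      have e9 : S.arr 9 = (Function.update (Function.update (s'.arr 9) (s'.reg 8)
          (s'.reg 4 + 1)) (f 2 (s'.reg 8)) (s'.reg 4 + 1)) := by subst hS; simp [State.setArr_arr]
      have e3 : S.reg 3 = s'.reg 3 := by subst hS; simp [State.setReg_reg]
      have e4 : S.reg 4 = s'.reg 4 + 1 := by subst hS; simp [State.setReg_reg]
      have e6 : S.reg 6 = f 2 (s'.reg 8) := by subst hS; simp [State.setReg_reg]
      have er9 : S.reg 9 = f 2 (s'.reg 8) := by subst hS; simp [State.setReg_reg]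
      have hFS : Frame [3, 4, 6, 7, 8, 9] [8, 9, 10] s S := by
        subst hS
        repeat' first
          | exact hF | refine Frame.setReg ?_ (by decide) | refine Frame.setArr ?_ (by decide)
      clear hS
      refine Run.seq (Run.mono (rowLoop_run hf hW
        (hm.frame hFS (by decide) (by decide) (by decide)) (by rw [e6]; exact hz)
        (by rw [e8, e10, e3]; exact hw.stage.rows) (by rw [e8]; exact hw.stage.closed)) ?_)
      rintro t' s'' ⟨hc, hF', ht'⟩
      have hm'' := hm.frame (hFS.trans (hF'.mono (by decide) (by decide)))
        (by decide) (by decide) (by decide)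
      have r9 : s''.reg 9 = f 2 (s'.reg 8) := by rw [hF'.reg 9 (by decide), er9]
      have r4 : s''.reg 4 = s'.reg 4 + 1 := by rw [hF'.reg 4 (by decide), e4]
      have a9 := hF'.arr 9 (by decide)
      rw [e9] at a9
      rw [e8, e10, e3, e6] at hc
      have hstep := hw.step hf hu hr hr1 hs.rows hx1 hb hcol hc
      have hle := hc.le
      have h6' := hm''.mid _ hz
      refine Run.set ?_ ?_
      · simp only [Expr.eval, r9, h6']
        have := hf.lt 1 _ hz
        omega
      refine ⟨⟨?_, ?_, ?_⟩, ?_⟩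
      · simpa [Expr.eval, State.setReg_reg, r9, h6', r4, a9] using hstep
      · exact Frame.setReg (hFS.trans (hF'.mono (by decide) (by decide))) (by decide)
      · simp [Expr.cost, Test.cost, State.setReg_reg]
        omega
      · simp [State.setReg_reg]
        omega
    · rintro t s' ⟨hw, hF, ht⟩ hb
      simp only [Test.holds, Expr.eval] at hb
      refine ⟨hw.cycle hf hu hr hr1 hs.rows hs.cols hx1 hb hx2, hF, ?_⟩
      simp [Expr.cost, Test.cost]
      omega
  · refine ⟨_, s, .whileFalse (by simpa [Test.holds, Expr.eval] using h0), ColCycle.refl hs ht h0,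
      Frame.refl s, ?_⟩
    simp [Expr.cost, Test.cost]
    omega

/-- Traverses columns from all rows of the current component. -/
def sweepLoop : Program :=
  .while (.lt (.reg 5) (.reg 3)) <|
    .seq (.set 8 (.load 6 (.load 5 (.load 10 (.reg 5))))) <|
    .seq colLoop <|
    .set 5 (.add (.reg 5) (.const 1))

/-- Register `5` points to the next row to be swept, while the row count in register `3` may still
grow. The fixed cost of each call of `colLoop` is charged to register `5`. -/
theorem sweepLoop_run {N W sy sx q : ℕ} {f : Fin 3 → ℕ → ℕ} {row₀ : ℕ → ℕ} {s : State}
    (hf : Mates N f) (hW : 2 * N + 2 ≤ W) (hm : HasMates N f s)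
    (hs : Sweep N f sy sx q row₀ (s.arr 8) (s.arr 9) (s.arr 10) (s.reg 3) (s.reg 4) (s.reg 5)) :
    Run W sweepLoop s fun t s' =>
      Sweep N f sy sx q row₀ (s'.arr 8) (s'.arr 9) (s'.arr 10) (s'.reg 3) (s'.reg 4) (s'.reg 3) ∧
      s'.reg 5 = s'.reg 3 ∧ Frame [3, 4, 5, 6, 7, 8, 9] [8, 9, 10] s s' ∧
      t + (200 * (s.reg 3 + s.reg 4) + 300 * s.reg 5) ≤
        200 * (s'.reg 3 + s'.reg 4) + 300 * s'.reg 5 + 300 := by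
  refine Run.loop (fun t s' =>
    Sweep N f sy sx q row₀ (s'.arr 8) (s'.arr 9) (s'.arr 10) (s'.reg 3) (s'.reg 4) (s'.reg 5) ∧
      Frame [3, 4, 5, 6, 7, 8, 9] [8, 9, 10] s s' ∧
      t + (200 * (s.reg 3 + s.reg 4) + 300 * s.reg 5) ≤
        200 * (s'.reg 3 + s'.reg 4) + 300 * s'.reg 5)
    (fun s' => N - s'.reg 5) ⟨hs, Frame.refl s, by omega⟩ ?_ ?_
  · rintro t s' ⟨hw, hF, ht⟩ hb
    simp only [Test.holds, Expr.eval] at hb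
    have hm' := hm.frame hF (by decide) (by decide) (by decide)
    have hcy := hw.stage.rows.le_card
    have hR := hw.stage.rows.lt _ hb
    have hx := hf.lt 0 _ hR
    have hu := hf.lt 1 _ hx
    have hrow := hw.stage.rows.snd _ hb
    have hrow1 := hw.stage.closed _ hx (by omega)
    refine Run.seq (Run.set ?_ ?_)
    · simp only [Expr.eval, hm'.fst _ hR, hm'.mid _ hx]
      omega
    simp only [Expr.eval, hm'.fst _ hR, hm'.mid _ hx, Expr.cost]
    generalize hS : State.setReg _ 8 _ = S
    have er : ∀ r, r ≠ 8 → S.reg r = s'.reg r := by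
      intro r hr; subst hS; rw [State.setReg_reg, if_neg hr]
    have ea : S.arr = s'.arr := by subst hS; rfl
    have e8 : S.reg 8 = f 1 (f 0 (s'.arr 10 (s'.reg 5))) := by subst hS; simp [State.setReg_reg]
    have hFS : Frame [3, 4, 5, 6, 7, 8, 9] [8, 9, 10] s S := by
      subst hS; exact hF.setReg (by decide)
    clear hS
    refine Run.seq (Run.mono (colLoop_run (sy := sy) (sx := sx) (q := q) hf hW
      (hm.frame hFS (by decide) (by decide) (by decide)) (by rw [e8]; exact hu)
      (by rw [e8, ea]; exact hrow1)
      (by rw [ea, er 3 (by decide), er 4 (by decide)]; exact hw.stage)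
      (by rw [ea]; exact hw.settled)
      (by rw [e8, ea]; exact hw.start hf hb)) ?_)
    rintro t' s'' ⟨hc, hF', ht'⟩
    rw [ea, er 3 (by decide), er 4 (by decide), e8] at hc
    have r5 : s''.reg 5 = s'.reg 5 := by rw [hF'.reg 5 (by decide), er 5 (by decide)]
    have r3 := er 3 (by decide)
    have r4 := er 4 (by decide)
    refine Run.set ?_ ?_
    · simp only [Expr.eval, r5]
      omega
    refine ⟨⟨?_, ?_, ?_⟩, ?_⟩
    · simpa [Expr.eval, State.setReg_reg, r5] using hw.step hf hb hc
    · exact Frame.setReg (hFS.trans (hF'.mono (by decide) (by decide))) (by decide)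
    · simp [Expr.eval, Expr.cost, Test.cost, State.setReg_reg]
      omega
    · simp [Expr.eval, State.setReg_reg]
      omega
  · rintro t s' ⟨hw, hF, ht⟩ hb
    simp only [Test.holds, Expr.eval] at hb
    have := hw.le'
    have e : s'.reg 5 = s'.reg 3 := by omega
    rw [e] at hw
    refine ⟨hw, e, hF, ?_⟩
    simp [Expr.cost, Test.cost]
    omega

/-- Writes the coordinates of the vertices in the rows after the first `sy`. -/
def coordLoop : Program :=
  .while (.lt (.reg 13) (.reg 3)) <|
    .seq (.set 7 (.load 10 (.reg 13))) <|
    .seq (.store 11 (.reg 7) (.add (.load 9 (.reg 7)) (.reg 4))) <|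
    .seq (.store 12 (.reg 7) (.add (.load 8 (.reg 7)) (.reg 3))) <|
    .seq (.set 7 (.load 5 (.reg 7))) <|
    .seq (.store 11 (.reg 7) (.add (.load 9 (.reg 7)) (.reg 4))) <|
    .seq (.store 12 (.reg 7) (.add (.load 8 (.reg 7)) (.reg 3))) <|
    .set 13 (.add (.reg 13) (.const 1))

theorem coordLoop_run {N W : ℕ} {f : Fin 3 → ℕ → ℕ} {s : State}
    (hf : Mates N f) (hW : 2 * N + 2 ≤ W) (hm : HasMates N f s)
    (hs : Finished N f (s.arr 8) (s.arr 9) (s.arr 10) (s.reg 3) (s.reg 4))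
    (hle : s.reg 13 ≤ s.reg 3) :
    Run W coordLoop s fun t s' =>
      (∀ v < N, s.reg 13 < s.arr 8 v →
        s'.arr 11 v = s.arr 9 v + s.reg 4 ∧ s'.arr 12 v = s.arr 8 v + s.reg 3) ∧
      (∀ v < N, s.arr 8 v ≤ s.reg 13 →
        s'.arr 11 v = s.arr 11 v ∧ s'.arr 12 v = s.arr 12 v) ∧
      Frame [7, 13] [11, 12] s s' ∧ t + 60 * s.reg 13 ≤ 60 * s.reg 3 + 60 := by
  have hcy := hs.rows.le_card
  have hcx := hs.cols.le_card
  refine Run.loop (fun t s' =>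
      (∀ v < N, s.reg 13 < s.arr 8 v → s.arr 8 v ≤ s'.reg 13 →
        s'.arr 11 v = s.arr 9 v + s.reg 4 ∧ s'.arr 12 v = s.arr 8 v + s.reg 3) ∧
      (∀ v < N, s.arr 8 v ≤ s.reg 13 →
        s'.arr 11 v = s.arr 11 v ∧ s'.arr 12 v = s.arr 12 v) ∧
      Frame [7, 13] [11, 12] s s' ∧ s.reg 13 ≤ s'.reg 13 ∧ s'.reg 13 ≤ s.reg 3 ∧
      t + 60 * s.reg 13 ≤ 60 * s'.reg 13)
    (fun s' => N - s'.reg 13)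
    ⟨fun v _ h h' => by omega, fun _ _ _ => ⟨rfl, rfl⟩, Frame.refl s, le_rfl, hle, by omega⟩ ?_ ?_
  · rintro t s' ⟨h1, h2, hF, hl, hl', ht⟩ hb
    simp only [Test.holds, Expr.eval] at hb
    have r3 := hF.reg 3 (by decide)
    have r4 := hF.reg 4 (by decide)
    have a8 := hF.arr 8 (by decide)
    have a9 := hF.arr 9 (by decide)
    have a10 := hF.arr 10 (by decide)
    have a5 : ∀ v < N, s'.arr 5 v = f 0 v := (hm.frame hF (by decide) (by decide) (by decide)).fst
    rw [r3] at hb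
    generalize hi : s'.reg 13 = i at *
    have hR := hs.rows.lt _ hb
    have hx := hf.lt 0 _ hR
    have hr := hs.rows.fst _ hb
    have hrx := hs.rows.snd _ hb
    have hmem := hs.rows.mem
    have hne := hf.ne_self 0 _ hR
    have c1 := hs.cols.le _ hR (hs.row_col _ hR (by omega))
    have c2 := hs.cols.le _ hx (hs.row_col _ hx (by omega))
    have h5 := a5 _ hR
    generalize hg : s.arr 10 i = g at *
    refine Run.seq (Run.set ?_ ?_)
    · simp [Expr.eval, hi, a10, hg]; omega
    refine Run.seq (Run.store ?_ ?_ ?_)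
    · simp [Expr.eval, State.setReg_reg, hi, a10, hg]; omega
    · simp [Expr.eval, State.setReg_reg, hi, a10, hg, a9, r4]; omega
    refine Run.seq (Run.store ?_ ?_ ?_)
    · simp [Expr.eval, State.setReg_reg, hi, a10, hg]; omega
    · simp [Expr.eval, State.setReg_reg, State.setArr_arr, hi, a10, hg, a8, r3]; omega
    refine Run.seq (Run.set ?_ ?_)
    · simp [Expr.eval, State.setReg_reg, State.setArr_arr, hi, a10, hg, h5]; omega
    refine Run.seq (Run.store ?_ ?_ ?_)
    · simp [Expr.eval, State.setReg_reg, State.setArr_arr, hi, a10, hg, h5]; omega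
    · simp [Expr.eval, State.setReg_reg, State.setArr_arr, hi, a10, hg, h5, a9, r4]; omega
    refine Run.seq (Run.store ?_ ?_ ?_)
    · simp [Expr.eval, State.setReg_reg, State.setArr_arr, hi, a10, hg, h5]; omega
    · simp [Expr.eval, State.setReg_reg, State.setArr_arr, hi, a10, hg, h5, a8, r3]; omega
    refine Run.set ?_ ?_
    · simp [Expr.eval, State.setReg_reg, hi]; omega
    refine ⟨⟨?_, ?_, ?_, ?_, ?_, ?_⟩, ?_⟩
    · intro v hv k1 k2
      simp [Expr.eval, State.setReg_reg, State.setArr_arr, hi, a10, hg, h5, a8, a9, r3, r4,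
        Function.update_apply] at k2 ⊢
      have m := hmem v hv (by omega)
      have := h1 v hv k1
      by_cases k3 : s.arr 8 v ≤ i
      · have : v ≠ g := by rintro rfl; omega
        have : v ≠ f 0 g := by rintro rfl; omega
        simp_all
      · have : s.arr 8 v - 1 = i := by omega
        rw [this, hg] at m
        rcases m with rfl | rfl
        · simp [hne.symm]
        · simp
    · intro v hv k1
      have : v ≠ g := by rintro rfl; omega
      have : v ≠ f 0 g := by rintro rfl; omega
      have := h2 v hv k1
      simp_all [Expr.eval, State.setReg_reg, State.setArr_arr]
    · repeat' first
        | exact hF | refine Frame.setReg ?_ (by decide) | refine Frame.setArr ?_ (by decide)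
    · simp [Expr.eval, State.setReg_reg, hi]; omega
    · simp [Expr.eval, State.setReg_reg, hi]; omega
    · simp [Expr.eval, Expr.cost, Test.cost, State.setReg_reg, hi]
      omega
    · simp [Expr.eval, State.setReg_reg, hi]
      omega
  · rintro t s' ⟨h1, h2, hF, hl, hl', ht⟩ hb
    simp only [Test.holds, Expr.eval] at hb
    have r3 := hF.reg 3 (by decide)
    refine ⟨fun v hv c => h1 v hv c ?_, h2, hF, ?_⟩
    · have := hs.rows.le v hv (by omega)
      omega
    · simp [Expr.cost, Test.cost]
      omega

/-- Draws the component of the vertex in register `2`. -/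
def component : Program :=
  .seq (.set 10 (.reg 3)) <|
  .seq (.set 11 (.reg 4)) <|
  .seq (.set 6 (.reg 2)) <|
  .seq rowLoop <|
  .seq (.set 8 (.load 6 (.reg 2))) <|
  .seq colLoop <|
  .seq sweepLoop <|
  .seq (.set 13 (.reg 10)) <|
  .seq coordLoop <|
  .seq (.store 11 (.load 6 (.reg 2)) (.add (.add (.reg 11) (.reg 11)) (.const 1))) <|
  .store 12 (.reg 2) (.add (.add (.reg 10) (.reg 10)) (.const 1))

/-- Traversing columns from `f 1 q` before the sweep puts the left end of the root into column `sx +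
1`. Registers `10` and `11` save `sy` and `sx`; the last two stores move the ends of the root to `2
* sx + 1` and `2 * sy + 1`. -/
theorem component_run {N W : ℕ} {f : Fin 3 → ℕ → ℕ} {s : State}
    (hf : Mates N f) (hW : 2 * N + 2 ≤ W) (hm : HasMates N f s)
    (hs : Finished N f (s.arr 8) (s.arr 9) (s.arr 10) (s.reg 3) (s.reg 4))
    (hd : Drawn N f (s.arr 8) (s.reg 3) (s.reg 4) (s.arr 11) (s.arr 12))
    (ha : s.reg 5 = s.reg 3) (hq : s.reg 2 < N) (h0 : s.arr 8 (s.reg 2) = 0) :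
    Run W component s fun t s' =>
      Finished N f (s'.arr 8) (s'.arr 9) (s'.arr 10) (s'.reg 3) (s'.reg 4) ∧
      Drawn N f (s'.arr 8) (s'.reg 3) (s'.reg 4) (s'.arr 11) (s'.arr 12) ∧
      s'.reg 5 = s'.reg 3 ∧ (∀ v < N, s.arr 8 v ≠ 0 → s'.arr 8 v ≠ 0) ∧
      s'.arr 8 (s.reg 2) ≠ 0 ∧ Frame [3, 4, 5, 6, 7, 8, 9, 10, 11, 13] [8, 9, 10, 11, 12] s s' ∧
      t + 1000 * (s.reg 3 + s.reg 4) ≤ 1000 * (s'.reg 3 + s'.reg 4) + 2000 := by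
  have hcy := hs.rows.le_card
  have hcx := hs.cols.le_card
  generalize eq : s.reg 2 = q at *
  have hq1 := hf.lt 1 q hq
  refine Run.seq (Run.set (by simp only [Expr.eval]; omega) ?_)
  refine Run.seq (Run.set (by simp [Expr.eval, State.setReg_reg]; omega) ?_)
  refine Run.seq (Run.set (by simp [Expr.eval, State.setReg_reg]; omega) ?_)
  simp only [Expr.eval, State.setReg_reg, Expr.cost, Nat.reduceEqDiff, if_false]
  generalize hS : State.setReg _ 6 _ = S₁
  have F₁ : Frame [3, 4, 5, 6, 7, 8, 9, 10, 11, 13] [8, 9, 10, 11, 12] s S₁ := by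
    subst hS
    repeat' first | exact Frame.refl s | refine Frame.setReg ?_ (by decide)
  have a₁ : S₁.arr = s.arr := by subst hS; rfl
  have r₁3 : S₁.reg 3 = s.reg 3 := by subst hS; simp [State.setReg_reg]
  have r₁4 : S₁.reg 4 = s.reg 4 := by subst hS; simp [State.setReg_reg]
  have r₁5 : S₁.reg 5 = s.reg 5 := by subst hS; simp [State.setReg_reg]
  have r₁6 : S₁.reg 6 = q := by subst hS; simp [State.setReg_reg, eq]
  have r₁10 : S₁.reg 10 = s.reg 3 := by subst hS; simp [State.setReg_reg]
  have r₁11 : S₁.reg 11 = s.reg 4 := by subst hS; simp [State.setReg_reg]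
  clear hS
  refine Run.seq (Run.mono (rowLoop_run hf hW (hm.frame F₁ (by decide) (by decide) (by decide))
    (by rw [r₁6]; exact hq) (by rw [a₁, r₁3]; exact hs.rows) (by rw [a₁]; exact hs.closed)) ?_)
  rintro t₂ S₂ ⟨hrc, G₂, ht₂⟩
  rw [a₁, r₁3, r₁6] at hrc
  have F₂ := F₁.trans (G₂.mono (by decide) (by decide))
  have hst := hs.stage hf hq h0 hrc
  have hse := hs.settled hf hrc
  have hroot := hrc.root_not_rung hf hq h0
  have hcol := hs.col_root hf hq h0
  have h6 := (hm.frame F₂ (by decide) (by decide) (by decide)).mid q hq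
  have r₂2 : S₂.reg 2 = q := by rw [F₂.reg 2 (by decide), eq]
  have a₂9 : S₂.arr 9 = s.arr 9 := by rw [G₂.arr 9 (by decide), a₁]
  have r₂4 : S₂.reg 4 = s.reg 4 := by rw [G₂.reg 4 (by decide), r₁4]
  refine Run.seq (Run.set (by simp only [Expr.eval, r₂2, h6]; omega) ?_)
  simp only [Expr.eval, r₂2, h6, Expr.cost]
  generalize hS : State.setReg _ 8 _ = S₃
  have r₃ : ∀ r, r ≠ 8 → S₃.reg r = S₂.reg r := by
    intro r hr; subst hS; rw [State.setReg_reg, if_neg hr]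
  have a₃ : S₃.arr = S₂.arr := by subst hS; rfl
  have r₃8 : S₃.reg 8 = f 1 q := by subst hS; simp [State.setReg_reg]
  have F₃ : Frame [3, 4, 5, 6, 7, 8, 9, 10, 11, 13] [8, 9, 10, 11, 12] s S₃ := by
    subst hS; exact F₂.setReg (by decide)
  clear hS
  refine Run.seq (Run.mono (colLoop_run (sy := s.reg 3) (sx := s.reg 4) (q := q) hf hW
    (hm.frame F₃ (by decide) (by decide) (by decide)) (by rw [r₃8]; exact hq1)
    (by rw [r₃8, a₃]; exact hst.closed q hq hrc.start_ne)
    (by rw [a₃, r₃ 3 (by decide), r₃ 4 (by decide), a₂9, r₂4]; exact hst)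
    (by rw [a₃, a₂9]; exact hse)
    (by
      intro _
      rw [r₃8, a₃]
      exact ⟨hroot.1, fun h => absurd h hroot.2⟩)) ?_)
  rintro t₄ S₄ ⟨hcc, G₄, ht₄⟩
  rw [a₃, r₃ 3 (by decide), r₃ 4 (by decide), a₂9, r₂4, r₃8] at hcc
  have hsw := hcc.sweep hrc.ext hcol hrc.le
  have F₄ := F₃.trans (G₄.mono (by decide) (by decide))
  have r₄5 : S₄.reg 5 = s.reg 3 := by
    rw [G₄.reg 5 (by decide), r₃ 5 (by decide), G₂.reg 5 (by decide), r₁5, ha]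
  refine Run.seq (Run.mono (sweepLoop_run (sy := s.reg 3) (sx := s.reg 4) (q := q)
    (row₀ := s.arr 8) hf hW (hm.frame F₄ (by decide) (by decide) (by decide))
    (by rw [r₄5]; exact hsw)) ?_)
  rintro t₅ S₅ ⟨hsw', r₅5, G₅, ht₅⟩
  have F₅ := F₄.trans (G₅.mono (by decide) (by decide))
  have hfin := hsw'.finished hf
  have hle₅ := hsw'.stage.le_row
  have hlx₅ := hsw'.stage.le_col
  have hcy₅ := hfin.rows.le_card
  have hcx₅ := hfin.cols.le_card
  have r₅10 : S₅.reg 10 = s.reg 3 := by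
    rw [G₅.reg 10 (by decide), G₄.reg 10 (by decide), r₃ 10 (by decide), G₂.reg 10 (by decide),
      r₁10]
  have r₅11 : S₅.reg 11 = s.reg 4 := by
    rw [G₅.reg 11 (by decide), G₄.reg 11 (by decide), r₃ 11 (by decide), G₂.reg 11 (by decide),
      r₁11]
  have a₅11 : S₅.arr 11 = s.arr 11 := by
    rw [G₅.arr 11 (by decide), G₄.arr 11 (by decide), a₃, G₂.arr 11 (by decide), a₁]
  have a₅12 : S₅.arr 12 = s.arr 12 := by
    rw [G₅.arr 12 (by decide), G₄.arr 12 (by decide), a₃, G₂.arr 12 (by decide), a₁]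
  refine Run.seq (Run.set (by simp only [Expr.eval, r₅10]; omega) ?_)
  simp only [Expr.eval, r₅10, Expr.cost]
  generalize hS : State.setReg _ 13 _ = S₆
  have r₆ : ∀ r, r ≠ 13 → S₆.reg r = S₅.reg r := by
    intro r hr; subst hS; rw [State.setReg_reg, if_neg hr]
  have a₆ : S₆.arr = S₅.arr := by subst hS; rfl
  have r₆13 : S₆.reg 13 = s.reg 3 := by subst hS; simp [State.setReg_reg]
  have F₆ : Frame [3, 4, 5, 6, 7, 8, 9, 10, 11, 13] [8, 9, 10, 11, 12] s S₆ := by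
    subst hS; exact F₅.setReg (by decide)
  clear hS
  refine Run.seq (Run.mono (coordLoop_run hf hW
    (hm.frame F₆ (by decide) (by decide) (by decide))
    (by rw [a₆, r₆ 3 (by decide), r₆ 4 (by decide)]; exact hfin)
    (by rw [r₆13, r₆ 3 (by decide)]; omega)) ?_)
  rintro t₇ S₇ ⟨hnew, hold, G₇, ht₇⟩
  rw [a₆, r₆13] at hnew hold
  rw [r₆ 3 (by decide), r₆ 4 (by decide)] at hnew
  rw [a₅11, a₅12] at hold
  rw [r₆13, r₆ 3 (by decide)] at ht₇
  have F₇ := F₆.trans (G₇.mono (by decide) (by decide))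
  have r₇2 : S₇.reg 2 = q := by rw [F₇.reg 2 (by decide), eq]
  have h7 := (hm.frame F₇ (by decide) (by decide) (by decide)).mid q hq
  have r₇3 : S₇.reg 3 = S₅.reg 3 := by rw [G₇.reg 3 (by decide), r₆ 3 (by decide)]
  have r₇4 : S₇.reg 4 = S₅.reg 4 := by rw [G₇.reg 4 (by decide), r₆ 4 (by decide)]
  have r₇5 : S₇.reg 5 = S₅.reg 5 := by rw [G₇.reg 5 (by decide), r₆ 5 (by decide)]
  have r₇10 : S₇.reg 10 = s.reg 3 := by
    rw [G₇.reg 10 (by decide), r₆ 10 (by decide), r₅10]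
  have r₇11 : S₇.reg 11 = s.reg 4 := by
    rw [G₇.reg 11 (by decide), r₆ 11 (by decide), r₅11]
  have a₇8 : S₇.arr 8 = S₅.arr 8 := by rw [G₇.arr 8 (by decide), a₆]
  have a₇9 : S₇.arr 9 = S₅.arr 9 := by rw [G₇.arr 9 (by decide), a₆]
  have a₇10 : S₇.arr 10 = S₅.arr 10 := by rw [G₇.arr 10 (by decide), a₆]
  refine Run.seq (Run.store ?_ ?_ ?_)
  · simp only [Expr.eval, r₇2, h7]; omega
  · simp only [Expr.eval, r₇11]; omega
  refine Run.store ?_ ?_ ?_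
  · simp only [Expr.eval, State.setArr_reg, r₇2]; omega
  · simp only [Expr.eval, State.setArr_reg, r₇10]; omega
  simp only [Expr.eval, State.setArr_reg, State.setArr_arr, Expr.cost, r₇2, r₇3, r₇4, r₇5, r₇10,
    r₇11, h7, a₇8, a₇9, a₇10, Nat.reduceEqDiff, if_false, if_true]
  have hrow0 : ∀ v < N, s.arr 8 v ≠ 0 → S₅.arr 8 v = s.arr 8 v := hsw'.ext.keep
  refine ⟨hfin, ?_, r₅5, ?_, ?_, ?_, ?_⟩
  · refine hsw'.drawn hf hs hd ?_ ⟨?_, ?_, ?_, ?_⟩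
    · intro v hv c
      have e1 : v ≠ q := by rintro rfl; exact c h0
      -- The two final stores do not touch earlier components, which are closed under `f 1` and do
      -- not contain `q`.
      have e2 : v ≠ f 1 q := by
        rintro rfl
        have := hs.closed _ hq1 c
        rw [hf.invol 1 q hq] at this
        exact this h0
      rw [Function.update_of_ne e1, Function.update_of_ne e2]
      have := hrow0 v hv c
      have := hs.rows.le v hv c
      exact hold v hv (by omega)
    · rintro v ⟨hv, c⟩ e
      rw [Function.update_of_ne e]
      exact (hnew v hv c).1
    · rintro v ⟨hv, c⟩ e
      rw [Function.update_of_ne e]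
      exact (hnew v hv c).2
    · rw [Function.update_self]; omega
    · rw [Function.update_self]; omega
  · intro v hv c
    rw [hrow0 v hv c]
    exact c
  · have := hsw'.stage.row_root
    omega
  · exact (F₇.setArr (by decide)).setArr (by decide)
  · have := r₃ 3 (by decide)
    have := r₃ 4 (by decide)
    have := hrc.le
    have := hcc.le_row
    have := hcc.le_col
    omega

/-- Draws all components of the graph on the vertices `0, …, N - 1`, with `N` in register `14`. -/
def drawLoop : Program :=
  .while (.lt (.reg 2) (.reg 14)) <|
    .seq (.ite (.eq (.load 8 (.reg 2)) (.const 0)) component .skip) <|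
    .set 2 (.add (.reg 2) (.const 1))

theorem drawLoop_run {N W : ℕ} {f : Fin 3 → ℕ → ℕ} {s : State}
    (hf : Mates N f) (hW : 2 * N + 2 ≤ W) (hm : HasMates N f s)
    (h2 : s.reg 2 = 0) (h3 : s.reg 3 = 0) (h4 : s.reg 4 = 0) (h5 : s.reg 5 = 0)
    (h14 : s.reg 14 = N) (h8 : ∀ v < N, s.arr 8 v = 0) (h9 : ∀ v < N, s.arr 9 v = 0) :
    Run W drawLoop s fun t s' =>
      Good N f {v | v < N} (s'.arr 11) (s'.arr 12) ∧
      (∀ v < N, s'.arr 11 v ≤ 2 * N ∧ s'.arr 12 v ≤ 2 * N) ∧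
      Frame [2, 3, 4, 5, 6, 7, 8, 9, 10, 11, 13] [8, 9, 10, 11, 12] s s' ∧
      t ≤ 6000 * N + 6000 := by
  refine Run.loop (fun t s' =>
      Finished N f (s'.arr 8) (s'.arr 9) (s'.arr 10) (s'.reg 3) (s'.reg 4) ∧
      Drawn N f (s'.arr 8) (s'.reg 3) (s'.reg 4) (s'.arr 11) (s'.arr 12) ∧
      s'.reg 5 = s'.reg 3 ∧ (∀ v < s'.reg 2, s'.arr 8 v ≠ 0) ∧ s'.reg 2 ≤ N ∧
      Frame [2, 3, 4, 5, 6, 7, 8, 9, 10, 11, 13] [8, 9, 10, 11, 12] s s' ∧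
      t ≤ 1000 * (s'.reg 3 + s'.reg 4) + 3000 * s'.reg 2)
    (fun s' => N - s'.reg 2) ⟨⟨⟨?_, ?_, ?_, ?_, ?_⟩, ⟨?_, ?_, ?_, ?_⟩, ?_, ?_, ?_⟩, ⟨?_, ?_⟩,
      by omega, by omega, by omega, Frame.refl s, by omega⟩ ?_ ?_
  · intro ρ hρ; omega
  · intro ρ hρ; omega
  · intro ρ hρ; omega
  · exact fun v hv c => absurd (h8 v hv) c
  · exact fun v hv c => absurd (h8 v hv) c
  · exact fun v hv c => absurd (h9 v hv) c
  · exact fun v hv c => absurd (h9 v hv) c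
  · exact fun v hv _ _ c => absurd (h9 v hv) c
  · intro i hi; omega
  · exact fun v hv c => absurd (h9 v hv) c
  · exact fun v hv c => absurd (h8 v hv) c
  · exact fun v hv c => absurd (h8 v hv) c
  · have : {v | v < N ∧ s.arr 8 v ≠ 0} = ∅ := by
      ext v
      simp only [Set.mem_ofPred_eq, Set.mem_empty_iff_false, iff_false]
      exact fun h => h.2 (h8 v h.1)
    rw [this]
    refine ⟨?_, ?_, ?_, ?_, ?_, ?_, ?_, ?_⟩ <;> simp
  · exact fun v hv c => absurd (h8 v hv) c
  · rintro t s' ⟨hfin, hd, ha, hq, hqN, hF, ht⟩ hb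
    simp only [Test.holds, Expr.eval] at hb
    rw [hF.reg 14 (by decide), h14] at hb
    refine Run.seq (Run.ite ?_ ?_)
    · intro h0
      simp only [Test.holds, Expr.eval] at h0
      refine Run.mono (component_run hf hW (hm.frame hF (by decide) (by decide) (by decide))
        hfin hd ha hb h0) ?_
      rintro t' s'' ⟨hfin', hd', ha', hk, hq0, hF', ht'⟩
      have r2 := hF'.reg 2 (by decide)
      refine Run.set (by simp only [Expr.eval]; omega) ?_
      simp only [Expr.eval, State.setReg_arr, State.setReg_reg, Expr.cost, Test.cost,
        Nat.reduceEqDiff, if_false, if_true]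
      refine ⟨⟨hfin', hd', ha', ?_, by omega,
        (hF.trans (hF'.mono (by decide) (by decide))).setReg (by decide), by omega⟩, by omega⟩
      intro v hv
      by_cases e : v = s'.reg 2
      · rw [e]; exact hq0
      · exact hk v (by omega) (hq v (by omega))
    · intro h0
      simp only [Test.holds, Expr.eval] at h0
      refine Run.skip ?_
      refine Run.set (by simp only [Expr.eval]; omega) ?_
      simp only [Expr.eval, State.setReg_arr, State.setReg_reg, Expr.cost, Test.cost,
        Nat.reduceEqDiff, if_false, if_true]
      refine ⟨⟨hfin, hd, ha, ?_, by omega, hF.setReg (by decide), by omega⟩, by omega⟩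
      intro v hv
      by_cases e : v = s'.reg 2
      · rw [e]; exact h0
      · exact hq v (by omega)
  · rintro t s' ⟨hfin, hd, ha, hq, hqN, hF, ht⟩ hb
    simp only [Test.holds, Expr.eval] at hb
    rw [hF.reg 14 (by decide), h14] at hb
    have hcy := hfin.rows.le_card
    have hcx := hfin.cols.le_card
    have hall : ∀ v < N, s'.arr 8 v ≠ 0 := fun v hv => hq v (by omega)
    have hset : {v | v < N ∧ s'.arr 8 v ≠ 0} = {v | v < N} := by
      ext v
      exact ⟨fun h => h.1, fun h => ⟨h, hall v h⟩⟩
    refine ⟨hset ▸ hd.good, fun v hv => ?_, hF, ?_⟩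
    · have := hd.le v hv (hall v hv)
      omega
    · simp only [Test.cost, Expr.cost]
      omega

/-! ### Reduction to cubic graphs by taking four copies. -/

/-- `M i v` is `0` or `t + 1`, where `t` is the mate of `v` in the matching number `i`. -/
structure PartialMates (n : ℕ) (M : Fin 3 → ℕ → ℕ) : Prop where
  le : ∀ i, ∀ v < n, M i v ≤ n
  invol : ∀ i, ∀ v < n, M i v ≠ 0 → M i (M i v - 1) = v + 1
  ne_self : ∀ i, ∀ v < n, M i v ≠ v + 1
  ne : ∀ i j, i ≠ j → ∀ v < n, M i v ≠ 0 → M i v ≠ M j v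

/-- Three disjoint perfect matchings of the complete graph on four vertices. -/
def quad (i : Fin 3) (k : ℕ) : ℕ := k ^^^ (i + 1)

/-- Four copies of a graph with partial matchings, made cubic by adding edges between the copies of
a vertex. -/
def copies (M : Fin 3 → ℕ → ℕ) (i : Fin 3) (x : ℕ) : ℕ :=
  if M i (x / 4) = 0 then 4 * (x / 4) + quad i (x % 4) else 4 * (M i (x / 4) - 1) + x % 4

theorem quad_lt (i : Fin 3) : ∀ k < 4, quad i k < 4 := by
  fin_cases i <;> decide

theorem quad_invol (i : Fin 3) : ∀ k < 4, quad i (quad i k) = k := by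
  fin_cases i <;> decide

theorem quad_ne_self (i : Fin 3) : ∀ k < 4, quad i k ≠ k := by
  fin_cases i <;> decide

theorem quad_ne (i j : Fin 3) (h : i ≠ j) : ∀ k < 4, quad i k ≠ quad j k := by
  revert h
  fin_cases i <;> fin_cases j <;> decide

/-- Edges of `G` join copies of different vertices with the same index; added edges join different
copies of one vertex. So the two kinds never coincide, and each kind inherits the matching
properties from `M` or from `quad`. -/
theorem PartialMates.copies {n : ℕ} {M : Fin 3 → ℕ → ℕ} (h : PartialMates n M) :
    Mates (4 * n) (copies M) := by
  have div : ∀ v < 4 * n, v / 4 < n := fun v hv => by omega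
  refine ⟨?_, ?_, ?_, ?_⟩
  · intro i v hv
    have := h.le i _ (div v hv)
    have := quad_lt i (v % 4) (by omega)
    unfold RAC.copies
    split_ifs <;> omega
  · intro i v hv
    have l := quad_lt i (v % 4) (by omega)
    have := quad_invol i (v % 4) (by omega)
    have := h.invol i _ (div v hv)
    by_cases c : M i (v / 4) = 0
    · have e : RAC.copies M i v = 4 * (v / 4) + quad i (v % 4) := by simp [RAC.copies, c]
      have e1 : RAC.copies M i v / 4 = v / 4 := by omega
      have e2 : RAC.copies M i v % 4 = quad i (v % 4) := by omega
      rw [RAC.copies.eq_def M i (RAC.copies M i v)]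
      rw [e1, e2, if_pos c]
      omega
    · have e : RAC.copies M i v = 4 * (M i (v / 4) - 1) + v % 4 := by simp [RAC.copies, c]
      have e1 : RAC.copies M i v / 4 = M i (v / 4) - 1 := by omega
      have e2 : RAC.copies M i v % 4 = v % 4 := by omega
      rw [RAC.copies.eq_def M i (RAC.copies M i v)]
      rw [e1, e2, this c, if_neg (by omega)]
      simp
      omega
  · intro i v hv
    have := h.ne_self i _ (div v hv)
    have := quad_ne_self i (v % 4) (by omega)
    unfold RAC.copies
    split_ifs <;> omega
  · intro i j hij v hv
    have := h.ne i j hij _ (div v hv)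
    have := h.ne_self i _ (div v hv)
    have := h.ne_self j _ (div v hv)
    have := quad_lt i (v % 4) (by omega)
    have := quad_lt j (v % 4) (by omega)
    have := quad_ne i j hij (v % 4) (by omega)
    unfold RAC.copies
    split_ifs <;> omega

/-- `M` describes the color classes of `c`. -/
structure Describes {n : ℕ} {G : SimpleGraph (Fin n)} (c : EdgeColoring G) (M : Fin 3 → ℕ → ℕ) :
    Prop where
  adj : ∀ u v (h : G.Adj u v), M (c ⟨s(u, v), h⟩) u = v + 1
  exists_adj : ∀ i (u : Fin n), M i u ≠ 0 → ∃ v, ∃ h : G.Adj u v, c ⟨s(u, v), h⟩ = i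

theorem eq_of_color {n : ℕ} {G : SimpleGraph (Fin n)} (c : EdgeColoring G) {u v v' : Fin n}
    (h : G.Adj u v) (h' : G.Adj u v') (e : c ⟨s(u, v), h⟩ = c ⟨s(u, v'), h'⟩) : v = v' := by
  by_contra hne
  refine c.valid (v := ⟨s(u, v), h⟩) (w := ⟨s(u, v'), h'⟩) ?_ e
  rw [SimpleGraph.lineGraph_adj_iff_exists]
  refine ⟨?_, u, by simp, by simp⟩
  intro hh
  have := congrArg Subtype.val hh
  simp only [Sym2.congr_right] at this
  exact hne this

theorem Describes.partialMates {n : ℕ} {G : SimpleGraph (Fin n)} {c : EdgeColoring G}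
    {M : Fin 3 → ℕ → ℕ} (h : Describes c M) : PartialMates n M := by
  have key : ∀ i, ∀ v (hv : v < n), M i v ≠ 0 →
      ∃ t : Fin n, M i v = t + 1 ∧ M i t = v + 1 ∧ (t : ℕ) ≠ v ∧
        ∃ ha : G.Adj ⟨v, hv⟩ t, c ⟨s(⟨v, hv⟩, t), ha⟩ = i := by
    intro i v hv c0
    obtain ⟨t, ht, e⟩ := h.exists_adj i ⟨v, hv⟩ c0
    refine ⟨t, ?_, ?_, ?_, ht, e⟩
    · have := h.adj _ _ ht
      rwa [e] at this
    · have := h.adj _ _ ht.symm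
      have e' : c ⟨s(t, ⟨v, hv⟩), ht.symm⟩ = i := by
        rw [← e]; congr 2; exact Sym2.eq_swap
      rwa [e'] at this
    · intro hh
      exact ht.ne (Fin.ext hh.symm)
  refine ⟨?_, ?_, ?_, ?_⟩
  · intro i v hv
    by_cases c0 : M i v = 0
    · omega
    · obtain ⟨t, e, -⟩ := key i v hv c0
      have := t.2
      omega
  · intro i v hv c0
    obtain ⟨t, e, e', -⟩ := key i v hv c0
    rw [e, Nat.add_sub_cancel, e']
  · intro i v hv e
    obtain ⟨t, e', -, hne, -⟩ := key i v hv (by omega)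
    omega
  · intro i j hij v hv c0 e
    obtain ⟨t, e1, -, -, ha, h1⟩ := key i v hv c0
    obtain ⟨t', e1', -, -, ha', h1'⟩ := key j v hv (by omega)
    have : t = t' := Fin.ext (by omega)
    subst this
    exact hij (h1.symm.trans h1')

/-- The copies with index 0 carry `G` with its coloring; this is the embedding used in
`Good.drawing`. -/
theorem Describes.copies_adj {n : ℕ} {G : SimpleGraph (Fin n)} {c : EdgeColoring G}
    {M : Fin 3 → ℕ → ℕ} (h : Describes c M) (u v : Fin n) (ha : G.Adj u v) :
    4 * (v : ℕ) = copies M (c ⟨s(u, v), ha⟩) (4 * (u : ℕ)) := by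
  have e := h.adj u v ha
  have e1 : 4 * (u : ℕ) / 4 = u := by omega
  have e2 : 4 * (u : ℕ) % 4 = 0 := by omega
  simp [copies, e1, e2, e]

/-! ### Reading the input, building the cubic graph, writing the output. -/

theorem EdgeList.card_le {n m : ℕ} {G : SimpleGraph (Fin n)} (L : EdgeList G m)
    (c : EdgeColoring G) : m ≤ 3 * n := by
  -- An edge is determined by one end and its color, so a pass over the edges takes time linear in
  -- `n`.
  have inj : Function.Injective fun i : Fin m => (L.src i, c (L.edge i)) := by
    intro i j hij
    simp only [Prod.mk.injEq] at hij
    obtain ⟨h1, h2⟩ := hij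
    by_contra hne
    refine c.valid (v := L.edge i) (w := L.edge j) ?_ h2
    rw [SimpleGraph.lineGraph_adj_iff_exists]
    refine ⟨fun h => hne (L.edge.injective h), L.src i, ?_, ?_⟩
    · rw [L.ends]; simp
    · rw [L.ends, h1]; simp
  have := Fintype.card_le_of_injective _ inj
  simp at this
  omega

/-- Four times the content of a register. -/
def fourTimes (r : ℕ) : Expr := .add (.add (.reg r) (.reg r)) (.add (.reg r) (.reg r))

theorem fourTimes_eval (s : State) (r : ℕ) : (fourTimes r).eval s = 4 * s.reg r := by
  simp only [fourTimes, Expr.eval]; omega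

theorem fourTimes_cost (r : ℕ) : (fourTimes r).cost = 7 := rfl

/-- Makes the vertices in the registers `6` and `7` mates in the array `a`. -/
def storePair (a : ℕ) : Program :=
  .seq (.store a (.reg 6) (.add (.reg 7) (.const 1))) <|
  .store a (.reg 7) (.add (.reg 6) (.const 1))

theorem storePair_run {W a : ℕ} {s : State} (h6 : s.reg 6 + 1 ≤ W) (h7 : s.reg 7 + 1 ≤ W) :
    Run W (storePair a) s fun t s' => t = 10 ∧ s'.reg = s.reg ∧ (∀ b, b ≠ a → s'.arr b = s.arr b) ∧
      s'.arr a = Function.update (Function.update (s.arr a) (s.reg 6) (s.reg 7 + 1)) (s.reg 7)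
        (s.reg 6 + 1) := by
  refine Run.seq (Run.store ?_ ?_ (Run.store ?_ ?_ ⟨?_, ?_, ?_, ?_⟩))
  · simp only [Expr.eval]; omega
  · simp only [Expr.eval]; omega
  · simp only [Expr.eval, State.setArr_reg]; omega
  · simp only [Expr.eval, State.setArr_reg]; omega
  · simp [Expr.cost]
  · rfl
  · intro b hb
    simp [State.setArr_arr, hb]
  · simp [State.setArr_arr, Expr.eval]

/-- Stores the mates for the matching with the number in register `8`. -/
def storeMates : Program :=
  .ite (.eq (.reg 8) (.const 0)) (storePair 13) <|
  .ite (.eq (.reg 8) (.const 1)) (storePair 14) (storePair 15)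

theorem storeMates_run {W : ℕ} {i : Fin 3} {s : State} (h6 : s.reg 6 + 1 ≤ W)
    (h7 : s.reg 7 + 1 ≤ W) (h8 : s.reg 8 = i) :
    Run W storeMates s fun t s' => t ≤ 20 ∧ s'.reg = s.reg ∧
      (∀ b : ℕ, b ≠ 13 + i → s'.arr b = s.arr b) ∧
      s'.arr (13 + i) = Function.update (Function.update (s.arr (13 + i)) (s.reg 6) (s.reg 7 + 1))
        (s.reg 7) (s.reg 6 + 1) := by
  refine Run.ite (fun h => ?_) (fun h => Run.ite (fun h' => ?_) (fun h' => ?_)) <;>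
    simp only [Test.holds, Expr.eval, h8] at *
  · have : i = 0 := Fin.ext (by simpa using h)
    subst this
    refine Run.mono (storePair_run h6 h7) ?_
    rintro t s' ⟨ht, h⟩
    exact ⟨by simp [Test.cost, Expr.cost]; omega, h⟩
  · have : i = 1 := Fin.ext (by simpa using h')
    subst this
    refine Run.mono (storePair_run h6 h7) ?_
    rintro t s' ⟨ht, h⟩
    exact ⟨by simp [Test.cost, Expr.cost]; omega, h⟩
  · have : i = 2 := Fin.ext (by have := i.2; simp; omega)
    subst this
    refine Run.mono (storePair_run h6 h7) ?_
    rintro t s' ⟨ht, h⟩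
    exact ⟨by simp [Test.cost, Expr.cost]; omega, h⟩

/-- Computes the mates for the three color classes. -/
def mateLoop : Program :=
  .while (.lt (.reg 2) (.reg 1)) <|
    .seq (.set 6 (.load 0 (.reg 2))) <|
    .seq (.set 7 (.load 1 (.reg 2))) <|
    .seq (.set 8 (.load 2 (.reg 2))) <|
    .seq storeMates <|
    .set 2 (.add (.reg 2) (.const 1))

theorem mateLoop_run {n m W : ℕ} {G : SimpleGraph (Fin n)} (c : EdgeColoring G)
    (L : EdgeList G m) (hW : 3 * n + 3 ≤ W) :
    Run W mateLoop (L.input c) fun t s' => t ≤ 60 * m + 10 ∧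
      Describes c (fun i => s'.arr (13 + i)) ∧
      Frame [2, 6, 7, 8] [13, 14, 15] (L.input c) s' := by
  have hm := L.card_le c
  have hadj : ∀ j, G.Adj (L.src j) (L.tgt j) := by
    intro j
    have := (L.edge j).2
    rwa [L.ends] at this
  have hcol : ∀ j, c (L.edge j) = c ⟨s(L.src j, L.tgt j), hadj j⟩ := by
    intro j
    congr 1
    exact Subtype.ext (L.ends j)
  -- Two facts are kept: ends of processed edges have nonzero entries, and every nonzero entry names
  -- a neighbor along an edge of that color. Properness of the coloring is needed only at the end,
  -- to see that this neighbor is the right one.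
  refine Run.loop (fun t s' => t ≤ 60 * s'.reg 2 ∧ s'.reg 2 ≤ m ∧
      (∀ j : Fin m, (j : ℕ) < s'.reg 2 → ∀ x : Fin n, x = L.src j ∨ x = L.tgt j →
        s'.arr (13 + (c (L.edge j) : Fin 3)) x ≠ 0) ∧
      (∀ k : Fin 3, ∀ x : Fin n, s'.arr (13 + k) x ≠ 0 →
        ∃ y, ∃ h : G.Adj x y, c ⟨s(x, y), h⟩ = k ∧ s'.arr (13 + k) x = y + 1) ∧
      Frame [2, 6, 7, 8] [13, 14, 15] (L.input c) s')
    (fun s' => m - s'.reg 2) ⟨by omega, ?_, ?_, ?_, Frame.refl _⟩ ?_ ?_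
  · simp [EdgeList.input]
  · intro j hj
    simp [EdgeList.input] at hj
  · intro k x h
    exfalso
    apply h
    have h1 : 13 + (k : ℕ) ≠ 1 := by omega
    have h2 : 13 + (k : ℕ) ≠ 2 := by omega
    simp [EdgeList.input, h1, h2]
  · rintro t s ⟨ht, hle, ha, hb, hF⟩ hlt
    simp only [Test.holds, Expr.eval] at hlt
    rw [hF.reg 1 (by decide)] at hlt
    have hlt' : s.reg 2 < m := by simpa [EdgeList.input] using hlt
    have a0 := congrFun (hF.arr 0 (by decide)) (s.reg 2)
    have a1 := congrFun (hF.arr 1 (by decide)) (s.reg 2)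
    have a2 := congrFun (hF.arr 2 (by decide)) (s.reg 2)
    simp only [EdgeList.input, hlt', dif_pos, if_true, if_false, one_ne_zero,
      OfNat.ofNat_ne_zero, OfNat.ofNat_ne_one] at a0 a1 a2
    generalize hj : (⟨s.reg 2, hlt'⟩ : Fin m) = j at *
    have hj' : s.reg 2 = j := by rw [← hj]
    have hs := (L.src j).2
    have htg := (L.tgt j).2
    have hc3 := (c (L.edge j)).2
    refine Run.seq (Run.set ?_ ?_)
    · simp only [Expr.eval, a0]; omega
    refine Run.seq (Run.set ?_ ?_)
    · simp [Expr.eval, State.setReg_reg, a1]; omega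
    refine Run.seq (Run.set ?_ ?_)
    · simp [Expr.eval, State.setReg_reg, a2]; omega
    simp only [Expr.eval, State.setReg_reg, State.setReg_arr, Expr.cost, Nat.reduceEqDiff,
      if_false, a0, a1, a2]
    generalize hS : State.setReg _ 8 _ = S
    have e6 : S.reg 6 = L.src j := by subst hS; simp [State.setReg_reg]
    have e7 : S.reg 7 = L.tgt j := by subst hS; simp [State.setReg_reg]
    have e8 : S.reg 8 = (c (L.edge j) : Fin 3) := by subst hS; simp [State.setReg_reg]
    have e2 : S.reg 2 = j := by subst hS; simp [State.setReg_reg, hj']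
    have ea : S.arr = s.arr := by subst hS; rfl
    have hFS : Frame [2, 6, 7, 8] [13, 14, 15] (L.input c) S := by
      subst hS
      repeat' first | exact hF | refine Frame.setReg ?_ (by decide)
    clear hS
    refine Run.seq (Run.mono (storeMates_run (by omega) (by omega) e8) ?_)
    rintro t' S' ⟨ht', hreg, hold, hnew⟩
    rw [ea] at hold hnew
    rw [e6, e7] at hnew
    refine Run.set ?_ ?_
    · simp only [Expr.eval, hreg, e2]; omega
    simp only [Expr.eval, State.setReg_reg, State.setReg_arr, Expr.cost, Test.cost,
      if_true, hreg, e2]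
    have hmono : ∀ (k : Fin 3) (x : ℕ), s.arr (13 + k) x ≠ 0 → S'.arr (13 + k) x ≠ 0 := by
      intro k x hx
      by_cases hk : k = c (L.edge j)
      · rw [hk, hnew]
        rw [hk] at hx
        simp only [Function.update_apply]
        split_ifs <;> omega
      · rw [hold _ (by intro h; apply hk; apply Fin.ext; omega)]
        exact hx
    refine ⟨⟨by omega, by omega, ?_, ?_, ?_⟩, by omega⟩
    · intro i hi x hx
      by_cases hij : i = j
      · subst hij
        rw [hnew]
        simp only [Function.update_apply]
        rcases hx with rfl | rfl <;> split_ifs <;> omega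
      · refine hmono _ _ (ha i ?_ x hx)
        have : (i : ℕ) ≠ j := fun h => hij (Fin.ext h)
        omega
    · intro k x hx
      by_cases hk : k = c (L.edge j)
      · subst hk
        rw [hnew] at hx ⊢
        by_cases h1 : x = L.tgt j
        · subst h1
          refine ⟨L.src j, (hadj j).symm, ?_, by simp⟩
          rw [hcol]
          congr 2
          exact Sym2.eq_swap
        · have h1' : (x : ℕ) ≠ L.tgt j := fun h => h1 (Fin.ext h)
          rw [Function.update_of_ne h1'] at hx ⊢
          by_cases h2 : x = L.src j
          · subst h2
            exact ⟨L.tgt j, hadj j, (hcol j).symm, by simp⟩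
          · have h2' : (x : ℕ) ≠ L.src j := fun h => h2 (Fin.ext h)
            rw [Function.update_of_ne h2'] at hx ⊢
            exact hb _ x hx
      · have hne : 13 + (k : ℕ) ≠ 13 + (c (L.edge j) : Fin 3) := by
          intro h; apply hk; apply Fin.ext; omega
        rw [hold _ hne] at hx ⊢
        exact hb k x hx
    · refine Frame.setReg (hFS.trans ⟨fun r _ => by rw [hreg], fun a ha => ?_⟩) (by decide)
      rw [ea]
      refine hold a ?_
      rintro rfl
      apply ha
      generalize c (L.edge j) = k
      fin_cases k <;> simp
  · rintro t s ⟨ht, hle, ha, hb, hF⟩ hlt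
    simp only [Test.holds, Expr.eval] at hlt
    rw [hF.reg 1 (by decide)] at hlt
    have hlt' : m ≤ s.reg 2 := by simpa [EdgeList.input] using hlt
    refine ⟨by simp [Test.cost, Expr.cost]; omega, ⟨?_, ?_⟩, hF⟩
    · intro u v h
      have e := L.edge.apply_symm_apply ⟨s(u, v), h⟩
      generalize L.edge.symm ⟨s(u, v), h⟩ = j at e
      have hu : u ∈ (L.edge j : Sym2 (Fin n)) := by rw [e]; simp
      rw [L.ends, Sym2.mem_iff] at hu
      have h0 := ha j (by have := j.2; omega) u hu
      obtain ⟨y, hy, hc, hv⟩ := hb _ u h0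
      rw [e] at hc hv
      have := eq_of_color c hy h hc
      subst this
      exact hv
    · intro i u h0
      obtain ⟨y, hy, hc, -⟩ := hb i u h0
      exact ⟨y, hy, hc⟩

/-- Stores four values in the cells of the array `a` from the address in register `6` on. -/
def storeFour (a r : ℕ) (g : ℕ → ℕ) : Program :=
  .seq (.store a (.add (.reg 6) (.const 0)) (.add (.reg r) (.const (g 0)))) <|
  .seq (.store a (.add (.reg 6) (.const 1)) (.add (.reg r) (.const (g 1)))) <|
  .seq (.store a (.add (.reg 6) (.const 2)) (.add (.reg r) (.const (g 2)))) <|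
  .store a (.add (.reg 6) (.const 3)) (.add (.reg r) (.const (g 3)))

theorem storeFour_run {W a r : ℕ} {g : ℕ → ℕ} {s : State} (h6 : s.reg 6 + 3 ≤ W)
    (hr : s.reg r + 3 ≤ W) (hg : ∀ k < 4, g k < 4) :
    Run W (storeFour a r g) s fun t s' => t = 28 ∧ s'.reg = s.reg ∧
      (∀ b, b ≠ a → s'.arr b = s.arr b) ∧
      ∀ x, s'.arr a x = if s.reg 6 ≤ x ∧ x < s.reg 6 + 4 then s.reg r + g (x - s.reg 6)
        else s.arr a x := by
  have g0 := hg 0 (by omega)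
  have g1 := hg 1 (by omega)
  have g2 := hg 2 (by omega)
  have g3 := hg 3 (by omega)
  refine Run.seq (Run.store ?_ ?_ (Run.seq (Run.store ?_ ?_ (Run.seq (Run.store ?_ ?_
    (Run.store ?_ ?_ ⟨rfl, rfl, ?_, ?_⟩)))))) <;>
    simp only [Expr.eval, State.setArr_reg]
  any_goals omega
  · intro b hb
    simp [State.setArr_arr, hb]
  · intro x
    simp only [State.setArr_arr, if_true, Function.update_apply]
    by_cases h : s.reg 6 ≤ x ∧ x < s.reg 6 + 4
    · rw [if_pos h]
      obtain ⟨k, rfl⟩ := Nat.exists_eq_add_of_le h.1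
      rcases (by omega : k = 0 ∨ k = 1 ∨ k = 2 ∨ k = 3) with rfl | rfl | rfl | rfl <;> simp
    · rw [if_neg h]
      split_ifs <;> omega

/-- Computes the mates in matching number `i` of the copies of the vertex in register `2`. -/
def copyMates (i : Fin 3) : Program :=
  .seq (.set 7 (.load (13 + i) (.reg 2))) <|
  .ite (.eq (.reg 7) (.const 0)) (storeFour (5 + i) 6 (quad i)) <|
    .seq (.set 7 (.sub (.reg 7) (.const 1))) <|
    .seq (.set 7 (fourTimes 7)) <|
    storeFour (5 + i) 7 id

theorem copyMates_run {n W : ℕ} {M : Fin 3 → ℕ → ℕ} {i : Fin 3} {s : State}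
    (hM : ∀ v < n, M i v ≤ n) (hW : 4 * n + 4 ≤ W) (ha : s.arr (13 + i) = M i)
    (h2 : s.reg 2 < n) (h6 : s.reg 6 = 4 * s.reg 2) :
    Run W (copyMates i) s fun t s' => t ≤ 60 ∧ Frame [7] [5 + i] s s' ∧
      ∀ x, s'.arr (5 + i) x = if x / 4 = s.reg 2 then copies M i x else s.arr (5 + i) x := by
  have hv := hM _ h2
  refine Run.seq (Run.set ?_ (Run.ite (fun h => ?_) (fun h => ?_)))
  · simp only [Expr.eval, ha]; omega
  · simp only [Test.holds, Expr.eval, State.setReg_reg, if_true, ha] at h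
    refine Run.mono (storeFour_run ?_ ?_ (quad_lt i)) ?_
    · simp [State.setReg_reg]; omega
    · simp [State.setReg_reg]; omega
    rintro t s' ⟨ht, hr, hold, hnew⟩
    refine ⟨by simp [Expr.cost, Test.cost]; omega, ⟨fun r hr' => ?_, fun a ha' => ?_⟩, ?_⟩
    · rw [hr, State.setReg_reg, if_neg (by simpa using hr')]
    · rw [hold a (by simpa using ha'), State.setReg_arr]
    · intro x
      rw [hnew]
      simp only [State.setReg_reg, Nat.reduceEqDiff, if_false, State.setReg_arr]
      by_cases hx : x / 4 = s.reg 2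
      · rw [if_pos (by omega), if_pos hx, copies, hx, if_pos h, h6]
        congr 2
        omega
      · rw [if_neg (by omega), if_neg hx]
  · simp only [Test.holds, Expr.eval, State.setReg_reg, if_true, ha] at h
    refine Run.seq (Run.set ?_ (Run.seq (Run.set ?_ ?_)))
    · simp [Expr.eval, State.setReg_reg, ha]; omega
    · simp [fourTimes_eval, Expr.eval, State.setReg_reg, ha]; omega
    refine Run.mono (storeFour_run ?_ ?_ (fun k hk => hk)) ?_
    · simp [State.setReg_reg]; omega
    · simp [fourTimes_eval, Expr.eval, State.setReg_reg, ha]; omega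
    rintro t s' ⟨ht, hr, hold, hnew⟩
    refine ⟨by simp [Expr.cost, Test.cost, fourTimes_cost]; omega,
      ⟨fun r hr' => ?_, fun a ha' => ?_⟩, ?_⟩
    · have : r ≠ 7 := by simpa using hr'
      rw [hr, State.setReg_reg, if_neg this, State.setReg_reg, if_neg this, State.setReg_reg,
        if_neg this]
    · rw [hold a (by simpa using ha')]; rfl
    · intro x
      rw [hnew]
      simp only [State.setReg_reg, Nat.reduceEqDiff, if_false, State.setReg_arr, if_true,
        fourTimes_eval, Expr.eval, ha, id]
      by_cases hx : x / 4 = s.reg 2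
      · rw [if_pos (by omega), if_pos hx, copies, hx, if_neg h, h6]
        congr 1
        omega
      · rw [if_neg (by omega), if_neg hx]

/-- Computes the mates in the cubic graph. -/
def copyLoop : Program :=
  .while (.lt (.reg 2) (.reg 0)) <|
    .seq (.set 6 (fourTimes 2)) <|
    .seq (copyMates 0) <|
    .seq (copyMates 1) <|
    .seq (copyMates 2) <|
    .set 2 (.add (.reg 2) (.const 1))

theorem copyLoop_run {n W : ℕ} {M : Fin 3 → ℕ → ℕ} {s : State}
    (hM : ∀ i, ∀ v < n, M i v ≤ n) (hW : 4 * n + 4 ≤ W) (ha : ∀ i : Fin 3, s.arr (13 + i) = M i)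
    (h0 : s.reg 0 = n) (h2 : s.reg 2 = 0) :
    Run W copyLoop s fun t s' => t ≤ 300 * n + 10 ∧ HasMates (4 * n) (copies M) s' ∧
      Frame [2, 6, 7] [5, 6, 7] s s' := by
  refine Run.loop (fun t s' => t ≤ 300 * s'.reg 2 ∧ s'.reg 2 ≤ n ∧
      HasMates (4 * s'.reg 2) (copies M) s' ∧ Frame [2, 6, 7] [5, 6, 7] s s')
    (fun s' => n - s'.reg 2) ⟨by omega, by omega, ?_, Frame.refl s⟩ ?_ ?_
  · rw [h2]
    exact ⟨fun v hv => by omega, fun v hv => by omega, fun v hv => by omega⟩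
  · rintro t s₀ ⟨ht, hle, hm, hF⟩ hb
    simp only [Test.holds, Expr.eval] at hb
    rw [hF.reg 0 (by decide), h0] at hb
    have ha₀ : ∀ i : Fin 3, s₀.arr (13 + i) = M i := by
      intro i
      rw [hF.arr _ (by fin_cases i <;> decide), ha]
    refine Run.seq (Run.set ?_ ?_)
    · rw [fourTimes_eval]; omega
    rw [fourTimes_eval, fourTimes_cost]
    generalize hS : State.setReg _ 6 _ = S
    have e2 : S.reg 2 = s₀.reg 2 := by subst hS; simp [State.setReg_reg]
    have e6 : S.reg 6 = 4 * s₀.reg 2 := by subst hS; simp [State.setReg_reg]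
    have ea : S.arr = s₀.arr := by subst hS; rfl
    have FS : Frame [2, 6, 7] [5, 6, 7] s S := by subst hS; exact hF.setReg (by decide)
    clear hS
    refine Run.seq (Run.mono (copyMates_run (i := 0) (hM 0) hW (by rw [ea, ha₀])
      (by omega) (by omega)) ?_)
    rintro t₁ S₁ ⟨ht₁, F₁, h₁⟩
    have e₁2 : S₁.reg 2 = s₀.reg 2 := by rw [F₁.reg 2 (by decide), e2]
    have e₁6 : S₁.reg 6 = 4 * s₀.reg 2 := by rw [F₁.reg 6 (by decide), e6]
    refine Run.seq (Run.mono (copyMates_run (i := 1) (hM 1) hW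
      (by rw [F₁.arr _ (by decide), ea, ha₀]) (by omega) (by omega)) ?_)
    rintro t₂ S₂ ⟨ht₂, F₂, h₂⟩
    have e₂2 : S₂.reg 2 = s₀.reg 2 := by rw [F₂.reg 2 (by decide), e₁2]
    have e₂6 : S₂.reg 6 = 4 * s₀.reg 2 := by rw [F₂.reg 6 (by decide), e₁6]
    refine Run.seq (Run.mono (copyMates_run (i := 2) (hM 2) hW
      (by rw [F₂.arr _ (by decide), F₁.arr _ (by decide), ea, ha₀]) (by omega) (by omega)) ?_)
    rintro t₃ S₃ ⟨ht₃, F₃, h₃⟩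
    have e₃2 : S₃.reg 2 = s₀.reg 2 := by rw [F₃.reg 2 (by decide), e₂2]
    refine Run.set ?_ ?_
    · simp only [Expr.eval, e₃2]; omega
    simp only [Expr.eval, State.setReg_reg, Expr.cost, Test.cost, if_true, e₃2]
    refine ⟨⟨by omega, by omega, ⟨?_, ?_, ?_⟩, ?_⟩, by omega⟩
    · intro v hv
      have k3 : S₃.arr 5 = S₂.arr 5 := F₃.arr 5 (by decide)
      have k2 : S₂.arr 5 = S₁.arr 5 := F₂.arr 5 (by decide)
      have k1 := h₁ v
      rw [e2, ea] at k1
      rw [State.setReg_arr, k3, k2]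
      by_cases hx : v / 4 = s₀.reg 2
      · rw [if_pos hx] at k1
        exact k1
      · rw [if_neg hx] at k1
        exact k1.trans (hm.fst v (by omega))
    · intro v hv
      have k3 : S₃.arr 6 = S₂.arr 6 := F₃.arr 6 (by decide)
      have k1 : S₁.arr 6 = S.arr 6 := F₁.arr 6 (by decide)
      have k2 := h₂ v
      rw [e₁2] at k2
      rw [State.setReg_arr, k3]
      by_cases hx : v / 4 = s₀.reg 2
      · rw [if_pos hx] at k2
        exact k2
      · rw [if_neg hx] at k2
        refine k2.trans ?_
        exact (congrFun k1 v).trans ((congrFun (congrFun ea 6) v).trans (hm.mid v (by omega)))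
    · intro v hv
      have k2 : S₂.arr 7 = S₁.arr 7 := F₂.arr 7 (by decide)
      have k1 : S₁.arr 7 = S.arr 7 := F₁.arr 7 (by decide)
      have k3 := h₃ v
      rw [e₂2] at k3
      rw [State.setReg_arr]
      by_cases hx : v / 4 = s₀.reg 2
      · rw [if_pos hx] at k3
        exact k3
      · rw [if_neg hx] at k3
        refine k3.trans ?_
        exact (congrFun k2 v).trans ((congrFun k1 v).trans
          ((congrFun (congrFun ea 7) v).trans (hm.snd v (by omega))))
    · refine Frame.setReg (((FS.trans (F₁.mono (by decide) (by decide))).trans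
        (F₂.mono (by decide) (by decide))).trans (F₃.mono (by decide) (by decide))) (by decide)
  · rintro t s₀ ⟨ht, hle, hm, hF⟩ hb
    simp only [Test.holds, Expr.eval] at hb
    rw [hF.reg 0 (by decide), h0] at hb
    have e : s₀.reg 2 = n := by omega
    rw [e] at hm
    refine ⟨by simp [Test.cost, Expr.cost]; omega, hm, hF⟩

/-- Copies the coordinates of the first copy of every vertex to the arrays `3` and `4`. -/
def outputLoop : Program :=
  .while (.lt (.reg 2) (.reg 0)) <|
    .seq (.set 6 (fourTimes 2)) <|
    .seq (.store 3 (.reg 2) (.load 11 (.reg 6))) <|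
    .seq (.store 4 (.reg 2) (.load 12 (.reg 6))) <|
    .set 2 (.add (.reg 2) (.const 1))

theorem outputLoop_run {n W : ℕ} {s : State} (hW : 8 * n + 8 ≤ W)
    (hX : ∀ v < 4 * n, s.arr 11 v ≤ 8 * n ∧ s.arr 12 v ≤ 8 * n)
    (h0 : s.reg 0 = n) (h2 : s.reg 2 = 0) :
    Run W outputLoop s fun t s' => t ≤ 100 * n + 10 ∧
      ∀ v < n, s'.arr 3 v = s.arr 11 (4 * v) ∧ s'.arr 4 v = s.arr 12 (4 * v) := by
  refine Run.loop (fun t s' => t ≤ 100 * s'.reg 2 ∧ s'.reg 2 ≤ n ∧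
      (∀ v < s'.reg 2, s'.arr 3 v = s.arr 11 (4 * v) ∧ s'.arr 4 v = s.arr 12 (4 * v)) ∧
      Frame [2, 6] [3, 4] s s')
    (fun s' => n - s'.reg 2) ⟨by omega, by omega, by intro v hv; omega, Frame.refl s⟩ ?_ ?_
  · rintro t s' ⟨ht, hle, hv, hF⟩ hb
    simp only [Test.holds, Expr.eval] at hb
    rw [hF.reg 0 (by decide), h0] at hb
    have a11 := hF.arr 11 (by decide)
    have a12 := hF.arr 12 (by decide)
    have hx := hX (4 * s'.reg 2) (by omega)
    refine Run.seq (Run.set ?_ (Run.seq (Run.store ?_ ?_ (Run.seq (Run.store ?_ ?_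
      (Run.set ?_ ⟨⟨?_, ?_, ?_, ?_⟩, ?_⟩))))))
    · rw [fourTimes_eval]; omega
    · simp [Expr.eval, State.setReg_reg]; omega
    · simp [Expr.eval, State.setReg_reg, fourTimes_eval, a11]; omega
    · simp [Expr.eval, State.setReg_reg]; omega
    · simp [Expr.eval, State.setReg_reg, State.setArr_arr, fourTimes_eval, a12]; omega
    · simp [Expr.eval, State.setReg_reg]; omega
    · simp [Expr.eval, Expr.cost, Test.cost, State.setReg_reg, fourTimes_cost]; omega
    · simp [Expr.eval, State.setReg_reg]; omega
    · intro v hv'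
      simp [Expr.eval, State.setReg_reg] at hv'
      simp only [Expr.eval, State.setReg_reg, State.setReg_arr, State.setArr_reg, State.setArr_arr,
        fourTimes_eval, Nat.reduceEqDiff, if_true, if_false, a11, a12, Function.update_apply]
      by_cases e : v = s'.reg 2
      · simp [e]
      · simpa [e] using hv v (by omega)
    · repeat' first
        | exact hF | refine Frame.setReg ?_ (by decide) | refine Frame.setArr ?_ (by decide)
    · simp [Expr.eval, State.setReg_reg]; omega
  · rintro t s' ⟨ht, hle, hv, hF⟩ hb
    simp only [Test.holds, Expr.eval] at hb
    rw [hF.reg 0 (by decide), h0] at hb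
    exact ⟨by simp [Test.cost, Expr.cost]; omega, fun v hv' => hv v (by omega)⟩

/-! ### The whole algorithm. -/

/-- The drawing algorithm. -/
def drawProgram : Program :=
  .seq mateLoop <|
  .seq (.set 2 (.const 0)) <|
  .seq copyLoop <|
  .seq (.set 2 (.const 0)) <|
  .seq (.set 14 (fourTimes 0)) <|
  .seq drawLoop <|
  .seq (.set 2 (.const 0)) <|
  outputLoop

theorem drawProgram_run {n m W : ℕ} {G : SimpleGraph (Fin n)} (c : EdgeColoring G)
    (L : EdgeList G m) (hW : 8 * n + 8 ≤ W) :
    Run W drawProgram (L.input c) fun t s => t ≤ 30000 * (n + 1) ∧ ∃ X Y : Fin n → ℕ,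
      (∀ v : Fin n, s.arr 3 v = X v ∧ s.arr 4 v = Y v) ∧ (∀ v, X v ≤ 8 * n ∧ Y v ≤ 8 * n) ∧
      IsRACDrawing G (gridPos X Y) ∧ RespectsColoring G c (gridPos X Y) := by
  have hm := L.card_le c
  refine Run.seq (Run.mono (mateLoop_run c L (by omega)) ?_)
  rintro t₁ S₁ ⟨ht₁, hD, F₁⟩
  generalize hM : (fun i : Fin 3 => S₁.arr (13 + i)) = M at hD
  have hMi : ∀ i : Fin 3, S₁.arr (13 + i) = M i := fun i => congrFun hM i
  have hP := hD.partialMates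
  have hf := hP.copies
  have r₁0 : S₁.reg 0 = n := by rw [F₁.reg 0 (by decide)]; simp [EdgeList.input]
  have zr : ∀ r, r ≠ 0 → r ≠ 1 → (L.input c).reg r = 0 := by
    intro r h0 h1; simp [EdgeList.input, h0, h1]
  have za : ∀ a v, a ≠ 0 → a ≠ 1 → a ≠ 2 → (L.input c).arr a v = 0 := by
    intro a v h0 h1 h2; simp [EdgeList.input, h0, h1, h2]
  refine Run.seq (Run.set (by simp [Expr.eval]) ?_)
  simp only [Expr.eval, Expr.cost]
  refine Run.seq (Run.mono (copyLoop_run (n := n) (M := M) hP.le (by omega) hMi ?_ ?_) ?_)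
  · simp [State.setReg_reg, r₁0]
  · simp [State.setReg_reg]
  rintro t₃ S₃ ⟨ht₃, hmates, F₃⟩
  have r₃0 : S₃.reg 0 = n := by
    rw [F₃.reg 0 (by decide)]; simp [State.setReg_reg, r₁0]
  have zr₃ : ∀ r, r ∉ [0, 1, 2, 6, 7, 8] → S₃.reg r = 0 := by
    intro r hr
    simp only [List.mem_cons, List.not_mem_nil, or_false, not_or] at hr
    rw [F₃.reg r (by simp; omega), State.setReg_reg, if_neg (by omega), F₁.reg r (by simp; omega),
      zr r (by omega) (by omega)]
  have za₃ : ∀ a v, a ∉ [0, 1, 2, 5, 6, 7, 13, 14, 15] → S₃.arr a v = 0 := by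
    intro a v ha
    simp only [List.mem_cons, List.not_mem_nil, or_false, not_or] at ha
    rw [F₃.arr a (by simp; omega), State.setReg_arr, F₁.arr a (by simp; omega),
      za a v (by omega) (by omega) (by omega)]
  refine Run.seq (Run.set (by simp [Expr.eval]) ?_)
  refine Run.seq (Run.set ?_ ?_)
  · simp [fourTimes_eval, State.setReg_reg, r₃0]; omega
  simp only [Expr.eval, Expr.cost, fourTimes_eval, fourTimes_cost]
  generalize hS : State.setReg _ 14 _ = S₅
  have r₅ : ∀ r, r ≠ 2 → r ≠ 14 → S₅.reg r = S₃.reg r := by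
    intro r h2 h14; subst hS; simp [State.setReg_reg, h2, h14]
  have r₅2 : S₅.reg 2 = 0 := by subst hS; simp [State.setReg_reg]
  have r₅14 : S₅.reg 14 = 4 * n := by subst hS; simp [State.setReg_reg, r₃0]
  have a₅ : S₅.arr = S₃.arr := by subst hS; rfl
  clear hS
  refine Run.seq (Run.mono (drawLoop_run (N := 4 * n) hf (by omega)
    ⟨by rw [a₅]; exact hmates.fst, by rw [a₅]; exact hmates.mid, by rw [a₅]; exact hmates.snd⟩
    r₅2 (by rw [r₅ 3 (by decide) (by decide), zr₃ 3 (by decide)])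
    (by rw [r₅ 4 (by decide) (by decide), zr₃ 4 (by decide)])
    (by rw [r₅ 5 (by decide) (by decide), zr₃ 5 (by decide)]) r₅14
    (fun v _ => by rw [a₅, za₃ 8 v (by decide)])
    (fun v _ => by rw [a₅, za₃ 9 v (by decide)])) ?_)
  rintro t₆ S₆ ⟨hgood, hbd, F₆, ht₆⟩
  have r₆0 : S₆.reg 0 = n := by
    rw [F₆.reg 0 (by decide), r₅ 0 (by decide) (by decide), r₃0]
  refine Run.seq (Run.set (by simp [Expr.eval]) ?_)
  refine Run.mono (outputLoop_run (n := n) hW ?_ ?_ ?_) ?_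
  · intro v hv
    have := hbd v hv
    rw [State.setReg_arr]
    omega
  · simp [State.setReg_reg, r₆0]
  · simp [State.setReg_reg, Expr.eval]
  rintro t₈ S₈ ⟨ht₈, hout⟩
  -- Drawing on `4 * n` vertices costs at most `24000 * n + 6000` steps; the other loops, with `m ≤
  -- 3 * n`, fit into the rest of `30000 * (n + 1)`.
  refine ⟨by simp only [Expr.cost]; omega, fun v => S₆.arr 11 (4 * v), fun v => S₆.arr 12 (4 * v),
    fun v => hout v v.2, fun v => ?_, ?_⟩
  · have := hbd (4 * v) (by have := v.2; omega)
    beta_reduce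
    omega
  · exact hgood.drawing (φ := fun v : Fin n => 4 * (v : ℕ)) hf
      (fun v => by have := v.2; simp only [Set.mem_ofPred_eq]; omega)
      (fun v => by have := v.2; omega)
      (fun u v h => Fin.ext (by simp only at h; omega)) hD.copies_adj

end RAC

theorem theorem1 :
    ∃ (P : WordRAM.Program) (C : ℕ),
      ∀ (n m : ℕ) (G : SimpleGraph (Fin n)) [DecidableRel G.Adj] (_ : G.maxDegree ≤ 3)
        (c : RAC.EdgeColoring G) (L : RAC.EdgeList G m),
        ∃ (t : ℕ) (s : WordRAM.State),
          WordRAM.Exec (C * (n + 1)) P (L.input c) t s ∧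
          t ≤ C * (n + 1) ∧
          ∃ X Y : Fin n → ℕ,
            (∀ v : Fin n, s.arr 3 v = X v ∧ s.arr 4 v = Y v) ∧
            (∀ v : Fin n, X v ≤ C * n ∧ Y v ≤ C * n) ∧
            RAC.IsRACDrawing G (RAC.gridPos X Y) ∧
            RAC.RespectsColoring G c (RAC.gridPos X Y) := by
  refine ⟨RAC.drawProgram, 30000, ?_⟩
  intro n m G _ _ c L
  obtain ⟨t, s, he, ht, X, Y, hout, hbd, hrac⟩ :=
    RAC.drawProgram_run c L (W := 30000 * (n + 1)) (by omega)
  refine ⟨t, s, he, ht, X, Y, hout, fun v => ?_, hrac⟩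
  have := hbd v
  omega
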